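/- Let $k$ be a commutative ring with unit. An involutive $k$-algebra is an associative unital $k$-algebra $A$ with a $k$-linear anti-homomorphism $a\mapsto\overline a$, $\overline{\overline a}=a$. Let $\Delta H$ be the hyperoctahedral category: its objects are $[n]=\{0,\dots,n\}$, $n\ge 0$, and a morphism $[n]\to[m]$ is a pair $(\phi,g)$ of an order-preserving map $\phi:[n]\to[m]$ and an element $g=(z_0,\dots,z_n;\sigma)$ of $H_{n+1}=C_2^{n+1}\rtimes\Sigma_{n+1}$, with the composition of the hyperoctahedral crossed simplicial group. Let $\mathsf H_A:\Delta H\to \mathbf{Mod}_k$, $[n]\mapsto A^{\otimes n+1}$, be the hyperoctahedral bar construction, in which $(\phi,g)$ sends $a_0\otimes\cdots\otimes a_n$ to the tensor product over $j=0,\dots,m$ of the ordered products $\prod_{i\in(\phi\circ\sigma)^{-1}(j)}a_i^{z_i}$, taken in the order of the positions $\sigma(i)$, where $a^{1}=a$ and $a^{t}=\overline a$ for the generator $t$ of $C_2$. Put $HO_n(A)=\mathrm{Tor}_n^{\Delta H}(k^\star,\mathsf H_A)$, where $k^\star$ is the constant right $\Delta H$-module at $k$, and for a $k$-module $M$ let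 $HO_n(A;M)$ be the $n$-th homology of $C_\star(\Delta H,\mathsf H_A)\otimes_k M$, where $C_n(\Delta H,F)=\bigoplus_{C_0\to\cdots\to C_n}F(C_0)$ is the Gabriel–Zisman complex. (1) If $A$ is flat over $k$, then for every $k$-module $M$ there is a first quadrant homological spectral sequence with $$E^2_{p,q}\cong \mathrm{Tor}^k_p(HO_q(A),M)$$ that converges to $HO_\star(A;M)$: each $HO_n(A;M)$ has a filtration $0=F_{-1}\subseteq F_0\subseteq\cdots\subseteq F_n=HO_n(A;M)$ with $F_p/F_{p-1}\cong E^\infty_{p,n-p}$. (2) If moreover the weak global dimension of $k$ (the supremum of all $n$ such that $\mathrm{Tor}_n^k(M,N)\ne 0$ for some $k$-modules $M,N$) is at most $1$, then these spectral sequences reduce to short exact sequences $$0\to HO_n(A)\otimes_k M\to HO_n(A;M)\to \mathrm{Tor}^k_1(HO_{n-1}(A),M)\to 0\qquad(n\ge 0,\ HO_{-1}(A)=0),$$ natural in the flat involutive algebra $A$ and in $M$, in which the image of $HO_n(A)\otimes_k M$ is $F_0$. (3) If in addition $k$ is hereditary (every ideal is projective) and $A$ is projective over $k$, then these sequences split.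 (4) In general the splitting cannot be chosen naturally: there are a hereditary commutative ring $k$ with weak global dimension at most $1$, a $k$-module $M$ and a degree $n\ge 1$ such that, for any sequences as in (2) natural in $A$ and $M$, no choice of splittings of the degree $n$ sequences for $M$, over all projective involutive $k$-algebras $A$, is natural in $A$. -/

import Mathlib

universe u

open CategoryTheory

/-! ### The hyperoctahedral category -/

/-- The hyperoctahedral group `H_{n+1} = C₂^{n+1} ⋊ Σ_{n+1}` of tuples `(z₀, …, zₙ; σ)`.
Here `C₂ = {1, t}` is `ℤˣ`, with `t = -1`. -/
@[ext]
structure HyperoctahedralGroup (n : ℕ) where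
  label : Fin (n + 1) → ℤˣ
  perm : Equiv.Perm (Fin (n + 1))

namespace HyperoctahedralGroup
variable {n m : ℕ}

/-- The product `h g` in `H_{n+1}` (first `g`, then `h`; the labels of a tuple are applied
before its permutation). -/
def mul (h g : HyperoctahedralGroup n) : HyperoctahedralGroup n where
  label i := h.label (g.perm i) * g.label i
  perm := g.perm.trans h.perm

/-- The unit of `H_{n+1}`. -/
def one (n : ℕ) : HyperoctahedralGroup n := ⟨fun _ => 1, Equiv.refl _⟩

/-- Order-reversal for the label `t`, nothing for the label `1`. -/
def flip (z : ℤˣ) (i : Fin (n + 1)) : Fin (n + 1) := if z = 1 then i else i.rev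

/-- The order on `[n]` that underlies `φ^*(h)`: first by the block `φ⁻¹(j)` in the order of the
positions `τ(j)`, where `h = (w; τ)`, then inside the block by the usual order, which is reversed
if the block carries the label `w_j = t`. -/
def key (φ : Fin (n + 1) →o Fin (m + 1)) (h : HyperoctahedralGroup m) (i : Fin (n + 1)) :
    Fin (m + 1) ×ₗ Fin (n + 1) :=
  toLex (h.perm (φ i), flip (h.label (φ i)) i)

/-- `φ^*(h) ∈ H_{n+1}` for `φ : [n] → [m]` in `Δ` and `h = (w; τ) ∈ H_{m+1}`: the permutation of
the blocks `φ⁻¹(j)` by `τ`, with reversal of the blocks labelled `t`; each element gets the label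
of its block. -/
def pullback (φ : Fin (n + 1) →o Fin (m + 1)) (h : HyperoctahedralGroup m) :
    HyperoctahedralGroup n where
  label i := h.label (φ i)
  perm := (Tuple.sort (key φ h)).symm

/-- `h_*(φ)`: the order-preserving map with `h_*(φ) ∘ φ^*(h) = h ∘ φ` on underlying sets. -/
def pushforward (φ : Fin (n + 1) →o Fin (m + 1)) (h : HyperoctahedralGroup m) :
    Fin (n + 1) →o Fin (m + 1) where
  toFun p := h.perm (φ ((pullback φ h).perm.symm p))
  monotone' := by
    intro p q hpq
    have := Tuple.monotone_sort (key φ h) hpq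
    exact Prod.Lex.monotone_fst _ _ this

theorem flip_lt (z : ℤˣ) (i j : Fin (n + 1)) :
    flip z i < flip z j ↔ (z = 1 ∧ i < j) ∨ (z ≠ 1 ∧ j < i) := by
  unfold flip
  split_ifs with h <;> simp [h]

theorem key_injective (φ : Fin (n + 1) →o Fin (m + 1)) (h : HyperoctahedralGroup m) :
    Function.Injective (key φ h) := by
  intro i j hij
  simp only [key, EmbeddingLike.apply_eq_iff_eq, Prod.mk.injEq] at hij
  obtain ⟨h1, h2⟩ := hij
  rw [h1] at h2
  unfold flip at h2
  split_ifs at h2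
  · exact h2
  · exact Fin.rev_injective h2

theorem pullback_perm_lt (φ : Fin (n + 1) →o Fin (m + 1)) (h : HyperoctahedralGroup m)
    (i j : Fin (n + 1)) :
    (pullback φ h).perm i < (pullback φ h).perm j ↔ key φ h i < key φ h j := by
  have hs : StrictMono (key φ h ∘ Tuple.sort (key φ h)) :=
    (Tuple.monotone_sort _).strictMono_of_injective
      ((key_injective φ h).comp (Equiv.injective _))
  rw [← hs.lt_iff_lt]
  simp [pullback]

theorem key_lt (φ : Fin (n + 1) →o Fin (m + 1)) (h : HyperoctahedralGroup m)
    (i j : Fin (n + 1)) :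
    key φ h i < key φ h j ↔ h.perm (φ i) < h.perm (φ j) ∨ (φ i = φ j ∧
      ((h.label (φ i) = 1 ∧ i < j) ∨ (h.label (φ i) ≠ 1 ∧ j < i))) := by
  rw [key, key, Prod.Lex.toLex_lt_toLex]
  simp only [EmbeddingLike.apply_eq_iff_eq]
  refine or_congr Iff.rfl (and_congr_right fun e => ?_)
  rw [← e, flip_lt]

end HyperoctahedralGroup

/-- Objects `[n] = {0, …, n}`, `n ≥ 0`, of the hyperoctahedral category `ΔH`. -/
structure DeltaH where
  len : ℕ

namespace DeltaH
open HyperoctahedralGroup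

/-- A morphism of `ΔH` is a pair `(φ, g)` with `φ` in `Δ` and `g` in the hyperoctahedral group of
the source. -/
@[ext]
structure Hom (a b : DeltaH) where
  mono : Fin (a.len + 1) →o Fin (b.len + 1)
  grp : HyperoctahedralGroup a.len

variable {a b c d : DeltaH}

/-- The composite `(ψ ∘ h_*(φ), φ^*(h) ∘ g)` of `(φ, g)` followed by `(ψ, h)`. -/
def Hom.comp (f : Hom a b) (g : Hom b c) : Hom a c where
  mono := g.mono.comp (pushforward f.mono g.grp)
  grp := (pullback f.mono g.grp).mul f.grp

/-- The identity morphism. -/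
def Hom.id (a : DeltaH) : Hom a a := ⟨OrderHom.id, one a.len⟩

/-- The underlying map of sets `φ ∘ σ`. -/
def Hom.toFun (f : Hom a b) (i : Fin (a.len + 1)) : Fin (b.len + 1) := f.mono (f.grp.perm i)

theorem Hom.comp_toFun (f : Hom a b) (g : Hom b c) (i : Fin (a.len + 1)) :
    (f.comp g).toFun i = g.toFun (f.toFun i) := by
  change g.mono (g.grp.perm (f.mono ((pullback f.mono g.grp).perm.symm
    ((pullback f.mono g.grp).perm (f.grp.perm i))))) = _
  rw [Equiv.symm_apply_apply]
  rfl

theorem Hom.comp_label (f : Hom a b) (g : Hom b c) (i : Fin (a.len + 1)) :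
    (f.comp g).grp.label i = g.grp.label (f.toFun i) * f.grp.label i := rfl

theorem Hom.comp_perm_lt (f : Hom a b) (g : Hom b c) (i j : Fin (a.len + 1)) :
    (f.comp g).grp.perm i < (f.comp g).grp.perm j ↔
      g.grp.perm (f.toFun i) < g.grp.perm (f.toFun j) ∨ (f.toFun i = f.toFun j ∧
        ((g.grp.label (f.toFun i) = 1 ∧ f.grp.perm i < f.grp.perm j) ∨
          (g.grp.label (f.toFun i) ≠ 1 ∧ f.grp.perm j < f.grp.perm i))) := by
  have : (f.comp g).grp.perm i < (f.comp g).grp.perm j ↔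
    (pullback f.mono g.grp).perm (f.grp.perm i) < (pullback f.mono g.grp).perm (f.grp.perm j) :=
    Iff.rfl
  rw [this, pullback_perm_lt, key_lt]
  rfl

theorem perm_ext {n : ℕ} {σ τ : Equiv.Perm (Fin n)} (h : ∀ i j, σ i < σ j ↔ τ i < τ j) :
    σ = τ := by
  have hm : StrictMono (σ.symm.trans τ) := by
    intro i j hij
    simpa using (h (σ.symm i) (σ.symm j)).1 (by simpa using hij)
  have := (Equiv.Perm.monotone_iff _).1 hm.monotone
  ext i
  have := congrArg (fun e => e (σ i)) this
  simp at this
  rw [this]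

theorem Hom.ext_of {f g : Hom a b} (h1 : ∀ i, f.toFun i = g.toFun i)
    (h2 : ∀ i, f.grp.label i = g.grp.label i)
    (h3 : ∀ i j, f.grp.perm i < f.grp.perm j ↔ g.grp.perm i < g.grp.perm j) : f = g := by
  have hp : f.grp.perm = g.grp.perm := perm_ext h3
  refine Hom.ext (OrderHom.ext _ _ (funext fun p => ?_))
    (HyperoctahedralGroup.ext (funext h2) hp)
  have := h1 (f.grp.perm.symm p)
  simp only [Hom.toFun, ← hp, Equiv.apply_symm_apply] at this
  exact this

theorem Hom.assoc (f : Hom a b) (g : Hom b c) (h : Hom c d) :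
    (f.comp g).comp h = f.comp (g.comp h) := by
  apply Hom.ext_of
  · intro i
    simp [Hom.comp_toFun]
  · intro i
    simp [Hom.comp_toFun, Hom.comp_label, mul_assoc]
  · intro i j
    simp only [Hom.comp_perm_lt, Hom.comp_toFun, Hom.comp_label]
    rcases Int.units_eq_one_or (h.grp.label (g.toFun (f.toFun i))) with h1 | h1 <;>
    rcases Int.units_eq_one_or (g.grp.label (f.toFun i)) with h2 | h2 <;>
    by_cases h3 : f.toFun i = f.toFun j <;>
    by_cases h4 : g.toFun (f.toFun i) = g.toFun (f.toFun j) <;>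
    simp_all
    all_goals exact fun e => absurd e.symm h3

theorem Hom.id_comp (f : Hom a b) : (Hom.id a).comp f = f := by
  apply Hom.ext_of
  · intro i
    rw [Hom.comp_toFun]
    rfl
  · intro i
    simp [Hom.comp_label, Hom.id, Hom.toFun, one]
  · intro i j
    simp only [Hom.comp_perm_lt, Hom.id, Hom.toFun, one]
    simp
    rintro rfl
    simp

theorem Hom.comp_id (f : Hom a b) : f.comp (Hom.id b) = f := by
  apply Hom.ext_of
  · intro i
    rw [Hom.comp_toFun]
    rfl
  · intro i
    simp [Hom.comp_label, Hom.id, one]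
  · intro i j
    simp only [Hom.comp_perm_lt, Hom.id, one]
    simp only [Equiv.refl_apply, ne_eq, not_true_eq_false, false_and, or_false, true_and]
    constructor
    · rintro (h | ⟨_, h⟩)
      · exact f.mono.monotone.reflect_lt h
      · exact h
    · intro h
      rcases (f.mono.monotone h.le).lt_or_eq with h' | h'
      · exact Or.inl h'
      · exact Or.inr ⟨h', h⟩

instance : SmallCategory DeltaH where
  Hom := Hom
  id := Hom.id
  comp := Hom.comp
  id_comp := Hom.id_comp
  comp_id := Hom.comp_id
  assoc := Hom.assoc
end DeltaH

/-! ### Functor homology -/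

section Functors
open TensorProduct

namespace FunctorHomology
variable {k : Type u} [CommRing k] {C : Type} [SmallCategory C]

section Tensor
open DirectSum
open scoped Classical in
/-- The submodule generated by all `G(α)(x) ⊗ y - x ⊗ F(α)(y)`. -/
noncomputable def relations (G : Cᵒᵖ ⥤ ModuleCat.{u} k) (F : C ⥤ ModuleCat.{u} k) :
    Submodule k (⨁ c : C, (G.obj (.op c) ⊗[k] F.obj c)) :=
  Submodule.span k {r | ∃ (c d : C) (α : c ⟶ d) (x : G.obj (.op d)) (y : F.obj c),
    r = DirectSum.lof k C (fun c => G.obj (.op c) ⊗[k] F.obj c) c (G.map α.op x ⊗ₜ y) -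
      DirectSum.lof k C (fun c => G.obj (.op c) ⊗[k] F.obj c) d (x ⊗ₜ F.map α y)}

/-- The tensor product `G ⊗_C F` of a right and a left `C`-module. -/
abbrev tensorObj (G : Cᵒᵖ ⥤ ModuleCat.{u} k) (F : C ⥤ ModuleCat.{u} k) : Type u :=
  (⨁ c : C, (G.obj (.op c) ⊗[k] F.obj c)) ⧸ relations G F

open scoped Classical in
/-- The map `[x ⊗ y] ↦ [Θ(x) ⊗ Ψ(y)]`. -/
noncomputable def tensorMap {G G' : Cᵒᵖ ⥤ ModuleCat.{u} k} {F F' : C ⥤ ModuleCat.{u} k}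
    (Θ : G ⟶ G') (Ψ : F ⟶ F') : tensorObj G F →ₗ[k] tensorObj G' F' :=
  (relations G F).mapQ (relations G' F')
    (DirectSum.lmap fun c => TensorProduct.map (Θ.app (.op c)).hom (Ψ.app c).hom) (by
      rw [relations, Submodule.span_le]
      rintro _ ⟨c, d, α, x, y, rfl⟩
      refine Submodule.subset_span ⟨c, d, α, Θ.app (.op d) x, Ψ.app c y, ?_⟩
      rw [map_sub, DirectSum.lmap_lof, DirectSum.lmap_lof, TensorProduct.map_tmul,
        TensorProduct.map_tmul]
      have h1 := ConcreteCategory.congr_hom (Θ.naturality α.op) x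
      have h2 := ConcreteCategory.congr_hom (Ψ.naturality α) y
      simp only [ModuleCat.hom_comp, LinearMap.comp_apply] at h1 h2
      rw [← h1, ← h2])

open scoped Classical in
theorem tensorObj_hom_ext {G : Cᵒᵖ ⥤ ModuleCat.{u} k} {F : C ⥤ ModuleCat.{u} k}
    {N : Type*} [AddCommGroup N] [Module k N] {f g : tensorObj G F →ₗ[k] N}
    (h : ∀ (c : C) (x : G.obj (.op c)) (y : F.obj c),
      f (Submodule.Quotient.mk (DirectSum.lof k C (fun c => G.obj (.op c) ⊗[k] F.obj c) c (x ⊗ₜ y))) =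
      g (Submodule.Quotient.mk (DirectSum.lof k C (fun c => G.obj (.op c) ⊗[k] F.obj c) c (x ⊗ₜ y)))) :
    f = g := by
  exact Submodule.linearMap_qext _
    (DirectSum.linearMap_ext _ fun c => TensorProduct.ext' fun x y => h c x y)

open scoped Classical in
theorem tensorMap_mk {G G' : Cᵒᵖ ⥤ ModuleCat.{u} k} {F F' : C ⥤ ModuleCat.{u} k}
    (Θ : G ⟶ G') (Ψ : F ⟶ F') (c : C) (x : G.obj (.op c)) (y : F.obj c) :
    tensorMap Θ Ψ (Submodule.Quotient.mk
      (DirectSum.lof k C (fun c => G.obj (.op c) ⊗[k] F.obj c) c (x ⊗ₜ y))) =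
    Submodule.Quotient.mk (DirectSum.lof k C (fun c => G'.obj (.op c) ⊗[k] F'.obj c) c
      (Θ.app (.op c) x ⊗ₜ Ψ.app c y)) := by
  rw [tensorMap, Submodule.mapQ_apply, DirectSum.lmap_lof, TensorProduct.map_tmul]

/-- The functor `G ↦ G ⊗_C F`. -/
noncomputable def tensorFunctor (F : C ⥤ ModuleCat.{u} k) :
    (Cᵒᵖ ⥤ ModuleCat.{u} k) ⥤ ModuleCat.{u} k where
  obj G := ModuleCat.of k (tensorObj G F)
  map Θ := ModuleCat.ofHom (tensorMap Θ (𝟙 F))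
  map_id G := by
    refine ModuleCat.hom_ext (tensorObj_hom_ext fun c x y => ?_)
    exact (tensorMap_mk _ _ _ _ _)
  map_comp Θ Θ' := by
    refine ModuleCat.hom_ext (tensorObj_hom_ext fun c x y => ?_)
    refine (tensorMap_mk _ (𝟙 F) c x y).trans ?_
    refine Eq.trans ?_ (congrArg (tensorMap Θ' (𝟙 F) : _ → _) (tensorMap_mk Θ (𝟙 F) c x y)).symm
    exact (tensorMap_mk Θ' (𝟙 F) c (Θ.app (.op c) x) y).symm

instance (F : C ⥤ ModuleCat.{u} k) : (tensorFunctor F).Additive where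
  map_add {G G' Θ Θ'} := by
    refine ModuleCat.hom_ext (tensorObj_hom_ext fun c x y => ?_)
    refine (tensorMap_mk _ (𝟙 F) c x y).trans ?_
    refine Eq.trans ?_ (congrArg₂ (· + ·) (tensorMap_mk Θ (𝟙 F) c x y)
      (tensorMap_mk Θ' (𝟙 F) c x y)).symm
    rw [← Submodule.Quotient.mk_add, ← map_add, ← TensorProduct.add_tmul]
    rfl

/-- `- ⊗_C F ⟶ - ⊗_C F'` for a map `F ⟶ F'` of left `C`-modules. -/
noncomputable def tensorFunctorMap {F F' : C ⥤ ModuleCat.{u} k} (Ψ : F ⟶ F') :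
    tensorFunctor F ⟶ tensorFunctor F' where
  app G := ModuleCat.ofHom (tensorMap (𝟙 G) Ψ)
  naturality G G' Θ := by
    refine ModuleCat.hom_ext (tensorObj_hom_ext fun c x y => ?_)
    refine (congrArg (tensorMap (𝟙 G') Ψ) (tensorMap_mk Θ (𝟙 F) c x y)).trans ?_
    refine (tensorMap_mk _ _ _ _ _).trans ?_
    refine Eq.trans ?_ (congrArg (tensorMap Θ (𝟙 F')) (tensorMap_mk (𝟙 G) Ψ c x y)).symm
    exact (tensorMap_mk Θ (𝟙 F') c x (Ψ.app c y)).symm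

end Tensor

/-- The right `C`-module freely generated by a projective module over `G(c)` in degree `c`. -/
noncomputable def cover (G : Cᵒᵖ ⥤ ModuleCat.{u} k) (c : Cᵒᵖ) : Cᵒᵖ ⥤ ModuleCat.{u} k :=
  (evaluationLeftAdjoint (ModuleCat.{u} k) c).obj (Projective.over (G.obj c))

/-- The map `cover G c ⟶ G` that is onto in degree `c`. -/
noncomputable def coverπ (G : Cᵒᵖ ⥤ ModuleCat.{u} k) (c : Cᵒᵖ) : cover G c ⟶ G :=
  ((evaluationAdjunctionRight (ModuleCat.{u} k) c).homEquiv _ _).symm (Projective.π (G.obj c))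

instance (G : Cᵒᵖ ⥤ ModuleCat.{u} k) (c : Cᵒᵖ) : Projective (cover G c) :=
  (evaluationAdjunctionRight (ModuleCat.{u} k) c).map_projective _ inferInstance

instance (G : Cᵒᵖ ⥤ ModuleCat.{u} k) (c : Cᵒᵖ) : Epi ((coverπ G c).app c) := by
  have h : Projective.π (G.obj c) = (evaluationAdjunctionRight (ModuleCat.{u} k) c).unit.app _ ≫
      (coverπ G c).app c :=
    (((evaluationAdjunctionRight (ModuleCat.{u} k) c).homEquiv _ _).apply_symm_apply
        (Projective.π (G.obj c))).symm.trans
      ((evaluationAdjunctionRight (ModuleCat.{u} k) c).homEquiv_unit _ _ (coverπ G c))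
  have : Epi ((evaluationAdjunctionRight (ModuleCat.{u} k) c).unit.app _ ≫
      (coverπ G c).app c) := by
    rw [← h]; infer_instance
  exact epi_of_epi ((evaluationAdjunctionRight (ModuleCat.{u} k) c).unit.app _) _

instance : EnoughProjectives (Cᵒᵖ ⥤ ModuleCat.{u} k) where
  presentation G := by
    have : Epi (Limits.Sigma.desc (coverπ G)) := by
      refine (NatTrans.epi_iff_epi_app _).2 fun c => ?_
      have h : (coverπ G c).app c =
          (Limits.Sigma.ι (cover G) c).app c ≫ (Limits.Sigma.desc (coverπ G)).app c := by
        rw [← NatTrans.comp_app, Limits.Sigma.ι_desc]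
      have : Epi ((Limits.Sigma.ι (cover G) c).app c ≫
          (Limits.Sigma.desc (coverπ G)).app c) := by
        rw [← h]; infer_instance
      exact epi_of_epi ((Limits.Sigma.ι (cover G) c).app c) _
    have hP : Projective (∐ cover G) :=
      ⟨fun f e _ => ⟨Limits.Sigma.desc fun c => Projective.factorThru (Limits.Sigma.ι _ c ≫ f) e,
        by ext1; simp⟩⟩
    exact ⟨{ p := ∐ cover G, projective := hP, f := Limits.Sigma.desc (coverπ G), epi := this }⟩

/-- `Tor_n^C(G, F)`, the left derived functors of `- ⊗_C F`, evaluated at `G`. -/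
noncomputable def functorTor (n : ℕ) (G : Cᵒᵖ ⥤ ModuleCat.{u} k) (F : C ⥤ ModuleCat.{u} k) :
    ModuleCat.{u} k :=
  ((tensorFunctor F).leftDerived n).obj G

/-- Functoriality of `Tor_n^C(G, F)` in `F`. -/
noncomputable def functorTorMap (n : ℕ) (G : Cᵒᵖ ⥤ ModuleCat.{u} k) {F F' : C ⥤ ModuleCat.{u} k}
    (Ψ : F ⟶ F') : functorTor n G F ⟶ functorTor n G F' :=
  (NatTrans.leftDerived (tensorFunctorMap Ψ) n).app G

section Complex
open DirectSum
open scoped Classical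

/-- `C_n(C, F)`, the direct sum of `F(C₀)` over all strings `C₀ ⟶ ⋯ ⟶ C_n` in `C`. -/
abbrev chains (F : C ⥤ ModuleCat.{u} k) (n : ℕ) : Type u :=
  ⨁ s : ComposableArrows C n, F.obj (s.obj 0)

/-- The simplicial structure: `θ : [m] → [n]` sends the summand `x ∈ F(C₀)` of the string
`C₀ ⟶ ⋯ ⟶ C_n` to the image of `x` in `F(C_{θ 0})`, in the summand of the string
`C_{θ 0} ⟶ ⋯ ⟶ C_{θ m}`. -/
noncomputable def simplicialMap (F : C ⥤ ModuleCat.{u} k) {m n : SimplexCategory} (θ : m ⟶ n) :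
    chains F n.len →ₗ[k] chains F m.len :=
  DirectSum.toModule k _ _ fun s =>
    (DirectSum.lof k (ComposableArrows C m.len) (fun s => F.obj (s.obj 0))
      (s.whiskerLeft (SimplexCategory.toCat.map θ).toFunctor)) ∘ₗ
      (F.map (s.map (homOfLE (Fin.zero_le (θ.toOrderHom 0))))).hom

theorem simplicialMap_lof (F : C ⥤ ModuleCat.{u} k) {m n : SimplexCategory} (θ : m ⟶ n)
    (s : ComposableArrows C n.len) (x : F.obj (s.obj 0)) :
    simplicialMap F θ (DirectSum.lof k _ (fun s : ComposableArrows C n.len => F.obj (s.obj 0)) s x)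
      = DirectSum.lof k (ComposableArrows C m.len) (fun s => F.obj (s.obj 0))
      (s.whiskerLeft (SimplexCategory.toCat.map θ).toFunctor)
      (F.map (s.map (homOfLE (Fin.zero_le (θ.toOrderHom 0)))) x) := by
  rw [simplicialMap, DirectSum.toModule_lof]
  rfl

/-- The simplicial `k`-module `C_*(C, F)` of Gabriel and Zisman. -/
noncomputable def simplicialModule (F : C ⥤ ModuleCat.{u} k) :
    SimplicialObject (ModuleCat.{u} k) where
  obj n := ModuleCat.of k (chains F n.unop.len)
  map θ := ModuleCat.ofHom (simplicialMap F θ.unop)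
  map_id n := by
    refine ModuleCat.hom_ext (DirectSum.linearMap_ext _ fun s => LinearMap.ext fun x => ?_)
    refine (simplicialMap_lof F _ s x).trans ?_
    have : F.map (s.map (homOfLE (Fin.zero_le 0))) = 𝟙 _ := by
      rw [show homOfLE (Fin.zero_le 0) = 𝟙 (0 : Fin (n.unop.len + 1)) from rfl]
      simp
    exact congrArg (DirectSum.lof k _ (fun s : ComposableArrows C n.unop.len => F.obj (s.obj 0)) s)
      (ConcreteCategory.congr_hom this x)
  map_comp {l m n} θ η := by
    refine ModuleCat.hom_ext (DirectSum.linearMap_ext _ fun s => LinearMap.ext fun x => ?_)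
    refine (simplicialMap_lof F _ s x).trans ?_
    refine Eq.trans ?_ (congrArg (simplicialMap F η.unop) (simplicialMap_lof F θ.unop s x)).symm
    refine Eq.trans ?_ (simplicialMap_lof F _ _ _).symm
    refine congrArg (DirectSum.lof k _ (fun s : ComposableArrows C n.unop.len => F.obj (s.obj 0)) _) ?_
    refine Eq.trans ?_ (ConcreteCategory.congr_hom (F.map_comp _ _) x)
    refine ConcreteCategory.congr_hom (congrArg F.map ?_) x
    exact (s.map_comp _ _)

/-- Functoriality of the simplicial module in `F`. -/
noncomputable def simplicialModuleMap {F F' : C ⥤ ModuleCat.{u} k} (Ψ : F ⟶ F') :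
    simplicialModule F ⟶ simplicialModule F' where
  app n := ModuleCat.ofHom (DirectSum.lmap fun s => (Ψ.app (s.obj 0)).hom)
  naturality m n θ := by
    refine ModuleCat.hom_ext (DirectSum.linearMap_ext _ fun s => LinearMap.ext fun x => ?_)
    refine (congrArg (DirectSum.lmap _) (simplicialMap_lof F _ s x)).trans ?_
    refine (DirectSum.lmap_lof _ _ _).trans ?_
    refine Eq.trans ?_ (congrArg (simplicialMap F' θ.unop) (DirectSum.lmap_lof _ _ _)).symm
    refine Eq.trans ?_ (simplicialMap_lof F' _ _ _).symm
    refine congrArg (DirectSum.lof k _ (fun s : ComposableArrows C n.unop.len => F'.obj (s.obj 0)) _) ?_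
    exact ConcreteCategory.congr_hom (Ψ.naturality _) x

/-- The chain complex `C_*(C, F)`, with the alternating sum of the faces as differential. -/
noncomputable def complex (F : C ⥤ ModuleCat.{u} k) : ChainComplex (ModuleCat.{u} k) ℕ :=
  (AlgebraicTopology.alternatingFaceMapComplex _).obj (simplicialModule F)

/-- Functoriality of the chain complex in `F`. -/
noncomputable def complexMap {F F' : C ⥤ ModuleCat.{u} k} (Ψ : F ⟶ F') :
    complex F ⟶ complex F' :=
  (AlgebraicTopology.alternatingFaceMapComplex _).map (simplicialModuleMap Ψ)

/-- The chain complex `C_*(C, F) ⊗ M` with differential `d ⊗ id`. -/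
noncomputable def complexTensor (M : ModuleCat.{u} k) (F : C ⥤ ModuleCat.{u} k) :
    ChainComplex (ModuleCat.{u} k) ℕ :=
  ((MonoidalCategory.tensorRight M).mapHomologicalComplex _).obj (complex F)

open MonoidalCategory in
/-- Functoriality of `C_*(C, F) ⊗ M` in `M` and `F`. -/
noncomputable def complexTensorMap {M N : ModuleCat.{u} k} (g : M ⟶ N) {F F' : C ⥤ ModuleCat.{u} k}
    (Ψ : F ⟶ F') : complexTensor M F ⟶ complexTensor N F' :=
  ((tensorRight M).mapHomologicalComplex _).map (complexMap Ψ) ≫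
    (NatTrans.mapHomologicalComplex ((tensoringRight _).map g) _).app (complex F')
end Complex
end FunctorHomology

end Functors

/-! ### Involutive algebras and the hyperoctahedral bar construction -/

section Bar
open TensorProduct

/-- An associative unital `k`-algebra with a `k`-linear anti-homomorphism `a ↦ star a` that squares
to the identity. -/
structure InvolutiveAlgebra (k : Type u) [CommRing k] where
  carrier : Type u
  [ring : Ring carrier]
  [algebra : Algebra k carrier]
  [starRing : StarRing carrier]
  star_smul (c : k) (a : carrier) : star (c • a) = c • star a

namespace InvolutiveAlgebra
variable {k : Type u} [CommRing k]

instance : CoeSort (InvolutiveAlgebra k) (Type u) := ⟨carrier⟩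
attribute [instance] ring algebra starRing

/-- `a ^ z`, which is `a` for `z = 1` and the involution of `a` for `z = t`. -/
def twist (A : InvolutiveAlgebra k) (z : ℤˣ) : A →ₗ[k] A where
  toFun a := if z = 1 then a else star a
  map_add' a b := by split_ifs <;> simp
  map_smul' c a := by split_ifs <;> simp [A.star_smul]

variable (A : InvolutiveAlgebra k) {a b c : DeltaH}

/-- The preimage `(φ ∘ σ)⁻¹(j)`, listed in the order given by `φ`, that is, by the positions `σ(i)`.
-/
def fibre (f : a ⟶ b) (j : Fin (b.len + 1)) : List (Fin (a.len + 1)) :=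
  ((List.finRange (a.len + 1)).filter fun p => f.mono p = j).map f.grp.perm.symm

/-- The ordered product `∏ xᵢ ^ zᵢ` over `i ∈ (φ ∘ σ)⁻¹(j)`. -/
def word (f : a ⟶ b) (x : Fin (a.len + 1) → A) (j : Fin (b.len + 1)) : A :=
  ((fibre f j).map fun i => A.twist (f.grp.label i) (x i)).prod

theorem mem_fibre (f : a ⟶ b) (j : Fin (b.len + 1)) (i : Fin (a.len + 1)) :
    i ∈ fibre f j ↔ f.toFun i = j := by
  simp only [fibre, List.mem_map, List.mem_filter, List.mem_finRange, true_and, decide_eq_true_eq]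
  constructor
  · rintro ⟨p, hp, rfl⟩
    simpa [DeltaH.Hom.toFun] using hp
  · intro h
    exact ⟨f.grp.perm i, h, by simp⟩

theorem fibre_sorted (f : a ⟶ b) (j : Fin (b.len + 1)) :
    (fibre f j).Pairwise fun i i' => f.grp.perm i < f.grp.perm i' := by
  rw [fibre, List.pairwise_map]
  simp only [Equiv.apply_symm_apply]
  exact (List.pairwise_lt_finRange _).filter _

theorem fibre_nodup (f : a ⟶ b) (j : Fin (b.len + 1)) : (fibre f j).Nodup :=
  (fibre_sorted f j).imp fun h e => by simp [e] at h

theorem word_update_of_ne (f : a ⟶ b) (x : Fin (a.len + 1) → A) (i : Fin (a.len + 1)) (y : A)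
    (j : Fin (b.len + 1)) (hj : j ≠ f.toFun i) :
    A.word f (Function.update x i y) j = A.word f x j := by
  unfold word
  congr 1
  refine List.map_congr_left fun i' hi' => ?_
  rw [mem_fibre] at hi'
  rw [Function.update_of_ne]
  rintro rfl
  exact hj hi'.symm

theorem exists_word_update (f : a ⟶ b) (x : Fin (a.len + 1) → A) (i : Fin (a.len + 1)) :
    ∃ L : A →ₗ[k] A, ∀ y, A.word f (Function.update x i y) (f.toFun i) = L y := by
  obtain ⟨s, t, hst⟩ := List.append_of_mem ((mem_fibre f (f.toFun i) i).2 rfl)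
  have hn := fibre_nodup f (f.toFun i)
  rw [hst] at hn
  refine ⟨(LinearMap.mulLeft k (s.map fun i => A.twist (f.grp.label i) (x i)).prod) ∘ₗ
    (LinearMap.mulRight k (t.map fun i => A.twist (f.grp.label i) (x i)).prod) ∘ₗ
    A.twist (f.grp.label i), fun y => ?_⟩
  have hs : i ∉ s := fun h => by
    rw [List.nodup_append] at hn
    exact hn.2.2 i h i (by simp) rfl
  have ht : i ∉ t := fun h => by
    rw [List.nodup_append] at hn
    exact (List.nodup_cons.1 hn.2.1).1 h
  have key : ∀ l : List (Fin (a.len + 1)), i ∉ l →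
      (l.map fun i' => A.twist (f.grp.label i') (Function.update x i y i')) =
        l.map fun i' => A.twist (f.grp.label i') (x i') := by
    intro l hl
    refine List.map_congr_left fun i' hi' => ?_
    rw [Function.update_of_ne]
    rintro rfl
    exact hl hi'
  simp [word, hst, key s hs, key t ht]

theorem word_update (f : a ⟶ b) (x : Fin (a.len + 1) → A) (i : Fin (a.len + 1)) (y : A) :
    A.word f (Function.update x i y) =
      Function.update (A.word f x) (f.toFun i) (A.word f (Function.update x i y) (f.toFun i)) := by
  funext j
  by_cases h : j = f.toFun i
  · subst h; simp
  · rw [Function.update_of_ne h, word_update_of_ne A f x i y j h]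

/-- `(a₀, …, aₙ) ↦ ⨂_j ∏_{i ∈ (φ ∘ σ)⁻¹(j)} aᵢ ^ zᵢ`. -/
noncomputable def wordMultilinear (f : a ⟶ b) :
    MultilinearMap k (fun _ : Fin (a.len + 1) => (A : Type u))
      (⨂[k] _ : Fin (b.len + 1), (A : Type u)) where
  toFun x := PiTensorProduct.tprod k (A.word f x)
  map_update_add' {inst} x i y z := by
    obtain rfl : inst = instDecidableEqFin _ := Subsingleton.elim _ _
    obtain ⟨L, hL⟩ := A.exists_word_update f x i
    rw [word_update A f x i (y + z), word_update A f x i y, word_update A f x i z, hL, hL, hL,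
      map_add, MultilinearMap.map_update_add]
  map_update_smul' {inst} x i r y := by
    obtain rfl : inst = instDecidableEqFin _ := Subsingleton.elim _ _
    obtain ⟨L, hL⟩ := A.exists_word_update f x i
    rw [word_update A f x i (r • y), word_update A f x i y, hL, hL,
      map_smul, MultilinearMap.map_update_smul]

theorem twist_one (y : A) : A.twist 1 y = y := by simp [twist]

theorem twist_neg_one (y : A) : A.twist (-1) y = star y := by
  simp [twist]

theorem twist_mul (z w : ℤˣ) (y : A) : A.twist z (A.twist w y) = A.twist (z * w) y := by
  rcases Int.units_eq_one_or z with rfl | rfl <;> rcases Int.units_eq_one_or w with rfl | rfl <;>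
  simp [twist_one, twist_neg_one]

/-- Reverse a list if the label is `t`. -/
def orient {α : Type*} (z : ℤˣ) (l : List α) : List α := if z = 1 then l else l.reverse

theorem twist_prod (z : ℤˣ) (l : List A) :
    A.twist z l.prod = ((orient z l).map (A.twist z)).prod := by
  rcases Int.units_eq_one_or z with rfl | rfl
  · have : (A.twist 1 : A → A) = _root_.id := funext A.twist_one
    simp [orient, this]
  · simp only [orient, twist_neg_one]
    rw [if_neg (by decide)]
    induction l with
    | nil => simp
    | cons y l ih => simp [twist_neg_one] at ih ⊢; rw [ih]

theorem fibre_comp (f : a ⟶ b) (g : b ⟶ c) (l : Fin (c.len + 1)) :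
    fibre (f ≫ g) l = (fibre g l).flatMap fun j => orient (g.grp.label j) (fibre f j) := by
  have hirr : ∀ i i', i ∈ fibre (f ≫ g) l →
      i' ∈ (fibre g l).flatMap (fun j => orient (g.grp.label j) (fibre f j)) →
      (f ≫ g).grp.perm i ≤ (f ≫ g).grp.perm i' → (f ≫ g).grp.perm i' ≤ (f ≫ g).grp.perm i →
      i = i' := fun i i' _ _ h h' => (f ≫ g).grp.perm.injective (le_antisymm h h')
  have hcomp : ∀ i i', (f ≫ g).grp.perm i < (f ≫ g).grp.perm i' ↔ _ :=
    fun i i' => DeltaH.Hom.comp_perm_lt f g i i'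
  have hmem : ∀ i j, i ∈ orient (g.grp.label j) (fibre f j) ↔ f.toFun i = j := by
    intro i j
    unfold orient
    split_ifs <;> simp [mem_fibre]
  have hs1 := fibre_sorted (f ≫ g) l
  have hs2 : ((fibre g l).flatMap fun j => orient (g.grp.label j) (fibre f j)).Pairwise
      fun i i' => (f ≫ g).grp.perm i < (f ≫ g).grp.perm i' := by
    rw [List.pairwise_flatMap]
    constructor
    · intro j _
      unfold orient
      have := fibre_sorted f j
      split_ifs with h
      · refine this.imp_of_mem fun {i i'} hi hi' hlt => (hcomp i i').2 ?_
        rw [mem_fibre] at hi hi'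
        simp [hi, hi', h, hlt]
      · rw [List.pairwise_reverse]
        refine this.imp_of_mem fun {i i'} hi hi' hlt => (hcomp i' i).2 ?_
        rw [mem_fibre] at hi hi'
        simp [hi, hi', h, hlt]
    · refine (fibre_sorted g l).imp fun {j j'} hlt i hi i' hi' => (hcomp i i').2 ?_
      rw [hmem] at hi hi'
      rw [hi, hi']
      exact Or.inl hlt
  refine List.Perm.eq_of_pairwise (le := fun i i' => (f ≫ g).grp.perm i ≤ (f ≫ g).grp.perm i')
    hirr (hs1.imp le_of_lt) (hs2.imp le_of_lt) ?_
  refine (List.perm_ext_iff_of_nodup (fibre_nodup _ _)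
    (hs2.imp fun h e => by simp [e] at h)).2 fun i => ?_
  simp only [List.mem_flatMap, mem_fibre, hmem]
  rw [show (f ≫ g).toFun i = g.toFun (f.toFun i) from DeltaH.Hom.comp_toFun f g i]
  simp

theorem word_comp (f : a ⟶ b) (g : b ⟶ c) (x : Fin (a.len + 1) → A) :
    A.word (f ≫ g) x = A.word g (A.word f x) := by
  funext l
  have key : ∀ L : List (Fin (b.len + 1)),
      ((L.flatMap fun j => orient (g.grp.label j) (fibre f j)).map fun i =>
        A.twist ((f ≫ g).grp.label i) (x i)).prod =
      (L.map fun j => A.twist (g.grp.label j) (A.word f x j)).prod := by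
    intro L
    induction L with
    | nil => simp
    | cons j L ih =>
      rw [List.flatMap_cons, List.map_append, List.prod_append, ih, List.map_cons,
        List.prod_cons, word, twist_prod]
      congr 2
      have ho : ∀ (z : ℤˣ) (l : List (Fin (a.len + 1))) (F : Fin (a.len + 1) → A),
          orient z (l.map F) = (orient z l).map F := by
        intro z l F
        unfold orient
        split_ifs <;> simp
      rw [ho, List.map_map]
      refine List.map_congr_left fun i hi => ?_
      have hi' : f.toFun i = j := by
        unfold orient at hi
        split_ifs at hi <;> simpa [mem_fibre] using hi
      simp only [Function.comp, twist_mul, ← hi']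
      rfl
  rw [word, fibre_comp, key]
  rfl

theorem word_id (x : Fin (a.len + 1) → A) : A.word (𝟙 a) x = x := by
  funext j
  have : fibre (𝟙 a) j = [j] := by
    refine List.Perm.eq_singleton ((List.perm_ext_iff_of_nodup (fibre_nodup _ _) (by simp)).2 ?_)
    intro i
    rw [mem_fibre, List.mem_singleton]
    rfl
  rw [word, this]
  simp only [List.map_cons, List.map_nil, List.prod_cons, List.prod_nil, mul_one]
  exact A.twist_one _

/-- The hyperoctahedral bar construction `H_A : ΔH ⥤ Mod_k`, `[n] ↦ A^{⊗ n+1}`. -/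
noncomputable def barConstruction : DeltaH ⥤ ModuleCat.{u} k where
  obj a := ModuleCat.of k (⨂[k] _ : Fin (a.len + 1), (A : Type u))
  map f := ModuleCat.ofHom (PiTensorProduct.lift (A.wordMultilinear f))
  map_id a := by
    ext x
    simp [wordMultilinear, word_id]
  map_comp f g := by
    ext x
    simp [wordMultilinear, word_comp]

variable {A} {B : InvolutiveAlgebra k}

theorem word_map (φ : A →⋆ₐ[k] B) (f : a ⟶ b) (x : Fin (a.len + 1) → A) (j) :
    B.word f (fun i => φ (x i)) j = φ (A.word f x j) := by
  rw [word, word, map_list_prod, List.map_map]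
  congr 1
  refine List.map_congr_left fun i _ => ?_
  simp only [twist, LinearMap.coe_mk, AddHom.coe_mk, Function.comp]
  split_ifs
  · rfl
  · exact (map_star φ _).symm

/-- The map of bar constructions induced by a map of involutive algebras. -/
noncomputable def barConstructionMap (φ : A →⋆ₐ[k] B) :
    A.barConstruction ⟶ B.barConstruction where
  app a := ModuleCat.ofHom (PiTensorProduct.map fun _ => (φ.toAlgHom.toLinearMap : A →ₗ[k] B))
  naturality a b f := by
    refine ModuleCat.hom_ext (PiTensorProduct.ext (MultilinearMap.ext fun x => ?_))
    have : (fun j => φ (A.word f x j)) = B.word f (fun i => φ (x i)) :=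
      funext fun j => (word_map φ f x j).symm
    change PiTensorProduct.map (fun _ => (φ.toAlgHom.toLinearMap : A →ₗ[k] B))
        (PiTensorProduct.lift (A.wordMultilinear f) (PiTensorProduct.tprod k x)) =
      PiTensorProduct.lift (B.wordMultilinear f)
        (PiTensorProduct.map (fun _ => (φ.toAlgHom.toLinearMap : A →ₗ[k] B))
          (PiTensorProduct.tprod k x))
    rw [PiTensorProduct.lift.tprod, PiTensorProduct.map_tprod, PiTensorProduct.lift.tprod]
    exact (PiTensorProduct.map_tprod _ _).trans (congrArg _ this)
end InvolutiveAlgebra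

end Bar

/-! ### Hyperoctahedral homology -/

section Homology
open FunctorHomology

variable {k : Type u} [CommRing k]

/-- Hyperoctahedral homology `HO_n(A) = Tor_n^{ΔH}(k^*, H_A)`, with `k^*` the constant right
`ΔH`-module at `k`. -/
noncomputable def HO (A : InvolutiveAlgebra k) (n : ℕ) : ModuleCat.{u} k :=
  functorTor n ((Functor.const DeltaHᵒᵖ).obj (ModuleCat.of k k)) A.barConstruction

/-- The map `HO_n(A) ⟶ HO_n(B)` induced by a map of involutive algebras. -/
noncomputable def HOMap {A B : InvolutiveAlgebra k} (φ : A →⋆ₐ[k] B) (n : ℕ) :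
    HO A n ⟶ HO B n :=
  functorTorMap n _ (InvolutiveAlgebra.barConstructionMap φ)

/-- Hyperoctahedral homology with coefficients `HO_n(A; M)`, the homology of
`C_*(ΔH, H_A) ⊗ M`. -/
noncomputable def HOCoeff (A : InvolutiveAlgebra k) (M : ModuleCat.{u} k) (n : ℕ) :
    ModuleCat.{u} k :=
  (complexTensor M A.barConstruction).homology n

/-- The map `HO_n(A; M) ⟶ HO_n(B; N)` induced by `A ⟶ B` and `M ⟶ N`. -/
noncomputable def HOCoeffMap {A B : InvolutiveAlgebra k} (φ : A →⋆ₐ[k] B)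
    {M N : ModuleCat.{u} k} (g : M ⟶ N) (n : ℕ) : HOCoeff A M n ⟶ HOCoeff B N n :=
  HomologicalComplex.homologyMap
    (complexTensorMap g (InvolutiveAlgebra.barConstructionMap φ)) n

end Homology

/-! ### Spectral sequences and convergence -/

/-- First quadrant homological spectral sequences starting at `E²`: the differential `dʳ` goes from
`(p, q)` to `(p - r, q + r - 1)`. -/
abbrev E₂HomologicalSpectralSequence (k : Type u) [CommRing k] :=
  SpectralSequence (ModuleCat.{u} k)
    (fun r => ComplexShape.spectralSequenceNat (⟨-r, r - 1⟩ : ℤ × ℤ)) 2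

/-- Convergence of a first quadrant spectral sequence to `H_*`: a finite filtration
`0 = F_{-1} ⊆ F_0 ⊆ ⋯ ⊆ F_n = H_n` for each `n` with `F_p / F_{p-1} ≅ E^∞_{p,n-p}`. All
differentials from and to the position `(p, q)` vanish from page `p + q + 2` on, so
`E^∞_{p,q}` is the term of that page. -/
structure ConvergesTo {k : Type u} [CommRing k] (E : E₂HomologicalSpectralSequence k)
    (H : ℕ → ModuleCat.{u} k) where
  filtration (n : ℕ) : ℤ → Submodule k (H n)
  mono (n : ℕ) : Monotone (filtration n)
  bot (n : ℕ) : filtration n (-1) = ⊥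
  top (n : ℕ) : filtration n n = ⊤
  graded (p q : ℕ) :
    (filtration (p + q) p ⧸
      (filtration (p + q) ((p : ℤ) - 1)).submoduleOf (filtration (p + q) p)) ≃ₗ[k]
    (E.page ((p : ℤ) + q + 2)).X (p, q)

/-! ### Universal coefficients -/

section UniversalCoefficients
open MonoidalCategory

/-- A spectral sequence with `E²_{p,q} ≅ Tor_p^k(HO_q(A), M)` that converges to `HO_*(A; M)`. -/
structure UniversalCoefficientSpectralSequence {k : Type u} [CommRing k]
    (A : InvolutiveAlgebra k) (M : ModuleCat.{u} k) where
  E : E₂HomologicalSpectralSequence k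
  pageTwo (p q : ℕ) :
    (E.page 2).X (p, q) ≅ ((Tor (ModuleCat.{u} k) p).obj (HO A q)).obj M
  converges : ConvergesTo E (HOCoeff A M)

/-- The weak global dimension of `k`. -/
noncomputable def weakGlobalDimension (k : Type u) [CommRing k] : ℕ∞ :=
  sSup {d | ∃ n : ℕ, d = n ∧ ∃ M N : ModuleCat.{u} k,
    ¬ Limits.IsZero (((Tor (ModuleCat.{u} k) n).obj M).obj N)}

/-- Every ideal is projective. -/
def IsHereditary (k : Type u) [CommRing k] : Prop :=
  ∀ I : Ideal k, Module.Projective k I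

/-- Short exact sequences
`0 ⟶ HO_n(A) ⊗ M ⟶ HO_n(A; M) ⟶ Tor_1^k(HO_{n-1}(A), M) ⟶ 0`
for all flat involutive algebras `A`, all modules `M` and all `n ≥ 0`, natural in `A` and `M`.
For `n = 0` the term on the right is zero, as `HO_{-1}(A) = 0`. -/
structure UniversalCoefficientSequences (k : Type u) [CommRing k] where
  ι (A : InvolutiveAlgebra k) (hA : Module.Flat k A) (M : ModuleCat.{u} k) (n : ℕ) :
    HO A n ⊗ M ⟶ HOCoeff A M n
  δ (A : InvolutiveAlgebra k) (hA : Module.Flat k A) (M : ModuleCat.{u} k) (n : ℕ) :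
    HOCoeff A M (n + 1) ⟶ ((Tor (ModuleCat.{u} k) 1).obj (HO A n)).obj M
  isIso_zero (A : InvolutiveAlgebra k) (hA : Module.Flat k A) (M : ModuleCat.{u} k) :
    IsIso (ι A hA M 0)
  comp_zero (A : InvolutiveAlgebra k) (hA : Module.Flat k A) (M : ModuleCat.{u} k) (n : ℕ) :
    ι A hA M (n + 1) ≫ δ A hA M n = 0
  shortExact (A : InvolutiveAlgebra k) (hA : Module.Flat k A) (M : ModuleCat.{u} k) (n : ℕ) :
    (ShortComplex.mk _ _ (comp_zero A hA M n)).ShortExact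
  ι_naturality {A B : InvolutiveAlgebra k} (hA : Module.Flat k A) (hB : Module.Flat k B)
    (φ : A →⋆ₐ[k] B) {M N : ModuleCat.{u} k} (g : M ⟶ N) (n : ℕ) :
    ι A hA M n ≫ HOCoeffMap φ g n = (HOMap φ n ⊗ₘ g) ≫ ι B hB N n
  δ_naturality {A B : InvolutiveAlgebra k} (hA : Module.Flat k A) (hB : Module.Flat k B)
    (φ : A →⋆ₐ[k] B) {M N : ModuleCat.{u} k} (g : M ⟶ N) (n : ℕ) :
    δ A hA M n ≫ ((Tor (ModuleCat.{u} k) 1).map (HOMap φ n)).app M ≫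
        ((Tor (ModuleCat.{u} k) 1).obj (HO B n)).map g =
      HOCoeffMap φ g (n + 1) ≫ δ B hB N n

/-- The sequence in degree `n + 1`. -/
noncomputable def UniversalCoefficientSequences.sequence {k : Type u} [CommRing k]
    (S : UniversalCoefficientSequences k) (A : InvolutiveAlgebra k) (hA : Module.Flat k A)
    (M : ModuleCat.{u} k) (n : ℕ) : ShortComplex (ModuleCat.{u} k) :=
  ShortComplex.mk (S.ι A hA M (n + 1)) (S.δ A hA M n) (S.comp_zero A hA M n)

/-- A choice of splittings, for a fixed module `M` and in a fixed degree `n + 1`, of the sequences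
of all projective involutive algebras, compatible with all maps of such algebras. -/
structure UniversalCoefficientSequences.NaturalSplitting {k : Type u} [CommRing k]
    (S : UniversalCoefficientSequences k) (M : ModuleCat.{u} k) (n : ℕ) where
  splitting (A : InvolutiveAlgebra k) (hA : Module.Projective k A) :
    (S.sequence A Module.Flat.of_projective M n).Splitting
  naturality {A B : InvolutiveAlgebra k} (hA : Module.Projective k A)
    (hB : Module.Projective k B) (φ : A →⋆ₐ[k] B) :
    HOCoeffMap φ (𝟙 M) (n + 1) ≫ (splitting B hB).r =
      (splitting A hA).r ≫ (HOMap φ (n + 1) ▷ M)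

end UniversalCoefficients

/-! The positive part is a statement about one complex. The constant right module has a bar
resolution whose $n$-th term is free on the strings $C_0\to\cdots\to C_n$; tensoring it with $F$
over $C$ gives the Gabriel–Zisman complex, so that $HO_n(A)=H_n(L)$ with $L=C_\star(\Delta H,\mathsf
H_A)$, naturally in $A$ (`functorTorIso`, `functorTorIso_naturality`). For flat $A$ the terms of
$L$, sums of tensor powers of $A$, are flat. Nothing else about $\Delta H$ is used until the
counterexample.

Resolve $M$, not $L$: let $K_0=M$ and $0\to K_{p+1}\to P_p\to K_p\to 0$ with $P_p$ projective.
Tensoring with $L$ keeps these sequences exact, and their long exact homology sequences form an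
exact couple with $D_{p,q}=H_q(L\otimes K_p)$ and $E_{p,q}=H_q(L\otimes P_p)$ (`couple`). As $P_p$
is flat, $E_{p,q}\cong H_q(L)\otimes P_p$ (`isIso_univ_of_flat`), so the second page is
$\mathrm{Tor}_p(H_q(L),M)$. The abutment is the column $D_{0,n}=H_n(L\otimes M)$, filtered by the
kernels of the iterated connecting maps, which vanish after $n+1$ steps. The piece $F_0$ is the
image of $H_n(L\otimes P_0)$, which is the image of $H_n(L)\otimes M$ (`range_univ`).

If the weak global dimension is at most one, the vanishing of $\mathrm{Tor}_2$ makes $K_1$ flat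
(`flat_syz_one`). Then $H_n(L\otimes K_1)\cong H_n(L)\otimes K_1$, and the long exact sequence for
$p=0$ breaks up into the desired short ones, because $\mathrm{Tor}_1(H_n(L),M)$ is the kernel of
$H_n(L)\otimes K_1\to H_n(L)\otimes P_0$. If $k$ is hereditary and $L$ projective, the cycles are a
direct summand of the chains; the class map extends to $h:L_n\to H_n(L)$, and $h\otimes M$ induces a
retraction.

For the failure of naturality let $A_c$ be the algebra with basis $1,x,y,z$ and $xy=cz=-yx$. The
one-chain $u_c$ that compares $yx$ with $xy$ has boundary $-2cz$. Hence $u_c\otimes\bar 1$ is a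
cycle over $k/c$, while $u_0$ is already a cycle over $k$, and the map $A_c\to A_0$ that kills $z$
sends $u_c$ to $u_0$. The deformation $A_1$ of $A_0$ yields a one-cocycle on $A_0$ with value $-2$
on $u_0$; its pullback to $A_c$ becomes a coboundary after multiplication by $c$, so over a domain
it vanishes on $HO_1(A_c;k)$. A natural splitting would make $u_0$ congruent modulo $c$ to a class
coming from $A_c$, hence $c\mid 2$ (`NaturalSplitting.dvd`). Over the integers $c=3$ is a
contradiction. -/

/-! ### The bar resolution of the constant right module -/

namespace FunctorHomology
variable {k : Type u} [CommRing k] {C : Type} [SmallCategory C]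
open scoped Classical

/-- The left `C`-module `d ↦ k[Hom(c, d)]`. -/
noncomputable def freeHom (k : Type u) [CommRing k] (c : C) : C ⥤ ModuleCat.{u} k where
  obj d := ModuleCat.of k ((c ⟶ d) →₀ k)
  map f := ModuleCat.ofHom (Finsupp.lmapDomain k k fun α => α ≫ f)
  map_id d := by
    refine ModuleCat.hom_ext (Finsupp.lhom_ext' fun α => LinearMap.ext_ring ?_)
    simp
  map_comp f g := by
    refine ModuleCat.hom_ext (Finsupp.lhom_ext' fun α => LinearMap.ext_ring ?_)
    simp

theorem freeHom_map_single (c : C) {d e : C} (f : d ⟶ e) (α : c ⟶ d) (r : k) :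
    (freeHom k c).map f (Finsupp.single α r) = Finsupp.single (α ≫ f) r :=
  Finsupp.mapDomain_single

/-- Precomposition `k[Hom(c, -)] ⟶ k[Hom(c', -)]` with `c' ⟶ c`. -/
noncomputable def freeHomPrecomp {c c' : C} (β : c' ⟶ c) : freeHom k c ⟶ freeHom k c' where
  app d := ModuleCat.ofHom (Finsupp.lmapDomain k k fun α => β ≫ α)
  naturality d e f := by
    refine ModuleCat.hom_ext (Finsupp.lhom_ext' fun α => LinearMap.ext_ring ?_)
    exact ((congrArg (Finsupp.mapDomain _) Finsupp.mapDomain_single).trans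
      Finsupp.mapDomain_single).trans (((congrArg (Finsupp.mapDomain _)
        Finsupp.mapDomain_single).trans Finsupp.mapDomain_single).trans (by simp)).symm

theorem freeHomPrecomp_single {c c' d : C} (β : c' ⟶ c) (α : c ⟶ d) (r : k) :
    (freeHomPrecomp β).app d (Finsupp.single α r) = Finsupp.single (β ≫ α) r :=
  Finsupp.mapDomain_single

/-- The generator of `C_n(C, F)` in the summand of the string `s`. -/
noncomputable abbrev chain (F : C ⥤ ModuleCat.{u} k) {n : ℕ} (s : ComposableArrows C n)
    (x : F.obj (s.obj 0)) : chains F n :=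
  DirectSum.lof k _ (fun s : ComposableArrows C n => F.obj (s.obj 0)) s x

theorem simplicialModuleMap_chain {F F' : C ⥤ ModuleCat.{u} k} (Ψ : F ⟶ F') (n : SimplexCategoryᵒᵖ)
    (s : ComposableArrows C n.unop.len) (x : F.obj (s.obj 0)) :
    (simplicialModuleMap Ψ).app n (chain F s x) = chain F' s (Ψ.app _ x) :=
  DirectSum.lmap_lof _ _ _

/-- The simplicial module `C_*(C, F)` as a functor of `F`. -/
noncomputable def simplicialModuleFunctor :
    (C ⥤ ModuleCat.{u} k) ⥤ SimplicialObject (ModuleCat.{u} k) where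
  obj F := simplicialModule F
  map Ψ := simplicialModuleMap Ψ
  map_id F := by
    refine NatTrans.ext (funext fun n => ModuleCat.hom_ext
      (DirectSum.linearMap_ext _ fun s => LinearMap.ext fun x => ?_))
    exact simplicialModuleMap_chain _ _ s x
  map_comp Ψ Ψ' := by
    refine NatTrans.ext (funext fun n => ModuleCat.hom_ext
      (DirectSum.linearMap_ext _ fun s => LinearMap.ext fun x => ?_))
    refine (simplicialModuleMap_chain _ _ s x).trans ?_
    exact ((congrArg ((simplicialModuleMap Ψ').app n) (simplicialModuleMap_chain Ψ n s x)).trans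
      (simplicialModuleMap_chain Ψ' n s _)).symm

/-- The contravariant functor `c ↦ k[Hom(c, -)]`. -/
noncomputable def freeHomFunctor (k : Type u) [CommRing k] (C : Type) [SmallCategory C] :
    Cᵒᵖ ⥤ C ⥤ ModuleCat.{u} k where
  obj c := freeHom k c.unop
  map β := freeHomPrecomp β.unop
  map_id c := by
    refine NatTrans.ext (funext fun d => ModuleCat.hom_ext
      (Finsupp.lhom_ext' fun α => LinearMap.ext_ring ?_))
    exact Finsupp.mapDomain_single.trans (by simp; rfl)
  map_comp β γ := by
    refine NatTrans.ext (funext fun d => ModuleCat.hom_ext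
      (Finsupp.lhom_ext' fun α => LinearMap.ext_ring ?_))
    exact Finsupp.mapDomain_single.trans (((congrArg (Finsupp.mapDomain _)
        Finsupp.mapDomain_single).trans Finsupp.mapDomain_single).trans (by simp)).symm

/-- The bar resolution, as a simplicial right `C`-module. -/
noncomputable def barSimplicial (k : Type u) [CommRing k] (C : Type) [SmallCategory C] :
    SimplicialObject (Cᵒᵖ ⥤ ModuleCat.{u} k) :=
  (freeHomFunctor k C ⋙ simplicialModuleFunctor).flip

/-- The bar resolution of the constant right `C`-module. -/
noncomputable def barComplex (k : Type u) [CommRing k] (C : Type) [SmallCategory C] :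
    ChainComplex (Cᵒᵖ ⥤ ModuleCat.{u} k) ℕ :=
  (AlgebraicTopology.alternatingFaceMapComplex _).obj (barSimplicial k C)

/-- The generator of the bar resolution given by a string starting with `α`. -/
noncomputable abbrev barGen (k : Type u) [CommRing k] {c : C} {n : ℕ} (s : ComposableArrows C n)
    (α : c ⟶ s.obj 0) : chains (freeHom k c) n :=
  chain (freeHom k c) s (Finsupp.single α 1 : (c ⟶ s.obj 0) →₀ k)

theorem bar_hom_ext {c : C} {n : ℕ} {N : Type*} [AddCommGroup N] [Module k N]
    {f g : chains (freeHom k c) n →ₗ[k] N}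
    (h : ∀ (s : ComposableArrows C n) (α : c ⟶ s.obj 0), f (barGen k s α) = g (barGen k s α)) :
    f = g :=
  DirectSum.linearMap_ext _ fun s => Finsupp.lhom_ext' fun α => LinearMap.ext_ring (h s α)

theorem simplicialMap_barGen {c : C} {m n : SimplexCategory} (θ : m ⟶ n)
    (s : ComposableArrows C n.len) (α : c ⟶ s.obj 0) :
    simplicialMap (freeHom k c) θ (barGen k s α) =
      barGen k (s.whiskerLeft (SimplexCategory.toCat.map θ).toFunctor)
        (α ≫ s.map (homOfLE (Fin.zero_le (θ.toOrderHom 0)))) := by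
  refine (simplicialMap_lof _ θ s _).trans ?_
  exact congrArg (chain (freeHom k c) (s.whiskerLeft (SimplexCategory.toCat.map θ).toFunctor))
    (freeHom_map_single _ _ _ _)

/-- Two generators agree if their strings, extended by the map from `c`, agree. -/
theorem barGen_congr {c : C} {n : ℕ} {s s' : ComposableArrows C n} {α : c ⟶ s.obj 0}
    {α' : c ⟶ s'.obj 0} (h : s = s') (h' : α ≫ eqToHom (by rw [h]) = α') :
    barGen k s α = barGen k s' α' := by
  subst h
  simp at h'
  rw [h']

/-- The contraction of the bar resolution. -/
noncomputable def barContraction (k : Type u) [CommRing k] (c : C) (n : ℕ) :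
    chains (freeHom k c) n →ₗ[k] chains (freeHom k c) (n + 1) :=
  DirectSum.toModule k _ _ fun s => Finsupp.linearCombination k fun α : c ⟶ s.obj 0 =>
    barGen k (s.precomp α) (𝟙 c)

theorem barContraction_barGen {c : C} {n : ℕ} (s : ComposableArrows C n) (α : c ⟶ s.obj 0) :
    barContraction k c n (barGen k s α) = barGen k (s.precomp α) (𝟙 c) := by
  refine (DirectSum.toModule_lof _ _ _).trans ?_
  exact (Finsupp.linearCombination_single _ _ _).trans (one_smul _ _)

/-- The faces of the bar resolution. -/
noncomputable abbrev barFace (k : Type u) [CommRing k] (c : C) (n : ℕ) (i : Fin (n + 2)) :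
    chains (freeHom k c) (n + 1) →ₗ[k] chains (freeHom k c) n :=
  simplicialMap (freeHom k c) (m := .mk n) (n := .mk (n + 1)) (SimplexCategory.δ i)

/-- The vertices of the extended string after the first are those of `s` only once the index is a
literal successor; the `eqToHom` bridges this and is the identity for such an index. -/
theorem precomp_map_of_eq {n : ℕ} (s : ComposableArrows C n) {c : C} (α : c ⟶ s.left)
    {j : Fin (n + 2)} {j' : Fin (n + 1)} (h : j = j'.succ) :
    (s.precomp α).map (homOfLE (Fin.zero_le j)) =
      α ≫ s.map (homOfLE (Fin.zero_le j')) ≫ eqToHom (by rw [h]; rfl) := by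
  subst h
  refine Eq.trans ?_ (congrArg (α ≫ ·) (Category.comp_id _).symm)
  obtain ⟨_ | j', hj⟩ := j'
  · refine Eq.trans ?_ ((Category.comp_id α).symm.trans
      (congrArg (α ≫ ·) (s.map_id _).symm))
    rfl
  · rfl

/-- Deleting the vertex that the contraction has just prepended composes `𝟙 c` with `α` and returns
the generator: the contraction is an extra degeneracy. -/
theorem barFace_zero_contraction (c : C) (n : ℕ) (x : chains (freeHom k c) n) :
    barFace k c n 0 (barContraction k c n x) = x := by
  suffices (barFace k c n 0).comp (barContraction k c n) = LinearMap.id from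
    DFunLike.congr_fun this x
  refine bar_hom_ext fun s α => ?_
  rw [LinearMap.comp_apply, barContraction_barGen, barFace]
  refine (simplicialMap_barGen (SimplexCategory.δ 0) (s.precomp α) (𝟙 c)).trans ?_
  refine barGen_congr (s := s) rfl ?_
  refine (Category.comp_id _).trans ((Category.id_comp _).trans ?_)
  refine (precomp_map_of_eq s α (j' := 0) rfl).trans ?_
  refine (congrArg (α ≫ ·) ((Category.comp_id _).trans (s.map_id 0))).trans ?_
  exact Category.comp_id _

/-- The hypotheses on `Φ` and `Ψ` are the relation between the cofaces `δ i.succ` and `δ i`: the new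
vertex is kept and the others move as before. This is the string part of the identity
$d_{i+1}h=h\,d_i$ for the contraction $h$. -/
theorem precomp_whiskerLeft_succ {m n : ℕ} (s : ComposableArrows C n) {c : C} (α : c ⟶ s.left)
    (Φ : Fin (m + 2) ⥤ Fin (n + 2)) (Ψ : Fin (m + 1) ⥤ Fin (n + 1)) (h₀ : Φ.obj 0 = 0)
    (h : ∀ j, Φ.obj j.succ = (Ψ.obj j).succ) :
    (s.precomp α).whiskerLeft Φ =
      (s.whiskerLeft Ψ).precomp (α ≫ s.map (homOfLE (Fin.zero_le (Ψ.obj 0)))) := by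
  have hΦ : Fin.succFunctor (m + 1) ⋙ Φ = Ψ ⋙ Fin.succFunctor (n + 1) :=
    CategoryTheory.Functor.ext h fun _ _ _ => Subsingleton.elim _ _
  refine ComposableArrows.ext_succ (congrArg (s.precomp α).obj h₀)
    (congrArg (s.precomp α).whiskerLeft hΦ) ?_
  have key : ∀ (i : Fin (n + 2)) (f : i ⟶ Φ.obj 1) (hi : i = 0), (s.precomp α).map f =
      eqToHom (congrArg (s.precomp α).obj hi) ≫
        (s.precomp α).map (homOfLE (Fin.zero_le (Φ.obj 1))) := by
    rintro i f rfl
    rw [eqToHom_refl, Category.id_comp]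
    congr 1
  refine (key _ (Φ.map (homOfLE (Fin.zero_le 1))) h₀).trans ?_
  refine congrArg (eqToHom _ ≫ ·) ((precomp_map_of_eq s α (h 0)).trans ?_)
  exact (Category.assoc _ _ _).symm

theorem barFace_succ_contraction (c : C) (n : ℕ) (i : Fin (n + 2))
    (x : chains (freeHom k c) (n + 1)) :
    barFace k c (n + 1) i.succ (barContraction k c (n + 1) x) =
      barContraction k c n (barFace k c n i x) := by
  suffices (barFace k c (n + 1) i.succ).comp (barContraction k c (n + 1)) =
    (barContraction k c n).comp (barFace k c n i) from
    DFunLike.congr_fun this x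
  refine bar_hom_ext fun s α => ?_
  rw [LinearMap.comp_apply, LinearMap.comp_apply, barContraction_barGen]
  refine (simplicialMap_barGen (SimplexCategory.δ i.succ) (s.precomp α) (𝟙 c)).trans ?_
  refine Eq.trans ?_ (congrArg _ (simplicialMap_barGen (SimplexCategory.δ i) s α)).symm
  refine Eq.trans ?_ (barContraction_barGen _ _).symm
  have h₀ : (SimplexCategory.toCat.map (SimplexCategory.δ i.succ)).toFunctor.obj
      (0 : Fin (n + 2)) = (0 : Fin (n + 3)) :=
    Fin.succAbove_ne_zero_zero (Fin.succ_ne_zero i)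
  refine barGen_congr (precomp_whiskerLeft_succ s α _ _ h₀ fun j =>
    Fin.succ_succAbove_succ i j) ?_
  have key : ∀ (j : Fin (n + 3)) (hj : j = 0), (s.precomp α).map (homOfLE (Fin.zero_le j)) =
      eqToHom (congrArg (s.precomp α).obj hj.symm) := by
    rintro _ rfl
    exact (s.precomp α).map_id 0
  refine (congrArg (· ≫ _) ((Category.id_comp _).trans (key _ h₀))).trans ?_
  exact (eqToHom_trans _ _).trans (eqToHom_refl _ _)

/-- The augmentation of the bar resolution. -/
noncomputable def barAugmentation (k : Type u) [CommRing k] (c : C) :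
    chains (freeHom k c) 0 →ₗ[k] k :=
  DirectSum.toModule k _ _ fun _ => Finsupp.linearCombination k fun _ => (1 : k)

theorem barAugmentation_barGen {c : C} (s : ComposableArrows C 0) (α : c ⟶ s.obj 0) :
    barAugmentation k c (barGen k s α) = 1 := by
  refine (DirectSum.toModule_lof _ _ _).trans ?_
  exact (Finsupp.linearCombination_single _ _ _).trans (one_smul _ _)

/-- In degree zero the last face leaves only the prepended vertex with its identity, whatever the
generator was. All generators have the same image, so the map factors through the augmentation. -/
theorem barFace_one_contraction (c : C) (x : chains (freeHom k c) 0) :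
    barFace k c 0 1 (barContraction k c 0 x) =
      barAugmentation k c x • barGen k (ComposableArrows.mk₀ c) (𝟙 c) := by
  suffices (barFace k c 0 1).comp (barContraction k c 0) =
    (barAugmentation k c).smulRight (barGen k (ComposableArrows.mk₀ c) (𝟙 c)) from
    DFunLike.congr_fun this x
  refine bar_hom_ext fun s α => ?_
  rw [LinearMap.comp_apply, barContraction_barGen]
  refine Eq.trans ?_ ((congrArg (· • barGen k (ComposableArrows.mk₀ c) (𝟙 c))
    (barAugmentation_barGen s α)).trans
    (one_smul k _)).symm
  refine (simplicialMap_barGen (SimplexCategory.δ 1) (s.precomp α) (𝟙 c)).trans ?_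
  refine barGen_congr (ComposableArrows.ext₀ rfl) ?_
  refine (Category.comp_id _).trans ((Category.id_comp _).trans ?_)
  exact (s.precomp α).map_id 0

theorem barAugmentation_barFace (c : C) (i : Fin 2) (x : chains (freeHom k c) 1) :
    barAugmentation k c (barFace k c 0 i x) =
      barAugmentation k c (barFace k c 0 0 x) := by
  suffices (barAugmentation k c).comp (barFace k c 0 i) =
    (barAugmentation k c).comp (barFace k c 0 0) from DFunLike.congr_fun this x
  refine bar_hom_ext fun s α => ?_
  refine (congrArg (barAugmentation k c)
    (simplicialMap_barGen (SimplexCategory.δ i) s α)).trans ?_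
  refine (barAugmentation_barGen _ _).trans ?_
  refine Eq.trans ?_ (congrArg (barAugmentation k c)
    (simplicialMap_barGen (SimplexCategory.δ 0) s α)).symm
  exact (barAugmentation_barGen _ _).symm

/-- The differential of the bar resolution. -/
noncomputable abbrev barD (k : Type u) [CommRing k] (c : C) (n : ℕ) :
    chains (freeHom k c) (n + 1) →ₗ[k] chains (freeHom k c) n :=
  ∑ i : Fin (n + 2), (-1 : ℤ) ^ (i : ℕ) • barFace k c n i

/-- Since $d_0h=1$, and $d_{i+1}h$ and $h\,d_i$ cancel by their signs, $dh+hd=1$. -/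
theorem barD_contraction_succ (c : C) (n : ℕ) (x : chains (freeHom k c) (n + 1)) :
    barD k c (n + 1) (barContraction k c (n + 1) x) + barContraction k c n (barD k c n x) = x := by
  rw [barD, barD, LinearMap.sum_apply, Fin.sum_univ_succ, LinearMap.sum_apply, map_sum, add_assoc,
    ← Finset.sum_add_distrib]
  have h (i : Fin (n + 2)) : ((-1 : ℤ) ^ ((i.succ : Fin (n + 3)) : ℕ) •
      barFace k c (n + 1) i.succ) (barContraction k c (n + 1) x) +
      barContraction k c n (((-1 : ℤ) ^ (i : ℕ) • barFace k c n i) x) = 0 := by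
    rw [LinearMap.smul_apply, LinearMap.smul_apply, barFace_succ_contraction, map_zsmul,
      Fin.val_succ, pow_succ, mul_neg_one, neg_smul, neg_add_cancel]
  rw [Finset.sum_congr rfl fun i _ => h i, Finset.sum_const_zero, add_zero, LinearMap.smul_apply,
    barFace_zero_contraction, Fin.val_zero, pow_zero, one_smul]

theorem barD_contraction_zero (c : C) (x : chains (freeHom k c) 0) :
    barD k c 0 (barContraction k c 0 x) +
      barAugmentation k c x • barGen k (ComposableArrows.mk₀ c) (𝟙 c) = x := by
  rw [barD, LinearMap.sum_apply, Fin.sum_univ_two]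
  simp [barFace_zero_contraction, barFace_one_contraction]

theorem barAugmentation_barD (c : C) (x : chains (freeHom k c) 1) :
    barAugmentation k c (barD k c 0 x) = 0 := by
  rw [barD, LinearMap.sum_apply, Fin.sum_univ_two]
  simp [barAugmentation_barFace c 1 x]

theorem complex_d_hom (F : C ⥤ ModuleCat.{u} k) (n : ℕ) :
    ((complex F).d (n + 1) n).hom = ∑ i : Fin (n + 2), (-1 : ℤ) ^ (i : ℕ) •
      simplicialMap F (m := .mk n) (n := .mk (n + 1)) (SimplexCategory.δ i) := by
  refine (congrArg ModuleCat.Hom.hom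
    (AlgebraicTopology.alternatingFaceMapComplex_obj_d (simplicialModule F) n)).trans ?_
  rw [AlgebraicTopology.AlternatingFaceMapComplex.objD, ModuleCat.hom_sum]
  rfl

theorem barComplex_d_app (c : Cᵒᵖ) (n : ℕ) :
    (((barComplex k C).d (n + 1) n).app c).hom = barD k c.unop n := by
  refine (congrArg (fun f : (barComplex k C).X (n + 1) ⟶ (barComplex k C).X n => (f.app c).hom)
    (AlgebraicTopology.alternatingFaceMapComplex_obj_d (barSimplicial k C) n)).trans ?_
  rw [AlgebraicTopology.AlternatingFaceMapComplex.objD, NatTrans.app_sum]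
  exact ModuleCat.hom_sum _ _

theorem barComplex_map_barGen {c c' : Cᵒᵖ} (β : c ⟶ c') {n : ℕ} (s : ComposableArrows C n)
    (α : c.unop ⟶ s.obj 0) :
    ((barComplex k C).X n).map β (barGen k s α) = barGen k s (β.unop ≫ α) :=
  (simplicialModuleMap_chain (freeHomPrecomp β.unop) (.op (.mk n)) s _).trans
    (congrArg (chain (freeHom k c'.unop) s) (freeHomPrecomp_single _ _ _))

/-- A map out of a right module of the bar resolution, given on generators. -/
noncomputable def barDescApp {G : Cᵒᵖ ⥤ ModuleCat.{u} k} {n : ℕ}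
    (g : ∀ s : ComposableArrows C n, G.obj (.op (s.obj 0))) (c : C) :
    chains (freeHom k c) n →ₗ[k] G.obj (.op c) :=
  DirectSum.toModule k _ _ fun s =>
    Finsupp.linearCombination k fun α : c ⟶ s.obj 0 => G.map α.op (g s)

theorem barDescApp_barGen {G : Cᵒᵖ ⥤ ModuleCat.{u} k} {n : ℕ}
    (g : ∀ s : ComposableArrows C n, G.obj (.op (s.obj 0))) {c : C} (s : ComposableArrows C n)
    (α : c ⟶ s.obj 0) : barDescApp g c (barGen k s α) = G.map α.op (g s) := by
  refine (DirectSum.toModule_lof _ _ _).trans ?_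
  exact (Finsupp.linearCombination_single _ _ _).trans (one_smul _ _)

/-- A map of right `C`-modules out of the bar resolution, given on generators. -/
noncomputable def barDesc {G : Cᵒᵖ ⥤ ModuleCat.{u} k} {n : ℕ}
    (g : ∀ s : ComposableArrows C n, G.obj (.op (s.obj 0))) : (barComplex k C).X n ⟶ G where
  app c := ModuleCat.ofHom (barDescApp g c.unop)
  naturality c c' β := by
    refine ModuleCat.hom_ext (bar_hom_ext fun s α => ?_)
    refine (congrArg (barDescApp g c'.unop) (barComplex_map_barGen β s α)).trans ?_
    refine (barDescApp_barGen _ _ _).trans ?_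
    refine Eq.trans ?_ (congrArg (G.map β) (barDescApp_barGen g s α)).symm
    exact ConcreteCategory.congr_hom (G.map_comp α.op β) (g s)

/-- By the Yoneda lemma a map out of this term is a free choice of one element of $G(C_0)$ for each
string. Epimorphisms of right modules are onto in each degree, so these elements can be lifted. -/
instance barComplex_projective (n : ℕ) : Projective ((barComplex k C).X n) where
  factors {G G'} f e he := by
    have (s : ComposableArrows C n) : ∃ x : G.obj (.op (s.obj 0)),
        e.app _ x = f.app (.op (s.obj 0)) (barGen k s (𝟙 _)) :=
      (ModuleCat.epi_iff_surjective _).1 ((NatTrans.epi_iff_epi_app _).1 he _) _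
    choose g hg using this
    refine ⟨barDesc g, NatTrans.ext (funext fun c => ModuleCat.hom_ext
      (bar_hom_ext fun s α => ?_))⟩
    refine (congrArg (e.app c) (barDescApp_barGen g s α)).trans ?_
    refine (ConcreteCategory.congr_hom (e.naturality α.op) (g s)).trans ?_
    refine (congrArg (G'.map α.op) (hg s)).trans ?_
    refine (ConcreteCategory.congr_hom (f.naturality α.op) (barGen k s (𝟙 _))).symm.trans ?_
    refine congrArg (f.app c) ((barComplex_map_barGen _ _ _).trans ?_)
    exact congrArg (barGen k s) (Category.comp_id _)

/-- The constant right `C`-module at `k`. -/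
noncomputable abbrev constModule (k : Type u) [CommRing k] (C : Type) [SmallCategory C] :
    Cᵒᵖ ⥤ ModuleCat.{u} k :=
  (Functor.const Cᵒᵖ).obj (ModuleCat.of k k)

/-- The augmentation of the bar resolution, as a map of right modules. -/
noncomputable def barε (k : Type u) [CommRing k] (C : Type) [SmallCategory C] :
    (barComplex k C).X 0 ⟶ constModule k C where
  app c := ModuleCat.ofHom (barAugmentation k c.unop)
  naturality c c' β := by
    refine ModuleCat.hom_ext (bar_hom_ext fun s α => ?_)
    refine (congrArg (barAugmentation k c'.unop) (barComplex_map_barGen β s α)).trans ?_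
    exact (barAugmentation_barGen _ _).trans (barAugmentation_barGen _ _).symm

theorem barComplex_d_comp_barε : (barComplex k C).d 1 0 ≫ barε k C = 0 := by
  refine NatTrans.ext (funext fun c => ModuleCat.hom_ext (LinearMap.ext fun x => ?_))
  refine (congrArg (barAugmentation k c.unop)
    (DFunLike.congr_fun (barComplex_d_app c 0) x)).trans ?_
  exact barAugmentation_barD _ _

/-- The augmentation of the bar resolution, as a map of complexes. -/
noncomputable def barπ (k : Type u) [CommRing k] (C : Type) [SmallCategory C] :
    barComplex k C ⟶ (ChainComplex.single₀ _).obj (constModule k C) :=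
  (ChainComplex.toSingle₀Equiv _ _).symm ⟨barε k C, barComplex_d_comp_barε⟩

/-- A chain complex mapping to a complex concentrated in degree `0` is a resolution if the
augmented complex is exact. -/
theorem quasiIso_of_exact {A : Type*} [Category A] [Abelian A] {K L : ChainComplex A ℕ}
    (f : K ⟶ L) (hL : ∀ n, Limits.IsZero (L.X (n + 1)))
    (h : ∀ n, (ShortComplex.mk _ _ (K.d_comp_d (n + 2) (n + 1) n)).Exact)
    (h₀ : (ShortComplex.mk (K.d 1 0) (f.f 0) (by
      rw [← f.comm, (hL 0).eq_of_tgt (f.f 1) 0, Limits.zero_comp])).Exact)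
    (he : Epi (f.f 0)) : QuasiIso f where
  quasiIsoAt n := by
    obtain _ | n := n
    · rw [ChainComplex.quasiIsoAt₀_iff, ShortComplex.quasiIso_iff_of_zeros']
      · exact ⟨h₀, he⟩
      · exact K.shape _ _ (by simp)
      · exact (hL 0).eq_of_src _ _
      · exact L.shape _ _ (by simp)
    · rw [quasiIsoAt_iff_exactAt' f (n + 1)
        (ShortComplex.exact_of_isZero_X₂ _ (hL n))]
      exact (HomologicalComplex.exactAt_iff' _ (n + 2) (n + 1) n (by simp) (by simp)).2 (h n)

/-- Exactness may be tested after evaluation at an object, where the contraction supplies preimages.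
The contraction is not natural in the object, so it is used only there. -/
instance barπ_quasiIso : QuasiIso (barπ k C) := by
  rw [HomologicalComplex.quasiIso_iff_evaluation]
  intro c
  refine quasiIso_of_exact _ (fun n => ?_) (fun n => ?_) ?_ ?_
  · exact ((evaluation Cᵒᵖ (ModuleCat.{u} k)).obj c).map_isZero
      (HomologicalComplex.isZero_single_obj_X (.down ℕ) 0 _ (n + 1) (by simp))
  · rw [ShortComplex.moduleCat_exact_iff]
    intro x hx
    replace hx : barD k c.unop n x = 0 :=
      (DFunLike.congr_fun (barComplex_d_app c n) x).symm.trans hx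
    refine ⟨barContraction k c.unop (n + 1) x, ?_⟩
    refine (DFunLike.congr_fun (barComplex_d_app c (n + 1)) _).trans ?_
    have := barD_contraction_succ c.unop n x
    rwa [hx, map_zero, add_zero] at this
  · rw [ShortComplex.moduleCat_exact_iff]
    intro x hx
    replace hx : barAugmentation k c.unop x = 0 := hx
    refine ⟨barContraction k c.unop 0 x, ?_⟩
    refine (DFunLike.congr_fun (barComplex_d_app c 0) _).trans ?_
    have := barD_contraction_zero c.unop x
    rwa [hx, zero_smul, add_zero] at this
  · rw [ModuleCat.epi_iff_surjective]
    intro r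
    refine ⟨(show k from r) • barGen k (ComposableArrows.mk₀ c.unop) (𝟙 _), ?_⟩
    refine (map_smul (barAugmentation k c.unop) _ _).trans ?_
    refine (congrArg ((show k from r) • ·) (barAugmentation_barGen (k := k) _ _)).trans (mul_one _)

/-- The bar resolution of the constant right `C`-module. -/
noncomputable def barResolution (k : Type u) [CommRing k] (C : Type) [SmallCategory C] :
    ProjectiveResolution (constModule k C) where
  complex := barComplex k C
  projective := barComplex_projective
  π := barπ k C
  quasiIso := barπ_quasiIso

end FunctorHomology

/-! ### Tor as the homology of the Gabriel–Zisman complex -/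

namespace FunctorHomology
variable {k : Type u} [CommRing k] {C : Type} [SmallCategory C]
open scoped Classical TensorProduct

/-- The class of `x ⊗ y` in `G ⊗_C F`. -/
noncomputable abbrev tensorMk (G : Cᵒᵖ ⥤ ModuleCat.{u} k) (F : C ⥤ ModuleCat.{u} k) (c : C)
    (x : G.obj (.op c)) (y : F.obj c) : tensorObj G F :=
  Submodule.Quotient.mk (DirectSum.lof k C (fun c => G.obj (.op c) ⊗[k] F.obj c) c (x ⊗ₜ y))

theorem tensorMk_map (G : Cᵒᵖ ⥤ ModuleCat.{u} k) (F : C ⥤ ModuleCat.{u} k) {c d : C} (α : c ⟶ d)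
    (x : G.obj (.op d)) (y : F.obj c) :
    tensorMk G F c (G.map α.op x) y = tensorMk G F d x (F.map α y) :=
  (Submodule.Quotient.eq _).2 (Submodule.subset_span ⟨c, d, α, x, y, rfl⟩)

/-- The pairing `k[strings from c] × F(c) → C_n(C, F)`. -/
noncomputable def barPairing (F : C ⥤ ModuleCat.{u} k) (n : ℕ) (c : C) :
    chains (freeHom k c) n →ₗ[k] F.obj c →ₗ[k] chains F n :=
  DirectSum.toModule k _ _ fun s => Finsupp.linearCombination k fun α : c ⟶ s.obj 0 =>
    (DirectSum.lof k _ (fun s : ComposableArrows C n => F.obj (s.obj 0)) s) ∘ₗ (F.map α).hom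

theorem barPairing_barGen (F : C ⥤ ModuleCat.{u} k) {n : ℕ} {c : C} (s : ComposableArrows C n)
    (α : c ⟶ s.obj 0) (y : F.obj c) :
    barPairing F n c (barGen k s α) y = chain F s (F.map α y) := by
  have : barPairing F n c (barGen k s α) =
      (DirectSum.lof k _ (fun s : ComposableArrows C n => F.obj (s.obj 0)) s) ∘ₗ (F.map α).hom :=
    (DirectSum.toModule_lof _ _ _).trans
      ((Finsupp.linearCombination_single _ _ _).trans (one_smul _ _))
  exact DFunLike.congr_fun this y

/-- `P_n ⊗_C F → C_n(C, F)` for the bar resolution `P`. -/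
noncomputable def barTensorHom (F : C ⥤ ModuleCat.{u} k) (n : ℕ) :
    tensorObj ((barComplex k C).X n) F →ₗ[k] chains F n :=
  (relations _ F).liftQ (DirectSum.toModule k _ _ fun c => TensorProduct.lift (barPairing F n c)) (by
    rw [relations, Submodule.span_le]
    rintro _ ⟨c, d, β, x, y, rfl⟩
    refine LinearMap.mem_ker.2 ((map_sub _ _ _).trans (sub_eq_zero.2 ?_))
    refine (DirectSum.toModule_lof _ _ _).trans ?_
    refine Eq.trans ?_ (DirectSum.toModule_lof _ _ _).symm
    refine (TensorProduct.lift.tmul _ _).trans ?_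
    refine Eq.trans ?_ (TensorProduct.lift.tmul _ _).symm
    suffices ((barPairing F n c).flip y).comp (((barComplex k C).X n).map β.op).hom =
        (barPairing F n d).flip (F.map β y) from DFunLike.congr_fun this x
    refine bar_hom_ext fun s α => ?_
    refine (congrArg ((barPairing F n c).flip y) (barComplex_map_barGen β.op s α)).trans ?_
    refine (barPairing_barGen F s _ y).trans ?_
    refine Eq.trans ?_ (barPairing_barGen F s α _).symm
    exact congrArg (chain F s) (ConcreteCategory.congr_hom (F.map_comp β α) y))

theorem barTensorHom_mk (F : C ⥤ ModuleCat.{u} k) {n : ℕ} {c : C} (s : ComposableArrows C n)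
    (α : c ⟶ s.obj 0) (y : F.obj c) :
    barTensorHom F n (tensorMk ((barComplex k C).X n) F c (barGen k s α) y) =
      chain F s (F.map α y) := by
  refine ((relations _ F).liftQ_apply _ _).trans ?_
  refine (DirectSum.toModule_lof _ _ _).trans ?_
  exact (TensorProduct.lift.tmul _ _).trans (barPairing_barGen F s α y)

theorem barTensor_hom_ext {F : C ⥤ ModuleCat.{u} k} {n : ℕ} {N : Type*} [AddCommGroup N]
    [Module k N] {f g : tensorObj ((barComplex k C).X n) F →ₗ[k] N}
    (h : ∀ (c : C) (s : ComposableArrows C n) (α : c ⟶ s.obj 0) (y : F.obj c),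
      f (tensorMk ((barComplex k C).X n) F c (barGen k s α) y) =
        g (tensorMk ((barComplex k C).X n) F c (barGen k s α) y)) : f = g := by
  refine Submodule.linearMap_qext _ (DirectSum.linearMap_ext _ fun c =>
    TensorProduct.ext (bar_hom_ext fun s α => LinearMap.ext fun y => h c s α y))

/-- The inverse of `barTensorHom`. -/
noncomputable def barTensorInv (F : C ⥤ ModuleCat.{u} k) (n : ℕ) :
    chains F n →ₗ[k] tensorObj ((barComplex k C).X n) F :=
  DirectSum.toModule k _ _ fun s => (relations _ F).mkQ ∘ₗ
    (DirectSum.lof k C (fun c => ((barComplex k C).X n).obj (.op c) ⊗[k] F.obj c) (s.obj 0)) ∘ₗ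
      TensorProduct.mk k _ _ (barGen k s (𝟙 _))

theorem barTensorInv_chain (F : C ⥤ ModuleCat.{u} k) {n : ℕ} (s : ComposableArrows C n)
    (y : F.obj (s.obj 0)) : barTensorInv F n (chain F s y) =
      tensorMk ((barComplex k C).X n) F _ (barGen k s (𝟙 _)) y :=
  DirectSum.toModule_lof _ _ _

/-- `P_n ⊗_C F ≃ C_n(C, F)` for the bar resolution `P`. -/
noncomputable def barTensorEquiv (F : C ⥤ ModuleCat.{u} k) (n : ℕ) :
    tensorObj ((barComplex k C).X n) F ≃ₗ[k] chains F n :=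
  LinearEquiv.ofLinearMap (barTensorHom F n) (barTensorInv F n)
    (DirectSum.linearMap_ext _ fun s => LinearMap.ext fun y => by
      refine (congrArg (barTensorHom F n) (barTensorInv_chain F s y)).trans ?_
      refine (barTensorHom_mk F s _ y).trans ?_
      exact congrArg (chain F s) (ConcreteCategory.congr_hom (F.map_id _) y))
    (barTensor_hom_ext fun c s α y => by
      refine (congrArg (barTensorInv F n) (barTensorHom_mk F s α y)).trans ?_
      refine (barTensorInv_chain F s _).trans ?_
      -- The defining relation of the tensor product moves `α` from the left factor to the right
      -- one, so every class comes from a generator with identity map.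
      refine (tensorMk_map _ F α _ y).symm.trans ?_
      refine congrArg (tensorMk ((barComplex k C).X n) F c · y) ?_
      refine (barComplex_map_barGen α.op s (𝟙 _)).trans ?_
      exact congrArg (barGen k s) (Category.comp_id _))

theorem complex_d_apply (F : C ⥤ ModuleCat.{u} k) (n : ℕ) (x : chains F (n + 1)) :
    @Eq (chains F n) ((complex F).d (n + 1) n x) (∑ i : Fin (n + 2), (-1 : ℤ) ^ (i : ℕ) •
      simplicialMap F (m := .mk n) (n := .mk (n + 1)) (SimplexCategory.δ i) x) := by
  refine Eq.trans (b := (∑ i : Fin (n + 2), (-1 : ℤ) ^ (i : ℕ) •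
      simplicialMap F (m := .mk n) (n := .mk (n + 1)) (SimplexCategory.δ i) :
      chains F (n + 1) →ₗ[k] chains F n) x) (DFunLike.congr_fun (complex_d_hom F n) x) ?_
  rw [LinearMap.sum_apply]
  rfl

theorem barTensorHom_d (F : C ⥤ ModuleCat.{u} k) (n : ℕ)
    (x : tensorObj ((barComplex k C).X (n + 1)) F) :
    barTensorHom F n (tensorMap ((barComplex k C).d (n + 1) n) (𝟙 F) x) =
      (complex F).d (n + 1) n (barTensorHom F (n + 1) x) := by
  suffices (barTensorHom F n).comp (tensorMap ((barComplex k C).d (n + 1) n) (𝟙 F)) =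
    ((complex F).d (n + 1) n).hom.comp (barTensorHom F (n + 1)) from DFunLike.congr_fun this x
  refine barTensor_hom_ext fun c s α y => ?_
  refine (congrArg (barTensorHom F n) (tensorMap_mk _ _ _ _ _)).trans ?_
  refine Eq.trans ?_ (congrArg ((complex F).d (n + 1) n) (barTensorHom_mk F s α y)).symm
  refine Eq.trans ?_ (complex_d_apply F n _).symm
  refine Eq.trans ((relations _ F).liftQ_apply _ _) ?_
  refine (DirectSum.toModule_lof _ _ _).trans ?_
  refine (TensorProduct.lift.tmul _ _).trans ?_
  have hd : @Eq (chains (freeHom k c) n)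
      ((((barComplex k C).d (n + 1) n).app (.op c)).hom (barGen k s α))
      (∑ i : Fin (n + 2), (-1 : ℤ) ^ (i : ℕ) • barFace k c n i (barGen k s α)) := by
    refine Eq.trans (b := barD k c n (barGen k s α))
      (DFunLike.congr_fun (barComplex_d_app (.op c) n) (barGen k s α)) ?_
    rw [barD, LinearMap.sum_apply]
    rfl
  refine (congrArg (fun z => barPairing F n c z y) hd).trans ?_
  have key (i : Fin (n + 2)) : barPairing F n c (barFace k c n i (barGen k s α)) y =
      simplicialMap F (m := .mk n) (n := .mk (n + 1)) (SimplexCategory.δ i)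
        (chain F s (F.map α y)) := by
    refine (congrArg (fun z => barPairing F n c z y)
      (simplicialMap_barGen (SimplexCategory.δ i) s α)).trans ?_
    refine (barPairing_barGen F _ _ y).trans ?_
    refine Eq.trans ?_ (simplicialMap_lof F (m := .mk n) (n := .mk (n + 1)) (SimplexCategory.δ i) s _).symm
    exact congrArg (chain F _) (ConcreteCategory.congr_hom (F.map_comp _ _) y)
  rw [map_sum, LinearMap.sum_apply]
  refine Finset.sum_congr rfl fun i _ => ?_
  rw [map_zsmul, LinearMap.smul_apply]
  exact congrArg (_ • ·) (key i)

/-- `P ⊗_C F ≅ C_*(C, F)` for the bar resolution `P`. -/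
noncomputable def barTensorIso (F : C ⥤ ModuleCat.{u} k) :
    ((tensorFunctor F).mapHomologicalComplex _).obj (barComplex k C) ≅ complex F :=
  HomologicalComplex.Hom.isoOfComponents (fun n => (barTensorEquiv F n).toModuleIso) (by
    rintro _ n rfl
    exact ModuleCat.hom_ext (LinearMap.ext fun x => (barTensorHom_d F n x).symm))

theorem barTensorIso_naturality {F F' : C ⥤ ModuleCat.{u} k} (Ψ : F ⟶ F') :
    (NatTrans.mapHomologicalComplex (tensorFunctorMap Ψ) _).app (barComplex k C) ≫
      (barTensorIso F').hom = (barTensorIso F).hom ≫ complexMap Ψ := by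
  ext n : 1
  refine ModuleCat.hom_ext (barTensor_hom_ext fun c s α y => ?_)
  refine (congrArg (barTensorHom F' n) (tensorMap_mk _ Ψ c _ y)).trans ?_
  refine (barTensorHom_mk F' s α _).trans ?_
  refine Eq.trans ?_ (congrArg ((complexMap Ψ).f n) (barTensorHom_mk F s α y)).symm
  refine Eq.trans ?_ (simplicialModuleMap_chain Ψ (.op (.mk n)) s _).symm
  exact congrArg (chain F' s) (ConcreteCategory.congr_hom (Ψ.naturality α) y).symm

/-- `Tor_n^C(k, F)` is the homology of `C_*(C, F)`. -/
noncomputable def functorTorIso (n : ℕ) (F : C ⥤ ModuleCat.{u} k) :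
    functorTor n (constModule k C) F ≅ (complex F).homology n :=
  (barResolution k C).isoLeftDerivedObj (tensorFunctor F) n ≪≫
    (HomologicalComplex.homologyFunctor _ _ n).mapIso (barTensorIso F)

theorem comp_trans_hom_eq {A : Type*} [Category A] {X Y Z X' Y' Z' : A} (e : X ≅ Y) (g : Y ≅ Z)
    (e' : X' ≅ Y') (g' : Y' ≅ Z') {m : X ⟶ X'} {f : Y ⟶ Y'} {h : Z ⟶ Z'}
    (hm : m = e.hom ≫ f ≫ e'.inv) (hf : f ≫ g'.hom = g.hom ≫ h) :
    m ≫ (e' ≪≫ g').hom = (e ≪≫ g).hom ≫ h := by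
  simp [hm, hf]

theorem functorTorIso_naturality (n : ℕ) {F F' : C ⥤ ModuleCat.{u} k} (Ψ : F ⟶ F') :
    functorTorMap n (constModule k C) Ψ ≫ (functorTorIso n F').hom =
      (functorTorIso n F).hom ≫ HomologicalComplex.homologyMap (complexMap Ψ) n := by
  refine comp_trans_hom_eq _ _ _ _
    ((barResolution k C).leftDerived_app_eq (tensorFunctorMap Ψ) n) ?_
  refine (Functor.map_comp _ _ _).symm.trans ?_
  refine (congrArg (HomologicalComplex.homologyFunctor _ _ n).map
    (barTensorIso_naturality Ψ)).trans ?_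
  exact Functor.map_comp _ _ _

end FunctorHomology

/-! ### Homology classes of cycles -/

section HomologyClasses
variable {k : Type u} [CommRing k]

namespace CategoryTheory.ShortComplex

/-- The homology class of a cycle. -/
noncomputable def cls (S : ShortComplex (ModuleCat.{u} k)) :
    LinearMap.ker S.g.hom →ₗ[k] S.homology :=
  (S.moduleCatCyclesIso.inv ≫ S.homologyπ).hom

theorem cls_surjective (S : ShortComplex (ModuleCat.{u} k)) : Function.Surjective S.cls :=
  (ModuleCat.epi_iff_surjective (S.moduleCatCyclesIso.inv ≫ S.homologyπ)).1 inferInstance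

theorem cls_eq (S : ShortComplex (ModuleCat.{u} k)) (z : LinearMap.ker S.g.hom) :
    S.cls z = S.moduleCatHomologyIso.inv (Submodule.Quotient.mk z) :=
  ConcreteCategory.congr_hom S.moduleCatCyclesIso_inv_π z

theorem cls_eq_zero_iff (S : ShortComplex (ModuleCat.{u} k)) (z : LinearMap.ker S.g.hom) :
    S.cls z = 0 ↔ ∃ y, S.f y = z.1 := by
  rw [cls_eq]
  have hi : Function.Injective S.moduleCatHomologyIso.inv :=
    (ModuleCat.mono_iff_injective _).1 inferInstance
  refine (map_eq_zero_iff S.moduleCatHomologyIso.inv.hom hi).trans ?_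
  refine (Submodule.Quotient.mk_eq_zero _).trans ?_
  refine exists_congr fun y => ?_
  exact Subtype.ext_iff

theorem homologyMap_cls {S S' : ShortComplex (ModuleCat.{u} k)} (φ : S ⟶ S')
    (z : LinearMap.ker S.g.hom) (h : φ.τ₂ z.1 ∈ LinearMap.ker S'.g.hom) :
    homologyMap φ (S.cls z) = S'.cls ⟨φ.τ₂ z.1, h⟩ := by
  refine (ConcreteCategory.congr_hom (homologyπ_naturality φ) _).trans ?_
  refine congrArg S'.homologyπ ?_
  have hi : Function.Injective S'.iCycles := (ModuleCat.mono_iff_injective _).1 inferInstance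
  refine hi ?_
  refine (ConcreteCategory.congr_hom (cyclesMap_i φ) _).trans ?_
  refine Eq.trans ?_ (ConcreteCategory.congr_hom S'.moduleCatCyclesIso_inv_iCycles _).symm
  exact congrArg φ.τ₂ (ConcreteCategory.congr_hom S.moduleCatCyclesIso_inv_iCycles z)

theorem mem_ker_of_hom {S S' : ShortComplex (ModuleCat.{u} k)} (φ : S ⟶ S')
    (z : LinearMap.ker S.g.hom) : φ.τ₂ z.1 ∈ LinearMap.ker S'.g.hom := by
  refine LinearMap.mem_ker.2 ((ConcreteCategory.congr_hom φ.comm₂₃ z.1).trans ?_)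
  exact (congrArg φ.τ₃ (LinearMap.mem_ker.1 z.2)).trans (map_zero _)

end CategoryTheory.ShortComplex
end HomologyClasses

/-! ### Homology with coefficients and the map $H_n(L)\otimes M\to H_n(L\otimes M)$ -/

namespace CoefficientHomology
open MonoidalCategory TensorProduct
variable {k : Type u} [CommRing k]

/-- The complex `L ⊗ M`. -/
noncomputable abbrev tensObj (L : ChainComplex (ModuleCat.{u} k) ℕ) (M : ModuleCat.{u} k) :
    ChainComplex (ModuleCat.{u} k) ℕ :=
  ((tensorRight M).mapHomologicalComplex _).obj L

/-- The map `L ⊗ M ⟶ L' ⊗ M'`. -/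
noncomputable def tensMap {L L' : ChainComplex (ModuleCat.{u} k) ℕ} {M M' : ModuleCat.{u} k}
    (f : L ⟶ L') (g : M ⟶ M') : tensObj L M ⟶ tensObj L' M' :=
  ((tensorRight M).mapHomologicalComplex _).map f ≫
    (NatTrans.mapHomologicalComplex ((tensoringRight _).map g) _).app L'

theorem tensMap_f {L L' : ChainComplex (ModuleCat.{u} k) ℕ} {M M' : ModuleCat.{u} k}
    (f : L ⟶ L') (g : M ⟶ M') (n : ℕ) : (tensMap f g).f n = f.f n ⊗ₘ g :=
  (MonoidalCategory.tensorHom_def _ _).symm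

theorem tensMap_comp {L L' L'' : ChainComplex (ModuleCat.{u} k) ℕ} {M M' M'' : ModuleCat.{u} k}
    (f : L ⟶ L') (f' : L' ⟶ L'') (g : M ⟶ M') (g' : M' ⟶ M'') :
    tensMap (f ≫ f') (g ≫ g') = tensMap f g ≫ tensMap f' g' := by
  ext n : 1
  rw [HomologicalComplex.comp_f, tensMap_f, tensMap_f, tensMap_f]
  exact (tensorHom_comp_tensorHom _ _ _ _).symm

/-- The map `L ⟶ L ⊗ M`, `x ↦ x ⊗ m`. -/
noncomputable def tmulRight (L : ChainComplex (ModuleCat.{u} k) ℕ) {M : ModuleCat.{u} k} (m : M) :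
    L ⟶ tensObj L M where
  f n := ModuleCat.ofHom ((TensorProduct.mk k (L.X n) M).flip m)
  comm' i j _ := by
    ext x
    rfl

theorem tmulRight_tensMap {L L' : ChainComplex (ModuleCat.{u} k) ℕ} {M M' : ModuleCat.{u} k}
    (f : L ⟶ L') (g : M ⟶ M') (m : M) :
    tmulRight L m ≫ tensMap f g = f ≫ tmulRight L' (g m) := by
  ext n x
  rfl

/-- The functor `M ↦ H_n(L ⊗ M)` on maps in both variables. -/
noncomputable abbrev homMap {L L' : ChainComplex (ModuleCat.{u} k) ℕ} {M M' : ModuleCat.{u} k}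
    (f : L ⟶ L') (g : M ⟶ M') (n : ℕ) : (tensObj L M).homology n ⟶ (tensObj L' M').homology n :=
  HomologicalComplex.homologyMap (tensMap f g) n

/-- The canonical map `H_n(L) ⊗ M ⟶ H_n(L ⊗ M)`. -/
noncomputable def univ (L : ChainComplex (ModuleCat.{u} k) ℕ) (M : ModuleCat.{u} k) (n : ℕ) :
    L.homology n ⊗ M ⟶ (tensObj L M).homology n :=
  ModuleCat.ofHom (TensorProduct.lift (LinearMap.mk₂ k
    (fun h m => (HomologicalComplex.homologyMap (tmulRight L m) n).hom h)
    (fun h h' m => map_add _ _ _)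
    (fun c h m => map_smul _ _ _)
    (fun h m m' => by
      have : tmulRight L (m + m') = tmulRight L m + tmulRight L m' := by
        ext n x
        exact tmul_add _ _ _
      rw [this, HomologicalComplex.homologyMap_add]
      rfl)
    (fun c h m => by
      have : tmulRight L (c • m) = c • tmulRight L m := by
        ext n x
        exact tmul_smul _ _ _
      rw [this]
      exact congrArg (fun f => f.hom h)
        (ShortComplex.homologyMap_smul
          ((HomologicalComplex.shortComplexFunctor _ _ n).map (tmulRight L m)) c))))

theorem univ_naturality {L L' : ChainComplex (ModuleCat.{u} k) ℕ} {M M' : ModuleCat.{u} k}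
    (f : L ⟶ L') (g : M ⟶ M') (n : ℕ) :
    univ L M n ≫ homMap f g n =
      (HomologicalComplex.homologyMap f n ⊗ₘ g) ≫ univ L' M' n := by
  refine ModuleCat.hom_ext (TensorProduct.ext' fun h m => ?_)
  have := congrArg (fun f => HomologicalComplex.homologyMap f n) (tmulRight_tensMap f g m)
  rw [HomologicalComplex.homologyMap_comp, HomologicalComplex.homologyMap_comp] at this
  exact ConcreteCategory.congr_hom this h

/-- `H_n(L) ⊗ M ⟶ H_n(L ⊗ M)` on classes of cycles. -/
theorem univ_cls (L : ChainComplex (ModuleCat.{u} k) ℕ) (M : ModuleCat.{u} k) (n : ℕ)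
    (t : LinearMap.ker (L.sc n).g.hom ⊗[k] M)
    (ht : ((LinearMap.ker (L.sc n).g.hom).subtype.rTensor M) t ∈
      LinearMap.ker ((tensObj L M).sc n).g.hom) :
    univ L M n ((L.sc n).cls.rTensor M t) = ((tensObj L M).sc n).cls ⟨_, ht⟩ := by
  have hmem : ∀ t, ((LinearMap.ker (L.sc n).g.hom).subtype.rTensor M) t ∈
      LinearMap.ker ((tensObj L M).sc n).g.hom := by
    intro t
    induction t using TensorProduct.induction_on with
    | zero => rw [map_zero]; exact zero_mem _
    | tmul z m =>
      exact ShortComplex.mem_ker_of_hom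
        ((HomologicalComplex.shortComplexFunctor _ _ n).map (tmulRight L m)) z
    | add x y hx hy => rw [map_add]; exact add_mem hx hy
  suffices (univ L M n).hom ∘ₗ ((L.sc n).cls.rTensor M) = ((tensObj L M).sc n).cls ∘ₗ
    LinearMap.codRestrict _ ((LinearMap.ker (L.sc n).g.hom).subtype.rTensor M) hmem from
    DFunLike.congr_fun this t
  refine TensorProduct.ext' fun z m => ?_
  exact ShortComplex.homologyMap_cls
    ((HomologicalComplex.shortComplexFunctor _ _ n).map (tmulRight L m)) z _

/-- A flat $M$ preserves the kernel of the differential, so the cycles of $L\otimes M$ are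
$Z_n\otimes M$; the boundaries are the image of $L_{n+1}\otimes M$ in any case. -/
theorem isIso_univ_of_flat (L : ChainComplex (ModuleCat.{u} k) ℕ) (M : ModuleCat.{u} k)
    [Module.Flat k M] (n : ℕ) : IsIso (univ L M n) := by
  have hex : Function.Exact ((LinearMap.ker (L.sc n).g.hom).subtype.rTensor M)
      ((L.sc n).g.hom.rTensor M) :=
    Module.Flat.rTensor_exact M (LinearMap.exact_subtype_ker_map _)
  have hsurj : Function.Surjective ((L.sc n).cls.rTensor M) :=
    LinearMap.rTensor_surjective _ (ShortComplex.cls_surjective _)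
  have hmem (t) : ((LinearMap.ker (L.sc n).g.hom).subtype.rTensor M) t ∈
      LinearMap.ker ((tensObj L M).sc n).g.hom := (hex _).2 ⟨t, rfl⟩
  rw [ConcreteCategory.isIso_iff_bijective]
  constructor
  · refine (injective_iff_map_eq_zero (univ L M n).hom).2 fun t ht => ?_
    obtain ⟨z, rfl⟩ := hsurj t
    obtain ⟨y, hy⟩ := (ShortComplex.cls_eq_zero_iff _ _).1 ((univ_cls L M n z (hmem z)).symm.trans ht)
    -- The equation is known in $L_n\otimes M$; by flatness $Z_n\otimes M$ embeds there, so it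
    -- already holds among cycles.
    have hz : z = (L.sc n).moduleCatToCycles.rTensor M y := by
      refine Module.Flat.rTensor_preserves_injective_linearMap (M := M) _
        (Submodule.subtype_injective _) (hy.symm.trans ?_)
      exact DFunLike.congr_fun (LinearMap.rTensor_comp M
        (LinearMap.ker (L.sc n).g.hom).subtype (L.sc n).moduleCatToCycles) y
    have h0 : (L.sc n).cls ∘ₗ (L.sc n).moduleCatToCycles = 0 :=
      LinearMap.ext fun y => (ShortComplex.cls_eq_zero_iff _ _).2 ⟨y, rfl⟩
    refine (congrArg ((L.sc n).cls.rTensor M) hz).trans ?_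
    refine (DFunLike.congr_fun (LinearMap.rTensor_comp M
        (L.sc n).cls (L.sc n).moduleCatToCycles) y).symm.trans ?_
    rw [h0, LinearMap.rTensor_zero]
    rfl
  · intro h
    obtain ⟨z, rfl⟩ := ShortComplex.cls_surjective _ h
    obtain ⟨t, ht⟩ := (hex z.1).1 z.2
    refine ⟨(L.sc n).cls.rTensor M t, (univ_cls L M n t (hmem t)).trans ?_⟩
    exact congrArg _ (Subtype.ext ht)

/-- The short exact sequence of complexes `0 ⟶ L ⊗ M₁ ⟶ L ⊗ M₂ ⟶ L ⊗ M₃ ⟶ 0`. -/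
noncomputable def tensSC (L : ChainComplex (ModuleCat.{u} k) ℕ)
    (S : ShortComplex (ModuleCat.{u} k)) : ShortComplex (ChainComplex (ModuleCat.{u} k) ℕ) :=
  ShortComplex.mk (tensMap (𝟙 L) S.f) (tensMap (𝟙 L) S.g) (by
    rw [← tensMap_comp, S.zero]
    ext n : 1
    rw [tensMap_f]
    exact MonoidalPreadditive.tensor_zero _)

/-- This is where the flatness of the complex enters: each $L_n\otimes-$ is exact, and exactness of
a sequence of complexes is tested degreewise. -/
theorem tensSC_shortExact (L : ChainComplex (ModuleCat.{u} k) ℕ) (hL : ∀ n, Module.Flat k (L.X n))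
    {S : ShortComplex (ModuleCat.{u} k)} (hS : S.ShortExact) : (tensSC L S).ShortExact := by
  refine HomologicalComplex.shortExact_of_degreewise_shortExact _ fun n => ?_
  have h := hS.map_of_exact (tensorLeft (L.X n))
  exact ShortComplex.shortExact_of_iso
    (S₁ := ShortComplex.mk (L.X n ◁ S.f) (L.X n ◁ S.g) (S.map (tensorLeft (L.X n))).zero)
    (S₂ := (tensSC L S).map (HomologicalComplex.eval _ _ n))
    (ShortComplex.isoMk (Iso.refl ((tensorLeft (L.X n)).obj S.X₁)) (Iso.refl ((tensorLeft (L.X n)).obj S.X₂))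
      (Iso.refl ((tensorLeft (L.X n)).obj S.X₃))
      ((Category.id_comp _).trans (((tensMap_f _ _ _).trans (id_tensorHom _ _)).trans
        (Category.comp_id _).symm))
      ((Category.id_comp _).trans (((tensMap_f _ _ _).trans (id_tensorHom _ _)).trans
        (Category.comp_id _).symm))) h

/-- The map of short exact sequences induced by maps of complexes and of sequences. -/
noncomputable def tensSCMap {L L' : ChainComplex (ModuleCat.{u} k) ℕ} (f : L ⟶ L')
    {S S' : ShortComplex (ModuleCat.{u} k)} (φ : S ⟶ S') : tensSC L S ⟶ tensSC L' S' where
  τ₁ := tensMap f φ.τ₁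
  τ₂ := tensMap f φ.τ₂
  τ₃ := tensMap f φ.τ₃
  comm₁₂ := by
    refine (tensMap_comp _ _ _ _).symm.trans (Eq.trans ?_ (tensMap_comp _ _ _ _))
    rw [Category.comp_id, Category.id_comp, φ.comm₁₂]
  comm₂₃ := by
    refine (tensMap_comp _ _ _ _).symm.trans (Eq.trans ?_ (tensMap_comp _ _ _ _))
    rw [Category.comp_id, Category.id_comp, φ.comm₂₃]

end CoefficientHomology

/-! ### Homology as a subquotient -/

section Subquotients
variable {k : Type u} [CommRing k]

/-- The map induced on the target of a surjection. -/
noncomputable def LinearMap.descend {V X Y : Type*} [AddCommGroup V] [Module k V] [AddCommGroup X]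
    [Module k X] [AddCommGroup Y] [Module k Y] (α : V →ₗ[k] X) (hα : Function.Surjective α)
    (β : V →ₗ[k] Y) (h : ∀ v, α v = 0 → β v = 0) : X →ₗ[k] Y :=
  (LinearMap.ker α).liftQ β h ∘ₗ (α.quotKerEquivOfSurjective hα).symm.toLinearMap

theorem LinearMap.descend_apply {V X Y : Type*} [AddCommGroup V] [Module k V] [AddCommGroup X]
    [Module k X] [AddCommGroup Y] [Module k Y] (α : V →ₗ[k] X) (hα : Function.Surjective α)
    (β : V →ₗ[k] Y) (h : ∀ v, α v = 0 → β v = 0) (v : V) : α.descend hα β h (α v) = β v := by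
  have : (α.quotKerEquivOfSurjective hα).symm (α v) = Submodule.Quotient.mk v := by
    rw [LinearEquiv.symm_apply_eq]
    rfl
  rw [LinearMap.descend, LinearMap.comp_apply, LinearEquiv.coe_coe, this]
  rfl

/-- Two surjections with the same kernel have isomorphic targets. -/
noncomputable def LinearEquiv.ofSurjections {V X Y : Type*} [AddCommGroup V] [Module k V]
    [AddCommGroup X] [Module k X] [AddCommGroup Y] [Module k Y] (α : V →ₗ[k] X)
    (hα : Function.Surjective α) (β : V →ₗ[k] Y) (hβ : Function.Surjective β)
    (h : ∀ v, α v = 0 ↔ β v = 0) : X ≃ₗ[k] Y :=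
  LinearEquiv.ofBijective (α.descend hα β fun v => (h v).1) ⟨by
    refine (injective_iff_map_eq_zero _).2 fun x hx => ?_
    obtain ⟨v, rfl⟩ := hα x
    rw [LinearMap.descend_apply] at hx
    exact (h v).2 hx, fun y => by
    obtain ⟨v, rfl⟩ := hβ y
    exact ⟨α v, LinearMap.descend_apply α hα β _ v⟩⟩

/-- Homology as a quotient of any module that maps onto the cycles. -/
noncomputable def CategoryTheory.ShortComplex.homologyIsoQuotient
    (S : ShortComplex (ModuleCat.{u} k)) {V : Type u} [AddCommGroup V] [Module k V]
    (φ : V →ₗ[k] S.X₂) (W : Submodule k V) (h₁ : ∀ x, S.g x = 0 ↔ ∃ v, φ v = x)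
    (h₂ : ∀ v, v ∈ W ↔ ∃ y, S.f y = φ v) : S.homology ≅ ModuleCat.of k (V ⧸ W) :=
  (LinearEquiv.ofSurjections
    (S.cls ∘ₗ φ.codRestrict (LinearMap.ker S.g.hom) fun v => (h₁ _).2 ⟨v, rfl⟩)
    (by
      intro x
      obtain ⟨z, rfl⟩ := S.cls_surjective x
      obtain ⟨v, hv⟩ := (h₁ z.1).1 z.2
      exact ⟨v, congrArg S.cls (Subtype.ext hv)⟩)
    W.mkQ W.mkQ_surjective
    (fun v => by
      rw [LinearMap.comp_apply, S.cls_eq_zero_iff, Submodule.mkQ_apply,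
        Submodule.Quotient.mk_eq_zero, h₂]
      rfl)).toModuleIso

/-- The homology of a complex in terms of all its differentials. -/
noncomputable def HomologicalComplex.homologyIsoQuotient {κ : Type*} {c : ComplexShape κ}
    (K : HomologicalComplex (ModuleCat.{u} k) c) (a : κ) {V : Type u} [AddCommGroup V]
    [Module k V] (φ : V →ₗ[k] K.X a) (W : Submodule k V)
    (h₁ : ∀ x, (∀ b, K.d a b x = 0) ↔ ∃ v, φ v = x)
    (h₂ : ∀ v, v ∈ W ↔ ∃ b y, K.d b a y = φ v) : K.homology a ≅ ModuleCat.of k (V ⧸ W) :=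
  (K.sc a).homologyIsoQuotient φ W
    (fun x => by
      refine Iff.trans ?_ (h₁ x)
      refine ⟨fun h b => ?_, fun h => h _⟩
      by_cases hb : c.Rel a b
      · obtain rfl := c.next_eq' hb
        exact h
      · rw [K.shape _ _ hb]
        rfl)
    (fun v => by
      refine (h₂ v).trans ?_
      constructor
      · rintro ⟨b, y, hy⟩
        by_cases hb : c.Rel b a
        · obtain rfl := c.prev_eq' hb
          exact ⟨y, hy⟩
        · rw [K.shape _ _ hb] at hy
          exact ⟨0, (map_zero _).trans hy⟩
      · rintro ⟨y, hy⟩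
        exact ⟨_, y, hy⟩)

end Subquotients

/-! ### The spectral sequence of a first quadrant exact couple -/

/-- A first quadrant bigraded exact couple `D ⟶ D ⟶ E ⟶ D`. -/
structure BigradedCouple (k : Type u) [CommRing k] where
  D : ℕ → ℕ → ModuleCat.{u} k
  E : ℕ → ℕ → ModuleCat.{u} k
  i (p q : ℕ) : D p (q + 1) ⟶ D (p + 1) q
  j (p q : ℕ) : D (p + 1) q ⟶ E p q
  π (p q : ℕ) : E p q ⟶ D p q
  exact_E (p q : ℕ) : Function.Exact (j p q) (π p q)
  exact_i (p q : ℕ) : Function.Exact (i p q) (j p q)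
  exact_π (p q : ℕ) : Function.Exact (π p (q + 1)) (i p q)
  surjective_π (p : ℕ) : Function.Surjective (π p 0)

namespace BigradedCouple
variable {k : Type u} [CommRing k] (T : BigradedCouple k)

/-- The kernel of the iterate `iˢ`. -/
def kerIter : ∀ _ p q : ℕ, Submodule k (T.D p q)
  | 0, _, _ => ⊥
  | _ + 1, _, 0 => ⊤
  | s + 1, p, q + 1 => (kerIter s (p + 1) q).comap (T.i p q).hom

/-- The image of the iterate `iˢ`, or of the longest iterate from the column `0`. -/
def imIter : ∀ _ p q : ℕ, Submodule k (T.D p q)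
  | 0, _, _ => ⊤
  | _ + 1, 0, _ => ⊤
  | s + 1, p + 1, q => (imIter s p (q + 1)).map (T.i p q).hom

theorem kerIter_le_succ (s p q : ℕ) : T.kerIter s p q ≤ T.kerIter (s + 1) p q := by
  induction s generalizing p q with
  | zero => exact bot_le
  | succ s ih =>
    cases q with
    | zero => exact le_rfl
    | succ q => exact Submodule.comap_mono (ih _ _)

theorem imIter_succ_le (s p q : ℕ) : T.imIter (s + 1) p q ≤ T.imIter s p q := by
  induction s generalizing p q with
  | zero => exact le_top
  | succ s ih =>
    cases p with
    | zero => exact le_rfl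
    | succ p => exact Submodule.map_mono (ih _ _)

theorem kerIter_mono {s t : ℕ} (h : s ≤ t) (p q : ℕ) : T.kerIter s p q ≤ T.kerIter t p q :=
  monotone_nat_of_le_succ (f := fun s => T.kerIter s p q) (fun s => T.kerIter_le_succ s p q) h

/-- The couple is zero below row zero. The definition of `kerIter` encodes this by declaring
everything in row zero to be killed by one more step. -/
theorem kerIter_eq_top {s q : ℕ} (h : q < s) (p : ℕ) : T.kerIter s p q = ⊤ := by
  induction s generalizing p q with
  | zero => omega
  | succ s ih =>
    cases q with
    | zero => rfl
    | succ q =>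
      change (T.kerIter s (p + 1) q).comap (T.i p q).hom = ⊤
      rw [ih (by omega), Submodule.comap_top]

/-- At most `p` steps lead from column zero to column `p`, so longer iterates impose no further
condition. -/
theorem imIter_succ_of_le {s p : ℕ} (h : p ≤ s) (q : ℕ) :
    T.imIter (s + 1) p q = T.imIter s p q := by
  induction s generalizing p q with
  | zero =>
    obtain rfl : p = 0 := by omega
    rfl
  | succ s ih =>
    cases p with
    | zero => rfl
    | succ p => exact congrArg _ (ih (by omega) _)

theorem imIter_eq_of_le {s p : ℕ} (h : p ≤ s) (q : ℕ) : T.imIter s p q = T.imIter p p q := by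
  induction s, h using Nat.le_induction with
  | base => rfl
  | succ s hs ih => rw [imIter_succ_of_le T hs, ih]

/-- In row zero there is no further connecting map to take the kernel of; surjectivity of `π` takes
the place of exactness there. -/
theorem kerIter_one (p q : ℕ) : T.kerIter 1 p q = LinearMap.range (T.π p q).hom := by
  cases q with
  | zero => exact (LinearMap.range_eq_top.2 (T.surjective_π p)).symm
  | succ q => exact (LinearMap.exact_iff.1 (T.exact_π p q))

theorem imIter_one (p q : ℕ) : T.imIter 1 (p + 1) q = LinearMap.ker (T.j p q).hom :=
  (Submodule.map_top _).trans (LinearMap.exact_iff.1 (T.exact_i p q)).symm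

/-- The iterate `iˢ`. -/
noncomputable def iter : ∀ (s p q : ℕ) {p' n : ℕ} (_ : p + s = p') (_ : q + s = n),
    T.D p n ⟶ T.D p' q
  | 0, p, q, _, _, hp, hn => eqToHom (by rw [← hp, ← hn]; rfl)
  | s + 1, p, q, _, _, hp, hn =>
    eqToHom (by rw [← hn]; rfl) ≫ T.i p (q + s) ≫ iter s (p + 1) q (by omega) rfl

theorem iter_succ (s p q : ℕ) {p' : ℕ} (hp : p + (s + 1) = p') :
    T.iter (s + 1) p q hp rfl = T.i p (q + s) ≫ T.iter s (p + 1) q (by omega) rfl := by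
  rw [iter, eqToHom_refl, Category.id_comp]

theorem comap_iter (t s p q : ℕ) {p' n : ℕ} (hp : p + s = p') (hn : q + s = n) :
    (T.kerIter t p' q).comap (T.iter s p q hp hn).hom = T.kerIter (t + s) p n := by
  subst hn
  induction s generalizing p p' with
  | zero =>
    subst hp
    rfl
  | succ s ih =>
    rw [iter_succ, ModuleCat.hom_comp, Submodule.comap_comp, ih]
    rfl

theorem map_iter (t s p q : ℕ) {p' n : ℕ} (hp : p + s = p') (hn : q + s = n) :
    (T.imIter t p n).map (T.iter s p q hp hn).hom = T.imIter (t + s) p' q := by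
  subst hn
  induction s generalizing p p' t with
  | zero =>
    subst hp
    exact Submodule.map_id _
  | succ s ih =>
    rw [iter_succ, ModuleCat.hom_comp, Submodule.map_comp]
    refine (ih (t + 1) (p + 1) (by omega)).trans ?_
    rw [show t + 1 + s = t + (s + 1) by omega]

theorem iter_mem_kerIter (t s p q : ℕ) {p' n : ℕ} (hp : p + s = p') (hn : q + s = n)
    (y : T.D p n) : T.iter s p q hp hn y ∈ T.kerIter t p' q ↔ y ∈ T.kerIter (t + s) p n := by
  rw [← comap_iter T t s p q hp hn]
  rfl

theorem iter_eq_zero_iff (s p q : ℕ) {p' n : ℕ} (hp : p + s = p') (hn : q + s = n)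
    (y : T.D p n) : T.iter s p q hp hn y = 0 ↔ y ∈ T.kerIter s p n := by
  have := T.iter_mem_kerIter 0 s p q hp hn y
  rwa [Nat.zero_add] at this

theorem mem_imIter_iff (s p q : ℕ) {p' n : ℕ} (hp : p + s = p') (hn : q + s = n)
    (x : T.D p' q) : x ∈ T.imIter s p' q ↔ ∃ y, T.iter s p q hp hn y = x := by
  have := T.map_iter 0 s p q hp hn
  rw [Nat.zero_add] at this
  rw [← this]
  exact ⟨fun ⟨y, _, hy⟩ => ⟨y, hy⟩, fun ⟨y, hy⟩ => ⟨y, trivial, hy⟩⟩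

/-- The cycles that survive to the page `s + 1`. -/
def cyclesAt (s p q : ℕ) : Submodule k (T.E p q) := (T.imIter s p q).comap (T.π p q).hom

/-- The elements that are killed before the page `s + 1`. -/
def boundariesAt (s p q : ℕ) : Submodule k (T.E p q) := (T.kerIter s (p + 1) q).map (T.j p q).hom

theorem π_j (p q : ℕ) (y : T.D (p + 1) q) : T.π p q (T.j p q y) = 0 :=
  (T.exact_E p q).apply_apply_eq_zero y

theorem boundariesAt_le (s t p q : ℕ) : T.boundariesAt s p q ≤ T.cyclesAt t p q := by
  rintro _ ⟨y, _, rfl⟩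
  refine Submodule.mem_comap.2 ?_
  rw [show (T.π p q).hom ((T.j p q).hom y) = 0 from T.π_j p q y]
  exact zero_mem _

theorem cyclesAt_succ_le (s p q : ℕ) : T.cyclesAt (s + 1) p q ≤ T.cyclesAt s p q :=
  Submodule.comap_mono (T.imIter_succ_le s p q)

/-- The term at `(p, q)` of the page `s + 1`. -/
abbrev term (s p q : ℕ) : Type u :=
  T.cyclesAt s p q ⧸ (T.boundariesAt s p q).submoduleOf (T.cyclesAt s p q)

/-- The class of a cycle in a term. -/
abbrev termMk (s p q : ℕ) (x : T.E p q) (hx : x ∈ T.cyclesAt s p q) : T.term s p q :=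
  Submodule.Quotient.mk ⟨x, hx⟩

theorem termMk_eq_zero {s p q : ℕ} {x : T.E p q} (hx : x ∈ T.cyclesAt s p q) :
    T.termMk s p q x hx = 0 ↔ x ∈ T.boundariesAt s p q := by
  exact Submodule.Quotient.mk_eq_zero _

theorem j_mem (s p q : ℕ) (y : T.D (p + 1) q) : T.j p q y ∈ T.cyclesAt s p q :=
  Submodule.mem_comap.2 ((T.π_j p q y).symm ▸ zero_mem _)

/-- The pairs `(y, x)` with `iˢ y = π x`. -/
noncomputable def corr (s p q : ℕ) : Submodule k (T.D (p + 1) (q + s) × T.E (p + 1 + s) q) :=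
  LinearMap.eqLocus ((T.iter s (p + 1) q rfl rfl).hom ∘ₗ LinearMap.fst k _ _)
    ((T.π (p + 1 + s) q).hom ∘ₗ LinearMap.snd k _ _)

/-- The differential of the page `s + 1`. -/
noncomputable def differential (s p q : ℕ) : T.term s (p + 1 + s) q →ₗ[k] T.term s p (q + s) :=
  LinearMap.descend
    (Submodule.mkQ _ ∘ₗ LinearMap.codRestrict (T.cyclesAt s (p + 1 + s) q)
      (LinearMap.snd k _ _ ∘ₗ (T.corr s p q).subtype)
      fun v => (T.mem_imIter_iff s (p + 1) q rfl rfl _).2 ⟨v.1.1, v.2⟩)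
    (by
      intro x
      obtain ⟨⟨x, hx⟩, rfl⟩ := Submodule.Quotient.mk_surjective _ x
      obtain ⟨y, hy⟩ := (T.mem_imIter_iff s (p + 1) q rfl rfl _).1 hx
      exact ⟨⟨(y, x), hy⟩, rfl⟩)
    (Submodule.mkQ _ ∘ₗ LinearMap.codRestrict (T.cyclesAt s p (q + s))
      ((T.j p (q + s)).hom ∘ₗ LinearMap.fst k _ _ ∘ₗ (T.corr s p q).subtype)
      fun v => T.j_mem s p (q + s) v.1.1)
    (by
      -- If $x=jz$ is a boundary, then $i^sy=\pi x=\pi jz=0$, so $jy\in j(\ker i^s)$. The case $x=0$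
      -- covers the choice of $y$.
      rintro ⟨⟨y, x⟩, hv⟩ h
      obtain ⟨z, _, hz⟩ := (T.termMk_eq_zero _).1 h
      refine (T.termMk_eq_zero _).2 ⟨y, (T.iter_eq_zero_iff s (p + 1) q rfl rfl y).1 ?_, rfl⟩
      refine Eq.trans hv ((congrArg (T.π _ _) hz.symm).trans (T.π_j _ _ z)))

theorem differential_mk (s p q : ℕ) (y : T.D (p + 1) (q + s)) (x : T.E (p + 1 + s) q)
    (h : T.iter s (p + 1) q rfl rfl y = T.π _ _ x) (hx : x ∈ T.cyclesAt s (p + 1 + s) q) :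
    T.differential s p q (T.termMk s _ q x hx) = T.termMk s p _ (T.j p _ y) (T.j_mem s p _ y) :=
  LinearMap.descend_apply _ _ _ _ (⟨(y, x), h⟩ : T.corr s p q)

/-- The value $jy$ lies in $j(\ker i^s)$ exactly when $y$ can be changed by an element of $\ker i^s$
to lie in $\ker j=\operatorname{im} i$; then $\pi x=i^sy$ lies in the image of $i^{s+1}$. -/
theorem differential_eq_zero_iff (s p q : ℕ) (x : T.E (p + 1 + s) q)
    (hx : x ∈ T.cyclesAt s (p + 1 + s) q) :
    T.differential s p q (T.termMk s _ q x hx) = 0 ↔ x ∈ T.cyclesAt (s + 1) (p + 1 + s) q := by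
  obtain ⟨y, hy⟩ := (T.mem_imIter_iff s (p + 1) q rfl rfl _).1 hx
  rw [T.differential_mk s p q y x hy hx, termMk_eq_zero, cyclesAt, Submodule.mem_comap,
    Nat.add_comm s 1, ← T.map_iter 1 s (p + 1) q rfl rfl, imIter_one]
  constructor
  · rintro ⟨z, hz, h⟩
    refine ⟨y - z, LinearMap.mem_ker.2 ((map_sub _ _ _).trans (sub_eq_zero.2 h.symm)), ?_⟩
    refine (map_sub _ _ _).trans ?_
    rw [(T.iter_eq_zero_iff s (p + 1) q rfl rfl z).2 hz, sub_zero]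
    exact hy
  · rintro ⟨z, hz, h⟩
    refine ⟨y - z, (T.iter_eq_zero_iff s (p + 1) q rfl rfl _).1 ((map_sub _ _ _).trans ?_), ?_⟩
    · exact sub_eq_zero.2 (hy.trans h.symm)
    · exact (map_sub _ _ _).trans ((congrArg _ (LinearMap.mem_ker.1 hz)).trans (sub_zero _))

/-- An element $i^sy$ is of the form $\pi x$ exactly when it lies in $\ker i$, that is, $y\in\ker
i^{s+1}$. So the values $jy$ of the differential fill out $j(\ker i^{s+1})$. -/
theorem exists_differential_eq_iff (s p q : ℕ) (v : T.E p (q + s))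
    (hv : v ∈ T.cyclesAt s p (q + s)) :
    (∃ x, T.differential s p q x = T.termMk s _ _ v hv) ↔ v ∈ T.boundariesAt (s + 1) p (q + s) := by
  have hB : v ∈ T.boundariesAt (s + 1) p (q + s) ↔
      ∃ y ∈ T.kerIter (1 + s) (p + 1) (q + s), T.j p (q + s) y = v := by
    rw [boundariesAt, Nat.add_comm s 1]
    rfl
  rw [hB]
  constructor
  · rintro ⟨x, h⟩
    obtain ⟨⟨x, hx⟩, rfl⟩ := Submodule.Quotient.mk_surjective _ x
    obtain ⟨y, hy⟩ := (T.mem_imIter_iff s (p + 1) q rfl rfl _).1 hx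
    have h' := (T.differential_mk s p q y x hy hx).symm.trans h
    obtain ⟨z, hz, hz'⟩ := (Submodule.Quotient.eq _).1 h'
    refine ⟨y - z, sub_mem ?_ (T.kerIter_mono (by omega) _ _ hz), ?_⟩
    · rw [← T.iter_mem_kerIter 1 s (p + 1) q rfl rfl, kerIter_one]
      exact ⟨x, hy.symm⟩
    · refine (map_sub _ _ _).trans ((congrArg _ hz').trans ?_)
      exact sub_sub_cancel _ _
  · rintro ⟨y, hy, rfl⟩
    have hy' := (T.iter_mem_kerIter 1 s (p + 1) q rfl rfl y).2 hy
    rw [kerIter_one] at hy'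
    obtain ⟨x, hx⟩ := hy'
    exact ⟨_, T.differential_mk s p q y x hx.symm
      ((T.mem_imIter_iff s (p + 1) q rfl rfl _).2 ⟨y, hx.symm⟩)⟩

/-- The differential of the page `s + 1` between any two positions. -/
noncomputable def pageD (s : ℕ) (a b : ℕ × ℕ) :
    ModuleCat.of k (T.term s a.1 a.2) ⟶ ModuleCat.of k (T.term s b.1 b.2) :=
  if h : b.1 + 1 + s = a.1 ∧ a.2 + s = b.2 then
    eqToHom (by rw [h.1]) ≫ ModuleCat.ofHom (T.differential s b.1 a.2) ≫ eqToHom (by rw [h.2])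
  else 0

theorem pageD_eq (s p q : ℕ) :
    T.pageD s (p + 1 + s, q) (p, q + s) = ModuleCat.ofHom (T.differential s p q) := by
  rw [pageD, dif_pos ⟨rfl, rfl⟩]
  rfl

theorem pageD_eq_zero_of_not {s : ℕ} {a b : ℕ × ℕ} (h : ¬ (b.1 + 1 + s = a.1 ∧ a.2 + s = b.2)) :
    T.pageD s a b = 0 := dif_neg h

theorem mem_cyclesAt_succ_iff (s p q : ℕ) (x : T.E p q) (hx : x ∈ T.cyclesAt s p q) :
    (∀ b, T.pageD s (p, q) b (T.termMk s p q x hx) = 0) ↔ x ∈ T.cyclesAt (s + 1) p q := by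
  by_cases h : ∃ p', p = p' + 1 + s
  · obtain ⟨p', rfl⟩ := h
    rw [← T.differential_eq_zero_iff s p' q x hx]
    constructor
    · intro h
      have := h (p', q + s)
      rw [pageD_eq] at this
      exact this
    · intro h b
      by_cases hb : b.1 + 1 + s = p' + 1 + s ∧ q + s = b.2
      · obtain ⟨b1, b2⟩ := b
        obtain ⟨hb1, rfl⟩ := hb
        obtain rfl : b1 = p' := by
          change b1 + 1 + s = _ at hb1
          omega
        rw [pageD_eq]
        exact h
      · rw [T.pageD_eq_zero_of_not hb]
        rfl
  -- A target would lie left of column zero: all outgoing differentials vanish, and the image of the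
  -- iterates has stabilised.
  · have hp : p ≤ s := by
      by_contra hp
      exact h ⟨p - 1 - s, by omega⟩
    have hZ : T.cyclesAt (s + 1) p q = T.cyclesAt s p q := by
      rw [cyclesAt, imIter_succ_of_le T hp, cyclesAt]
    rw [hZ]
    refine ⟨fun _ => hx, fun _ b => ?_⟩
    rw [T.pageD_eq_zero_of_not fun hb => h ⟨b.1, hb.1.symm⟩]
    rfl

theorem exists_pageD_eq_iff (s p q : ℕ) (v : T.E p q) (hv : v ∈ T.cyclesAt s p q) :
    (∃ b y, T.pageD s b (p, q) y = T.termMk s p q v hv) ↔ v ∈ T.boundariesAt (s + 1) p q := by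
  by_cases h : ∃ q', q = q' + s
  · obtain ⟨q', rfl⟩ := h
    rw [← T.exists_differential_eq_iff s p q' v hv]
    constructor
    · rintro ⟨b, y, h⟩
      by_cases hb : p + 1 + s = b.1 ∧ b.2 + s = q' + s
      · obtain ⟨b1, b2⟩ := b
        obtain ⟨rfl, hb1⟩ := hb
        obtain rfl : b2 = q' := by
          change b2 + s = _ at hb1
          omega
        rw [pageD_eq] at h
        exact ⟨y, h⟩
      · rw [T.pageD_eq_zero_of_not hb] at h
        exact ⟨0, (map_zero _).trans h⟩
    · rintro ⟨y, h⟩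
      refine ⟨(p + 1 + s, q'), y, ?_⟩
      rw [pageD_eq]
      exact h
  -- A source would lie below row zero: no differential arrives, and both kernels of iterates are
  -- already everything.
  · have hq : q < s := by
      by_contra hq
      exact h ⟨q - s, by omega⟩
    have : T.boundariesAt (s + 1) p q = T.boundariesAt s p q := by
      rw [boundariesAt, boundariesAt, kerIter_eq_top T hq, kerIter_eq_top T (by omega)]
    rw [this, ← T.termMk_eq_zero hv]
    constructor
    · rintro ⟨b, y, hy⟩
      rw [T.pageD_eq_zero_of_not fun hb => h ⟨b.2, hb.2.symm⟩] at hy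
      exact hy.symm
    · intro h
      exact ⟨(p, q), 0, (map_zero _).trans h.symm⟩

/-- Images of differentials are of the form $jy$, and $\pi j=0$ makes such elements cycles on every
page. -/
theorem pageD_comp_pageD (s : ℕ) (a b c : ℕ × ℕ) : T.pageD s a b ≫ T.pageD s b c = 0 := by
  refine ModuleCat.hom_ext (LinearMap.ext fun x => ?_)
  obtain ⟨⟨v, hv⟩, hv'⟩ := Submodule.Quotient.mk_surjective _ (T.pageD s a b x)
  have h := (T.exists_pageD_eq_iff s b.1 b.2 v hv).1 ⟨a, x, hv'.symm⟩
  have h' := (T.mem_cyclesAt_succ_iff s b.1 b.2 v hv).2 (T.boundariesAt_le _ _ _ _ h) c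
  exact (congrArg (T.pageD s b c) hv'.symm).trans h'

/-- The page `r` of the spectral sequence of the couple. -/
noncomputable def page (r : ℤ) (hr : 2 ≤ r) : HomologicalComplex (ModuleCat.{u} k)
    (ComplexShape.spectralSequenceNat (⟨-r, r - 1⟩ : ℤ × ℤ)) where
  -- The page $r$ is the term with $s=r-1$, the number of steps $i$ that its differential undoes.
  X a := ModuleCat.of k (T.term (r - 1).toNat a.1 a.2)
  d a b := T.pageD (r - 1).toNat a b
  shape a b hab := T.pageD_eq_zero_of_not fun h => hab (by
    rw [ComplexShape.spectralSequenceNat_rel_iff]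
    dsimp only
    omega)
  d_comp_d' a b c _ _ := T.pageD_comp_pageD _ a b c

/-- The homology of a page is the next page. -/
noncomputable def pageHomologyIso (r : ℤ) (hr : 2 ≤ r) (s : ℕ) (hs : s = (r - 1).toNat)
    (a : ℕ × ℕ) : (T.page r hr).homology a ≅ ModuleCat.of k (T.term (s + 1) a.1 a.2) := by
  subst hs
  exact HomologicalComplex.homologyIsoQuotient (T.page r hr) a
    (Submodule.mkQ _ ∘ₗ Submodule.inclusion (T.cyclesAt_succ_le (r - 1).toNat a.1 a.2)) _
    (fun x => by
      obtain ⟨⟨v, hv⟩, rfl⟩ := Submodule.Quotient.mk_surjective _ x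
      refine (T.mem_cyclesAt_succ_iff _ a.1 a.2 v hv).trans ⟨fun h => ⟨⟨v, h⟩, rfl⟩, ?_⟩
      rintro ⟨⟨w, hw⟩, h⟩
      have : w - v ∈ T.boundariesAt (r - 1).toNat a.1 a.2 :=
        (Submodule.Quotient.eq ((T.boundariesAt (r - 1).toNat a.1 a.2).submoduleOf _)).1 h
      have h' := sub_mem hw (T.boundariesAt_le _ ((r - 1).toNat + 1) _ _ this)
      rwa [sub_sub_cancel] at h')
    (fun v => by
      exact (T.exists_pageD_eq_iff _ a.1 a.2 v.1 (T.cyclesAt_succ_le _ _ _ v.2)).symm)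

/-- The spectral sequence of the couple. -/
noncomputable def spectralSequence : E₂HomologicalSpectralSequence k where
  page r hr := T.page r hr
  iso r r' a h hr := T.pageHomologyIso r hr _ rfl a ≪≫
    eqToIso (by
      change _ = ModuleCat.of k (T.term (r' - 1).toNat a.1 a.2)
      rw [show (r' - 1).toNat = (r - 1).toNat + 1 by omega])

/-- The filtration of `D 0 n` by the kernels of the iterates. -/
def filtration (n : ℕ) (p : ℤ) : Submodule k (T.D 0 n) := T.kerIter (p + 1).toNat 0 n

/-- The graded pieces of the filtration. -/
noncomputable def gradedEquiv (p q n s : ℕ) (hn : q + p = n) (hp : p ≤ s) (hq : q < s) :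
    (T.kerIter (p + 1) 0 n ⧸ (T.kerIter p 0 n).submoduleOf (T.kerIter (p + 1) 0 n)) ≃ₗ[k]
      T.term s p q :=
  -- The pairs $(y,x)$ with $i^py=\pi x$ map onto $F_p=\ker i^{p+1}$ and onto the cycles that
  -- survive. The kernels of the two maps to the quotients agree: $y\in F_{p-1}$ means $i^py=0$,
  -- that is $\pi x=0$, that is $x\in\operatorname{im} j$, and for $s>q$ all of $\operatorname{im}
  -- j$ consists of boundaries.
  let V := LinearMap.eqLocus ((T.iter p 0 q (Nat.zero_add p) hn).hom ∘ₗ LinearMap.fst k _ _)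
    ((T.π p q).hom ∘ₗ LinearMap.snd k _ _)
  have hV₁ (v : V) : v.1.1 ∈ T.kerIter (p + 1) 0 n := by
    rw [Nat.add_comm, ← T.iter_mem_kerIter 1 p 0 q (Nat.zero_add p) hn, kerIter_one]
    exact ⟨v.1.2, v.2.symm⟩
  have hV₂ (v : V) : v.1.2 ∈ T.cyclesAt s p q := by
    rw [cyclesAt, imIter_eq_of_le T hp]
    exact (T.mem_imIter_iff p 0 q (Nat.zero_add p) hn _).2 ⟨v.1.1, v.2⟩
  LinearEquiv.ofSurjections
    (Submodule.mkQ _ ∘ₗ LinearMap.codRestrict (T.kerIter (p + 1) 0 n)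
      (LinearMap.fst k _ _ ∘ₗ V.subtype) hV₁)
    (by
      intro y
      obtain ⟨⟨y, hy⟩, rfl⟩ := Submodule.Quotient.mk_surjective _ y
      have hy' := hy
      rw [Nat.add_comm, ← T.iter_mem_kerIter 1 p 0 q (Nat.zero_add p) hn, kerIter_one] at hy'
      obtain ⟨x, hx⟩ := hy'
      exact ⟨⟨(y, x), hx.symm⟩, rfl⟩)
    (Submodule.mkQ _ ∘ₗ LinearMap.codRestrict (T.cyclesAt s p q)
      (LinearMap.snd k _ _ ∘ₗ V.subtype) hV₂)
    (by
      intro x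
      obtain ⟨⟨x, hx⟩, rfl⟩ := Submodule.Quotient.mk_surjective _ x
      have hx' := hx
      rw [cyclesAt, imIter_eq_of_le T hp] at hx'
      obtain ⟨y, hy⟩ := (T.mem_imIter_iff p 0 q (Nat.zero_add p) hn _).1 hx'
      exact ⟨⟨(y, x), hy⟩, rfl⟩)
    (by
      rintro ⟨⟨y, x⟩, hv⟩
      have h₁ : y ∈ T.kerIter p 0 n ↔ T.π p q x = 0 := by
        rw [← T.iter_eq_zero_iff p 0 q (Nat.zero_add p) hn]
        exact ⟨fun h => hv.symm.trans h, fun h => Eq.trans hv h⟩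
      have h₂ : T.π p q x = 0 ↔ x ∈ T.boundariesAt s p q := by
        rw [boundariesAt, kerIter_eq_top T hq, T.exact_E p q x]
        exact ⟨fun ⟨y, hy⟩ => ⟨y, trivial, hy⟩, fun ⟨y, _, hy⟩ => ⟨y, hy⟩⟩
      refine (Submodule.Quotient.mk_eq_zero _).trans (Iff.trans ?_ (T.termMk_eq_zero _).symm)
      exact h₁.trans h₂)

/-- The spectral sequence of the couple converges to the column `D 0`. -/
noncomputable def convergesTo : ConvergesTo T.spectralSequence (T.D 0) where
  filtration := T.filtration
  mono n p p' h := T.kerIter_mono (by omega) 0 n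
  bot n := rfl
  top n := T.kerIter_eq_top (by omega) 0
  graded p q := by
    have h : T.filtration (p + q) ((p : ℤ) - 1) = T.kerIter p 0 (p + q) := by
      rw [filtration, show ((p : ℤ) - 1 + 1).toNat = p by omega]
    have h' : T.filtration (p + q) (p : ℤ) = T.kerIter (p + 1) 0 (p + q) := rfl
    rw [h, h']
    -- The page $p+q+2$ has $s=p+q+1$, large enough for both stabilisation conditions $p\le s$ and
    -- $q<s$.
    exact T.gradedEquiv p q (p + q) _ (Nat.add_comm _ _) (by omega) (by omega)

theorem filtration_zero (n : ℕ) : T.filtration n 0 = LinearMap.range (T.π 0 n).hom :=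
  T.kerIter_one 0 n

/-- The second page is the homology of `E` for the differential `j π`. -/
noncomputable def pageTwoIso (q : ℕ) (K : ChainComplex (ModuleCat.{u} k) ℕ)
    (e : ∀ p, T.E p q ≅ K.X p)
    (he : ∀ p, (e (p + 1)).hom ≫ K.d (p + 1) p = T.π (p + 1) q ≫ T.j p q ≫ (e p).hom) (p : ℕ) :
    K.homology p ≅ ModuleCat.of k (T.term 1 p q) :=
  K.homologyIsoQuotient p ((e p).hom.hom ∘ₗ (T.cyclesAt 1 p q).subtype) _
    (by
      intro x
      obtain ⟨x, rfl⟩ : ∃ y, (e p).hom y = x := ⟨(e p).inv x, by simp⟩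
      have hi : Function.Injective (e p).hom := (ModuleCat.mono_iff_injective _).1 inferInstance
      have : (∃ v : T.cyclesAt 1 p q, ((e p).hom.hom ∘ₗ (T.cyclesAt 1 p q).subtype) v =
          (e p).hom x) ↔ x ∈ T.cyclesAt 1 p q :=
        ⟨fun ⟨v, hv⟩ => hi hv ▸ v.2, fun h => ⟨⟨x, h⟩, rfl⟩⟩
      rw [this]
      cases p with
      | zero =>
        -- In column zero every element is a cycle, and the complex has no differential out of
        -- degree zero.
        refine ⟨fun _ => trivial, fun _ b => ?_⟩
        rw [K.shape _ _ (by simp)]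
        rfl
      | succ p =>
        have hj : x ∈ T.cyclesAt 1 (p + 1) q ↔ T.j p q (T.π (p + 1) q x) = 0 := by
          rw [cyclesAt, imIter_one]
          rfl
        have hi' : Function.Injective (e p).hom := (ModuleCat.mono_iff_injective _).1 inferInstance
        have hd : K.d (p + 1) p ((e (p + 1)).hom x) = (e p).hom (T.j p q (T.π (p + 1) q x)) :=
          ConcreteCategory.congr_hom (he p) x
        rw [hj]
        constructor
        · intro h
          exact hi' ((hd.symm.trans (h p)).trans (map_zero _).symm)
        · intro h b
          by_cases hb : b = p
          · subst hb
            rw [hd, h, map_zero]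
          · rw [K.shape _ _ (by simpa using hb)]
            rfl)
    (by
      intro v
      have hi : Function.Injective (e p).hom := (ModuleCat.mono_iff_injective _).1 inferInstance
      have hd (x) : K.d (p + 1) p ((e (p + 1)).hom x) = (e p).hom (T.j p q (T.π (p + 1) q x)) :=
        ConcreteCategory.congr_hom (he p) x
      change v.1 ∈ T.boundariesAt 1 p q ↔ _
      rw [boundariesAt, kerIter_one]
      constructor
      · rintro ⟨_, ⟨x, rfl⟩, hx⟩
        exact ⟨p + 1, (e (p + 1)).hom x, (hd x).trans (congrArg _ hx)⟩
      · rintro ⟨b, y, h⟩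
        by_cases hb : b = p + 1
        · subst hb
          obtain ⟨x, rfl⟩ : ∃ x, (e (p + 1)).hom x = y := ⟨(e (p + 1)).inv y, by simp⟩
          exact ⟨_, ⟨x, rfl⟩, hi ((hd x).symm.trans h)⟩
        · rw [K.shape _ _ (by simpa using fun h => hb h.symm)] at h
          have : v.1 = 0 := hi (h.symm.trans (map_zero _).symm)
          rw [this]
          exact zero_mem _)

end BigradedCouple

/-! ### Syzygies and the exact couple of a flat complex -/

namespace CoefficientHomology
open MonoidalCategory TensorProduct
variable {k : Type u} [CommRing k]

theorem functionExact_of_exact {S : ShortComplex (ModuleCat.{u} k)} (h : S.Exact) :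
    Function.Exact S.f S.g :=
  (ShortComplex.ShortExact.moduleCat_exact_iff_function_exact S).1 h

section Syzygies

/-- The syzygies of a module, in the resolution by the chosen projective covers. -/
noncomputable def syz (M : ModuleCat.{u} k) : ℕ → ModuleCat.{u} k
  | 0 => M
  | p + 1 => Limits.kernel (Projective.π (syz M p))

/-- The projective module over a syzygy. -/
noncomputable abbrev syzCover (M : ModuleCat.{u} k) (p : ℕ) : ModuleCat.{u} k :=
  Projective.over (syz M p)

/-- The map onto a syzygy. -/
noncomputable def syzπ (M : ModuleCat.{u} k) (p : ℕ) : syzCover M p ⟶ syz M p :=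
  Projective.π _

/-- The inclusion of a syzygy. -/
noncomputable def syzι (M : ModuleCat.{u} k) (p : ℕ) : syz M (p + 1) ⟶ syzCover M p :=
  Limits.kernel.ι (Projective.π (syz M p))

instance (M : ModuleCat.{u} k) (p : ℕ) : Mono (syzι M p) :=
  inferInstanceAs (Mono (Limits.kernel.ι (Projective.π (syz M p))))

instance (M : ModuleCat.{u} k) (p : ℕ) : Epi (syzπ M p) :=
  inferInstanceAs (Epi (Projective.π (syz M p)))

theorem syzι_syzπ (M : ModuleCat.{u} k) (p : ℕ) : syzι M p ≫ syzπ M p = 0 :=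
  Limits.kernel.condition _

/-- The sequence of a syzygy. -/
noncomputable abbrev syzSC (M : ModuleCat.{u} k) (p : ℕ) : ShortComplex (ModuleCat.{u} k) :=
  ShortComplex.mk (syzι M p) (syzπ M p) (syzι_syzπ M p)

theorem syzSC_shortExact (M : ModuleCat.{u} k) (p : ℕ) : (syzSC M p).ShortExact where
  exact := ShortComplex.exact_of_f_is_kernel _
    (Limits.kernelIsKernel (Projective.π (syz M p)))
  mono_f := inferInstanceAs (Mono (syzι M p))
  epi_g := inferInstanceAs (Epi (syzπ M p))

instance syzCover_projective (M : ModuleCat.{u} k) (p : ℕ) : Module.Projective k (syzCover M p) :=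
  (IsProjective.iff_projective (syzCover M p)).2 (Projective.projective_over (syz M p))

theorem syzπ_surjective (M : ModuleCat.{u} k) (p : ℕ) : Function.Surjective (syzπ M p) :=
  (syzSC_shortExact M p).moduleCat_surjective_g

theorem syz_exact (M : ModuleCat.{u} k) (p : ℕ) : Function.Exact (syzι M p) (syzπ M p) :=
  functionExact_of_exact (syzSC_shortExact M p).exact

theorem lTensor_syz_exact (X M : ModuleCat.{u} k) (p : ℕ) :
    Function.Exact (X ◁ syzι M p) (X ◁ syzπ M p) :=
  lTensor_exact X (f := (syzι M p).hom) (g := (syzπ M p).hom) (syz_exact M p) (syzπ_surjective M p)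

theorem lTensor_syzπ_surjective (X M : ModuleCat.{u} k) (p : ℕ) :
    Function.Surjective (X ◁ syzπ M p) :=
  LinearMap.lTensor_surjective X (g := (syzπ M p).hom) (syzπ_surjective M p)

/-- The resolution made from the syzygies, as a complex. -/
noncomputable def syzComplex (M : ModuleCat.{u} k) : ChainComplex (ModuleCat.{u} k) ℕ :=
  ChainComplex.of (syzCover M) (fun p => syzπ M (p + 1) ≫ syzι M p) fun p => by
    rw [Category.assoc, reassoc_of% (syzι_syzπ M (p + 1)), Limits.zero_comp, Limits.comp_zero]

theorem syzComplex_d (M : ModuleCat.{u} k) (p : ℕ) :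
    (syzComplex M).d (p + 1) p = syzπ M (p + 1) ≫ syzι M p := 
  ChainComplex.of_d (syzCover M) (fun p => syzπ M (p + 1) ≫ syzι M p) p

/-- The augmentation. -/
noncomputable def syzAugmentation (M : ModuleCat.{u} k) :
    syzComplex M ⟶ (ChainComplex.single₀ _).obj M :=
  (ChainComplex.toSingle₀Equiv _ _).symm ⟨syzπ M 0, by
    rw [syzComplex_d]
    exact (Category.assoc _ _ _).trans ((congrArg _ (syzι_syzπ M 0)).trans Limits.comp_zero)⟩

theorem syz_exact_comp (M : ModuleCat.{u} k) (p : ℕ) :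
    Function.Exact ((syzComplex M).d (p + 1) p) (syzπ M p) := by
  rw [syzComplex_d]
  intro x
  rw [syz_exact M p x]
  constructor
  · rintro ⟨y, rfl⟩
    obtain ⟨z, rfl⟩ := syzπ_surjective M (p + 1) y
    exact ⟨z, rfl⟩
  · rintro ⟨z, rfl⟩
    exact ⟨syzπ M (p + 1) z, rfl⟩

instance (M : ModuleCat.{u} k) : QuasiIso (syzAugmentation M) := by
  refine FunctorHomology.quasiIso_of_exact _ (fun n => ?_) (fun n => ?_) ?_ ?_
  · exact HomologicalComplex.isZero_single_obj_X (.down ℕ) 0 _ (n + 1) (by simp)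
  · refine (ShortComplex.ShortExact.moduleCat_exact_iff_function_exact _).2 fun x => ?_
    refine Iff.trans ?_ (syz_exact_comp M (n + 1) x)
    have hi : Function.Injective (syzι M n) := (ModuleCat.mono_iff_injective _).1 inferInstance
    change (syzComplex M).d (n + 1) n x = 0 ↔ _
    rw [syzComplex_d]
    exact map_eq_zero_iff (syzι M n).hom hi
  · exact (ShortComplex.ShortExact.moduleCat_exact_iff_function_exact _).2 (syz_exact_comp M 0)
  · exact (ModuleCat.epi_iff_surjective _).2 (syzπ_surjective M 0)

/-- The resolution made from the syzygies. -/
noncomputable def syzResolution (M : ModuleCat.{u} k) : ProjectiveResolution M where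
  complex := syzComplex M
  projective p := inferInstanceAs (Projective (syzCover M p))
  π := syzAugmentation M

/-- The complex `X ⊗ P` that computes `Tor(X, M)`. -/
noncomputable abbrev torComplex (X M : ModuleCat.{u} k) : ChainComplex (ModuleCat.{u} k) ℕ :=
  ((tensorLeft X).mapHomologicalComplex _).obj (syzComplex M)

/-- `Tor_p(X, M)` from the resolution by syzygies. -/
noncomputable def torIso (X M : ModuleCat.{u} k) (p : ℕ) :
    ((Tor (ModuleCat.{u} k) p).obj X).obj M ≅ (torComplex X M).homology p :=
  (syzResolution M).isoLeftDerivedObj ((tensoringLeft _).obj X) p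

end Syzygies

section Couple

/-- Every chain of degree zero is a cycle, so right exactness of the tensor product suffices. This
closes the exact couple along row zero. -/
theorem surjective_homMap_zero (L : ChainComplex (ModuleCat.{u} k) ℕ) {M N : ModuleCat.{u} k}
    (g : M ⟶ N) (hg : Function.Surjective g) : Function.Surjective (homMap (𝟙 L) g 0) := by
  intro x
  obtain ⟨z, rfl⟩ := ShortComplex.cls_surjective _ x
  obtain ⟨y, hy⟩ := LinearMap.lTensor_surjective (L.X 0) (g := g.hom) hg
    (show (L.X 0 : Type u) ⊗[k] N from z.1)
  have hy' : (show ((tensObj L M).sc 0).X₂ from y) ∈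
      LinearMap.ker ((tensObj L M).sc 0).g.hom := by
    have : ((tensObj L M).sc 0).g = 0 := (tensObj L M).shape _ _ (by simp)
    exact LinearMap.mem_ker.2 (by rw [this]; rfl)
  refine ⟨ShortComplex.cls _ ⟨y, hy'⟩, ?_⟩
  refine (ShortComplex.homologyMap_cls ((HomologicalComplex.shortComplexFunctor _ _ 0).map
    (tensMap (𝟙 L) g)) ⟨y, hy'⟩ (ShortComplex.mem_ker_of_hom
      ((HomologicalComplex.shortComplexFunctor _ _ 0).map (tensMap (𝟙 L) g)) ⟨y, hy'⟩)).trans ?_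
  refine congrArg _ (Subtype.ext ?_)
  refine Eq.trans ?_ hy
  exact ConcreteCategory.congr_hom ((tensMap_f (𝟙 L) g 0).trans (id_tensorHom _ _)) y

variable (L : ChainComplex (ModuleCat.{u} k) ℕ) (hL : ∀ n, Module.Flat k (L.X n))
  (M : ModuleCat.{u} k)

/-- The connecting map `H_{q+1}(L ⊗ K_p) ⟶ H_q(L ⊗ K_{p+1})`. -/
noncomputable def conn (p q : ℕ) :
    (tensObj L (syz M p)).homology (q + 1) ⟶ (tensObj L (syz M (p + 1))).homology q :=
  (tensSC_shortExact L hL (syzSC_shortExact M p)).δ (q + 1) q rfl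

theorem conn_exact₁ (p q : ℕ) :
    Function.Exact (conn L hL M p q) (homMap (𝟙 L) (syzι M p) q) :=
  functionExact_of_exact
    ((tensSC_shortExact L hL (syzSC_shortExact M p)).homology_exact₁ (q + 1) q rfl)

theorem conn_exact₂ (L : ChainComplex (ModuleCat.{u} k) ℕ) (hL : ∀ n, Module.Flat k (L.X n))
    (M : ModuleCat.{u} k) (p q : ℕ) :
    Function.Exact (homMap (𝟙 L) (syzι M p) q) (homMap (𝟙 L) (syzπ M p) q) :=
  functionExact_of_exact
    ((tensSC_shortExact L hL (syzSC_shortExact M p)).homology_exact₂ q)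

theorem conn_exact₃ (p q : ℕ) :
    Function.Exact (homMap (𝟙 L) (syzπ M p) (q + 1)) (conn L hL M p q) :=
  functionExact_of_exact
    ((tensSC_shortExact L hL (syzSC_shortExact M p)).homology_exact₃ (q + 1) q rfl)

/-- The exact couple of the homology of `L ⊗ -` on the syzygies of `M`. -/
noncomputable def couple : BigradedCouple k where
  D p q := (tensObj L (syz M p)).homology q
  E p q := (tensObj L (syzCover M p)).homology q
  i p q := conn L hL M p q
  j p q := homMap (𝟙 L) (syzι M p) q
  π p q := homMap (𝟙 L) (syzπ M p) q
  exact_E p q := conn_exact₂ L hL M p q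
  exact_i p q := conn_exact₁ L hL M p q
  exact_π p q := conn_exact₃ L hL M p q
  surjective_π p := surjective_homMap_zero L _ (syzπ_surjective M p)

instance isIso_univ_syzCover (p q : ℕ) : IsIso (univ L (syzCover M p) q) :=
  isIso_univ_of_flat L _ q

theorem homMap_comp {L L' L'' : ChainComplex (ModuleCat.{u} k) ℕ} {M M' M'' : ModuleCat.{u} k}
    (f : L ⟶ L') (f' : L' ⟶ L'') (g : M ⟶ M') (g' : M' ⟶ M'') (n : ℕ) :
    homMap f g n ≫ homMap f' g' n = homMap (f ≫ f') (g ≫ g') n := by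
  rw [homMap, homMap, ← HomologicalComplex.homologyMap_comp, ← tensMap_comp]

theorem univ_naturality_right {M N : ModuleCat.{u} k} (g : M ⟶ N) (n : ℕ) :
    univ L M n ≫ homMap (𝟙 L) g n = (L.homology n ◁ g) ≫ univ L N n := by
  rw [univ_naturality, HomologicalComplex.homologyMap_id, id_tensorHom]

/-- The second page of the couple is `Tor`. -/
noncomputable def couplePageTwo {X : ModuleCat.{u} k} (p q : ℕ) (a : X ≅ L.homology q) :
    ModuleCat.of k ((couple L hL M).term 1 p q) ≅ ((Tor (ModuleCat.{u} k) p).obj X).obj M :=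
  ((couple L hL M).pageTwoIso q (torComplex X M)
    -- Since $P_p$ is flat, row $q$ of $E$ is $H_q(L)\otimes P_p$; by naturality of `univ` the map
    -- $j\pi$ becomes $H_q(L)\otimes d$, whose homology is $\mathrm{Tor}$.
    (fun p => (asIso (univ L (syzCover M p) q)).symm ≪≫ whiskerRightIso a.symm _)
    (fun p => by
      have h : (torComplex X M).d (p + 1) p = X ◁ (syzπ M (p + 1) ≫ syzι M p) :=
        congrArg (X ◁ ·) (syzComplex_d M p)
      rw [h]
      change (inv (univ L (syzCover M (p + 1)) q) ≫ (a.inv ▷ _)) ≫ _ =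
        homMap (𝟙 L) (syzπ M (p + 1)) q ≫ homMap (𝟙 L) (syzι M p) q ≫
          inv (univ L (syzCover M p) q) ≫ (a.inv ▷ _)
      rw [Category.assoc, IsIso.inv_comp_eq]
      have h' := univ_naturality_right L (syzπ M (p + 1) ≫ syzι M p) q
      have h'' := homMap_comp (𝟙 L) (𝟙 L) (syzπ M (p + 1)) (syzι M p) q
      rw [Category.comp_id] at h''
      rw [← whisker_exchange, ← Category.assoc (homMap _ _ _), h'', ← Category.assoc, h']
      simp) p).symm ≪≫ (torIso X M p).symm

/-- In the naturality square along $P_0\to M$ the map $H_n(L)\otimes P_0\to H_n(L\otimes P_0)$ is an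
isomorphism and $H_n(L)\otimes P_0\to H_n(L)\otimes M$ is onto. With `filtration_zero` this
identifies the image of the universal coefficient map with $F_0$. -/
theorem range_univ (n : ℕ) :
    LinearMap.range (univ L M n).hom = LinearMap.range (homMap (𝟙 L) (syzπ M 0) n).hom := by
  have h := univ_naturality_right L (syzπ M 0) n
  have h₁ : LinearMap.range (univ L (syzCover M 0) n).hom = ⊤ :=
    LinearMap.range_eq_top.2 ((ConcreteCategory.isIso_iff_bijective _).1 inferInstance).2
  have h₂ : LinearMap.range (L.homology n ◁ syzπ M 0).hom = ⊤ :=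
    LinearMap.range_eq_top.2 (lTensor_syzπ_surjective _ M 0)
  have h' := congrArg (fun f => LinearMap.range f.hom) h
  simp only [ModuleCat.hom_comp, LinearMap.range_comp] at h'
  rw [h₁, h₂, Submodule.map_top, Submodule.map_top] at h'
  exact h'.symm

end Couple

end CoefficientHomology

namespace CoefficientHomology
open MonoidalCategory TensorProduct
variable {k : Type u} [CommRing k]

/-! ### Tor inside a tensor product with a syzygy -/

section TorOne

theorem torComplex_d (X M : ModuleCat.{u} k) (p : ℕ) :
    (torComplex X M).d (p + 1) p = X ◁ syzπ M (p + 1) ≫ X ◁ syzι M p :=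
  (congrArg (X ◁ ·) (syzComplex_d M p)).trans (whiskerLeft_comp _ _ _)

theorem torComplex_d_apply (X M : ModuleCat.{u} k) (p : ℕ) (x : (torComplex X M).X (p + 1)) :
    (torComplex X M).d (p + 1) p x = (X ◁ syzι M p) ((X ◁ syzπ M (p + 1)) x) :=
  ConcreteCategory.congr_hom (torComplex_d X M p) x

theorem mem_ker_sc_iff (K : ChainComplex (ModuleCat.{u} k) ℕ) (p : ℕ) (x : K.X (p + 1)) :
    (show (K.sc (p + 1)).X₂ from x) ∈ LinearMap.ker (K.sc (p + 1)).g.hom ↔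
      K.d (p + 1) p x = 0 := by
  change K.d (p + 1) ((ComplexShape.down ℕ).next (p + 1)) x = 0 ↔ _
  rw [ChainComplex.next_nat_succ]

theorem exists_sc_f_iff (K : ChainComplex (ModuleCat.{u} k) ℕ) (p : ℕ) (x : K.X p) :
    (∃ y, (K.sc p).f y = x) ↔ ∃ y, K.d (p + 1) p y = x := by
  change (∃ y : K.X ((ComplexShape.down ℕ).prev p), K.d _ p y = x) ↔ _
  rw [ChainComplex.prev]

/-- Right exactness makes $X\otimes P_{p+2}$ cover $X\otimes K_{p+2}$, so dying in $X\otimes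
K_{p+1}$ is the same as being a boundary. This is why homology embeds there. -/
theorem syz_exact_succ (X M : ModuleCat.{u} k) (p : ℕ) (x : (torComplex X M).X (p + 1)) :
    (X ◁ syzπ M (p + 1)) x = 0 ↔ ∃ y, (torComplex X M).d (p + 2) (p + 1) y = x := by
  refine (lTensor_syz_exact X M (p + 1) x).trans ?_
  constructor
  · rintro ⟨y, rfl⟩
    obtain ⟨z, rfl⟩ := lTensor_syzπ_surjective X M (p + 2) y
    exact ⟨z, torComplex_d_apply X M (p + 1) z⟩
  · rintro ⟨y, rfl⟩
    exact ⟨_, (torComplex_d_apply X M (p + 1) y).symm⟩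

/-- The map from the homology of `X ⊗ P` to `X ⊗ K`, with `K` the syzygy. -/
noncomputable def homologyToSyz (X M : ModuleCat.{u} k) (p : ℕ) :
    (torComplex X M).homology (p + 1) ⟶ X ⊗ syz M (p + 1) :=
  ModuleCat.ofHom (LinearMap.descend ((torComplex X M).sc (p + 1)).cls
    (ShortComplex.cls_surjective _)
    ((X ◁ syzπ M (p + 1)).hom ∘ₗ (LinearMap.ker ((torComplex X M).sc (p + 1)).g.hom).subtype)
    fun z hz => by
      have := (exists_sc_f_iff (torComplex X M) (p + 1) z.1).1
        ((ShortComplex.cls_eq_zero_iff _ z).1 hz)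
      exact (syz_exact_succ X M p z.1).2 this)

theorem homologyToSyz_cls (X M : ModuleCat.{u} k) (p : ℕ)
    (z : LinearMap.ker ((torComplex X M).sc (p + 1)).g.hom) :
    homologyToSyz X M p (((torComplex X M).sc (p + 1)).cls z) = (X ◁ syzπ M (p + 1)) z.1 :=
  LinearMap.descend_apply _ _ _ _ z

theorem homologyToSyz_injective (X M : ModuleCat.{u} k) (p : ℕ) :
    Function.Injective (homologyToSyz X M p) := by
  refine (injective_iff_map_eq_zero (homologyToSyz X M p).hom).2 fun x hx => ?_
  obtain ⟨z, rfl⟩ := ShortComplex.cls_surjective _ x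
  refine (ShortComplex.cls_eq_zero_iff _ z).2 ((exists_sc_f_iff _ _ _).2 ?_)
  exact (syz_exact_succ X M p z.1).1 ((homologyToSyz_cls X M p z).symm.trans hx)

/-- The differential is the composite $X\otimes P_{p+1}\to X\otimes K_{p+1}\to X\otimes P_p$ with
first map onto, so the images of cycles are exactly the elements killed by the second map. -/
theorem homologyToSyz_exact (X M : ModuleCat.{u} k) (p : ℕ) :
    Function.Exact (homologyToSyz X M p) (X ◁ syzι M p) := by
  intro x
  constructor
  · intro hx
    obtain ⟨y, rfl⟩ := lTensor_syzπ_surjective X M (p + 1) x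
    have hy := (mem_ker_sc_iff (torComplex X M) p y).2 ((torComplex_d_apply X M p y).trans hx)
    exact ⟨ShortComplex.cls _ ⟨_, hy⟩, homologyToSyz_cls X M p ⟨_, hy⟩⟩
  · rintro ⟨y, rfl⟩
    obtain ⟨z, rfl⟩ := ShortComplex.cls_surjective _ y
    refine (congrArg (X ◁ syzι M p) (homologyToSyz_cls X M p z)).trans ?_
    exact (torComplex_d_apply X M p z.1).symm.trans ((mem_ker_sc_iff (torComplex X M) p z.1).1 z.2)

/-- The embedding of `Tor_{p+1}(X, M)` into `X ⊗ K`, with `K` the syzygy. -/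
noncomputable def torToSyz (X M : ModuleCat.{u} k) (p : ℕ) :
    ((Tor (ModuleCat.{u} k) (p + 1)).obj X).obj M ⟶ X ⊗ syz M (p + 1) :=
  (torIso X M (p + 1)).hom ≫ homologyToSyz X M p

theorem torToSyz_injective (X M : ModuleCat.{u} k) (p : ℕ) :
    Function.Injective (torToSyz X M p) :=
  (homologyToSyz_injective X M p).comp
    ((ConcreteCategory.isIso_iff_bijective (torIso X M (p + 1)).hom).1 inferInstance).1

theorem torToSyz_exact (X M : ModuleCat.{u} k) (p : ℕ) :
    Function.Exact (torToSyz X M p) (X ◁ syzι M p) := by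
  intro x
  refine (homologyToSyz_exact X M p x).trans ?_
  constructor
  · rintro ⟨y, rfl⟩
    obtain ⟨z, rfl⟩ :=
      ((ConcreteCategory.isIso_iff_bijective (torIso X M (p + 1)).hom).1 inferInstance).2 y
    exact ⟨z, rfl⟩
  · rintro ⟨y, rfl⟩
    exact ⟨(torIso X M (p + 1)).hom y, rfl⟩

/-- $\mathrm{Tor}_{p+1}(X,M)$ is the kernel of $X\otimes K_{p+1}\to X\otimes P_p$. -/
theorem isZero_tor_iff (X M : ModuleCat.{u} k) (p : ℕ) :
    Limits.IsZero (((Tor (ModuleCat.{u} k) (p + 1)).obj X).obj M) ↔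
      Function.Injective (X ◁ syzι M p) := by
  rw [ModuleCat.isZero_iff_subsingleton]
  constructor
  · intro h
    refine (injective_iff_map_eq_zero (X ◁ syzι M p).hom).2 fun x hx => ?_
    obtain ⟨y, rfl⟩ := (torToSyz_exact X M p x).1 hx
    rw [Subsingleton.elim y 0, map_zero]
  · intro h
    refine subsingleton_of_forall_eq 0 fun x => torToSyz_injective X M p (h ?_)
    rw [map_zero, map_zero]
    exact (torToSyz_exact X M p).apply_apply_eq_zero x

/-- A lift of a map of modules to the resolutions by syzygies. -/
noncomputable def syzLift {M N : ModuleCat.{u} k} (g : M ⟶ N) : syzComplex M ⟶ syzComplex N :=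
  ProjectiveResolution.lift g (syzResolution M) (syzResolution N)

theorem syzLift_syzπ {M N : ModuleCat.{u} k} (g : M ⟶ N) :
    (syzLift g).f 0 ≫ syzπ N 0 = syzπ M 0 ≫ g :=
  ProjectiveResolution.lift_commutes_zero g (syzResolution M) (syzResolution N)

/-- The induced map of first syzygies. -/
noncomputable def syzMap {M N : ModuleCat.{u} k} (g : M ⟶ N) : syz M 1 ⟶ syz N 1 :=
  Limits.kernel.map (Projective.π M) (Projective.π N) ((syzLift g).f 0) g (syzLift_syzπ g).symm

theorem syzMap_syzι {M N : ModuleCat.{u} k} (g : M ⟶ N) :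
    syzMap g ≫ syzι N 0 = syzι M 0 ≫ (syzLift g).f 0 :=
  Limits.kernel.lift_ι _ _ _

theorem syzπ_syzMap {M N : ModuleCat.{u} k} (g : M ⟶ N) :
    syzπ M 1 ≫ syzMap g = (syzLift g).f 1 ≫ syzπ N 1 := by
  refine (cancel_mono (syzι N 0)).1 ?_
  refine (Category.assoc _ _ _).trans ((congrArg (syzπ M 1 ≫ ·) (syzMap_syzι g)).trans ?_)
  refine (Category.assoc _ _ _).symm.trans (Eq.trans ?_ (Category.assoc _ _ _).symm)
  have := (syzLift g).comm 1 0
  rw [syzComplex_d, syzComplex_d] at this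
  exact this.symm

/-- The map of the sequences of first syzygies. -/
noncomputable def syzSCMap {M N : ModuleCat.{u} k} (g : M ⟶ N) : syzSC M 0 ⟶ syzSC N 0 where
  τ₁ := syzMap g
  τ₂ := (syzLift g).f 0
  τ₃ := g
  comm₁₂ := syzMap_syzι g
  comm₂₃ := syzLift_syzπ g

theorem homologyToSyz_naturality {X Y M N : ModuleCat.{u} k}
    (Φ : torComplex X M ⟶ torComplex Y N) (t : X ⊗ syz M 1 ⟶ Y ⊗ syz N 1)
    (h : Φ.f 1 ≫ Y ◁ syzπ N 1 = X ◁ syzπ M 1 ≫ t) :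
    HomologicalComplex.homologyMap Φ 1 ≫ homologyToSyz Y N 0 = homologyToSyz X M 0 ≫ t := by
  refine ModuleCat.hom_ext (LinearMap.ext fun x => ?_)
  obtain ⟨z, rfl⟩ := ShortComplex.cls_surjective _ x
  have hz := ShortComplex.mem_ker_of_hom
    ((HomologicalComplex.shortComplexFunctor _ _ 1).map Φ) z
  refine (congrArg (homologyToSyz Y N 0) (ShortComplex.homologyMap_cls
    ((HomologicalComplex.shortComplexFunctor _ _ 1).map Φ) z hz)).trans ?_
  refine (homologyToSyz_cls Y N 0 ⟨_, hz⟩).trans ?_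
  refine Eq.trans ?_ (congrArg t (homologyToSyz_cls X M 0 z)).symm
  exact ConcreteCategory.congr_hom h z.1

theorem torToSyz_naturality_right (X : ModuleCat.{u} k) {M N : ModuleCat.{u} k} (g : M ⟶ N) :
    ((Tor (ModuleCat.{u} k) 1).obj X).map g ≫ torToSyz X N 0 =
      torToSyz X M 0 ≫ X ◁ syzMap g := by
  have h := ProjectiveResolution.isoLeftDerivedObj_hom_naturality g (syzResolution M)
    (syzResolution N) (syzLift g) (syzLift_syzπ g) ((tensoringLeft _).obj X) 1
  refine (Category.assoc _ _ _).symm.trans ((congrArg (· ≫ homologyToSyz X N 0) h).trans ?_)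
  refine (Category.assoc _ _ _).trans (Eq.trans ?_ (Category.assoc _ _ _).symm)
  refine congrArg (_ ≫ ·) (homologyToSyz_naturality _ _ ?_)
  refine (whiskerLeft_comp X _ _).symm.trans (Eq.trans ?_ (whiskerLeft_comp X _ _))
  exact congrArg (X ◁ ·) (syzπ_syzMap g).symm

theorem torToSyz_naturality_left {X Y : ModuleCat.{u} k} (f : X ⟶ Y) (M : ModuleCat.{u} k) :
    ((Tor (ModuleCat.{u} k) 1).map f).app M ≫ torToSyz Y M 0 =
      torToSyz X M 0 ≫ f ▷ syz M 1 := by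
  have h := (syzResolution M).leftDerived_app_eq ((tensoringLeft _).map f) 1
  refine (congrArg (· ≫ torToSyz Y M 0) h).trans ?_
  have hc : HomologicalComplex.homologyMap ((NatTrans.mapHomologicalComplex
      ((tensoringLeft (ModuleCat.{u} k)).map f) _).app (syzComplex M)) 1 ≫ homologyToSyz Y M 0 =
        homologyToSyz X M 0 ≫ f ▷ syz M 1 :=
    homologyToSyz_naturality _ _ (whisker_exchange f (syzπ M 1)).symm
  refine (Category.assoc _ _ _).trans (Eq.trans ?_ (Category.assoc _ _ _).symm)
  refine congrArg ((torIso X M 1).hom ≫ ·) ?_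
  refine (Category.assoc _ _ _).trans (Eq.trans ?_ hc)
  refine congrArg (_ ≫ ·) ?_
  exact Iso.inv_hom_id_assoc (torIso Y M 1) _

end TorOne

/-! ### Flatness of the first syzygy -/

section WeakDimension

/-- A quotient of a flat module by a submodule that stays a submodule after tensoring is flat. -/
theorem flat_of_injective_lTensor {S : ShortComplex (ModuleCat.{u} k)} (hS : S.ShortExact)
    [Module.Flat k S.X₂] (h : ∀ X : ModuleCat.{u} k, Function.Injective (X ◁ S.f)) :
    Module.Flat k S.X₃ := by
  rw [Module.Flat.iff_rTensor_preserves_injective_linearMap]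
  intro N N' _ _ _ _ f hf
  have hex : Function.Exact S.f.hom S.g.hom := functionExact_of_exact hS.exact
  have hg : Function.Surjective S.g.hom := hS.moduleCat_surjective_g
  refine (injective_iff_map_eq_zero _).2 fun z hz => ?_
  obtain ⟨y, rfl⟩ := LinearMap.lTensor_surjective N hg z
  have hcomm (Q Q' : Type u) [AddCommGroup Q] [Module k Q] [AddCommGroup Q'] [Module k Q']
      (q : Q →ₗ[k] Q') (A B : ModuleCat.{u} k) (a : A →ₗ[k] B) (t : Q ⊗[k] A) :
      a.lTensor Q' (q.rTensor A t) = q.rTensor B (a.lTensor Q t) := by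
    rw [← LinearMap.comp_apply, ← LinearMap.comp_apply, LinearMap.lTensor_comp_rTensor,
      LinearMap.rTensor_comp_lTensor]
  have hfex := LinearMap.exact_map_mkQ_range f
  rw [← hcomm] at hz
  obtain ⟨w, hw⟩ := (lTensor_exact N' hex hg _).1 hz
  -- The class of `w` in $(N'/N)\otimes X_1$ dies in $(N'/N)\otimes X_2$, where it is the image of
  -- an element of $N\otimes X_2$. By `h` for $X=N'/N$ it is zero, so `w` comes from $N\otimes X_1$.
  have hw0 : (LinearMap.range f).mkQ.rTensor S.X₁ w = 0 := by
    refine h (ModuleCat.of k (N' ⧸ LinearMap.range f)) (Eq.trans ?_ (map_zero _).symm)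
    refine (hcomm _ _ (LinearMap.range f).mkQ S.X₁ S.X₂ S.f.hom w).trans ?_
    rw [hw]
    exact (rTensor_exact S.X₂ hfex (Submodule.mkQ_surjective _)).apply_apply_eq_zero y
  obtain ⟨w', rfl⟩ := (rTensor_exact S.X₁ hfex (Submodule.mkQ_surjective _) w).1 hw0
  rw [hcomm] at hw
  rw [← Module.Flat.rTensor_preserves_injective_linearMap (M := S.X₂) f hf hw]
  exact (lTensor_exact N hex hg).apply_apply_eq_zero w'

theorem isZero_tor_of_weakGlobalDimension_le (hk : weakGlobalDimension k ≤ 1)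
    (X M : ModuleCat.{u} k) (n : ℕ) :
    Limits.IsZero (((Tor (ModuleCat.{u} k) (n + 2)).obj X).obj M) := by
  by_contra h
  have : ((n + 2 : ℕ) : ℕ∞) ≤ 1 := 
    le_trans (show _ ≤ weakGlobalDimension k from le_sSup ⟨n + 2, rfl, X, M, h⟩) hk
  have := Nat.cast_le.1 (this.trans_eq Nat.cast_one.symm)
  omega

/-- Vanishing of $\mathrm{Tor}_2(X,M)$ for all $X$ says that $K_2\to P_1$ stays injective after
tensoring, so its cokernel $K_1$ is flat. -/
theorem flat_syz_one (hk : weakGlobalDimension k ≤ 1) (M : ModuleCat.{u} k) :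
    Module.Flat k (syz M 1) := by
  have : Module.Flat k (syzSC M 1).X₂ := inferInstanceAs (Module.Flat k (syzCover M 1))
  exact flat_of_injective_lTensor (syzSC_shortExact M 1) fun X =>
    (isZero_tor_iff X M 1).1 (isZero_tor_of_weakGlobalDimension_le hk X M 0)

end WeakDimension

end CoefficientHomology

/-! ### The universal coefficient sequence of a flat complex -/

namespace CoefficientHomology
open MonoidalCategory TensorProduct
variable {k : Type u} [CommRing k]

section Sequences
variable (L : ChainComplex (ModuleCat.{u} k) ℕ) (hL : ∀ n, Module.Flat k (L.X n))
  (M : ModuleCat.{u} k)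

/-- A five lemma chase: compare $H_n(L)\otimes K_1\to H_n(L)\otimes P_0\to H_n(L)\otimes M\to 0$
with the homology sequence of $L\otimes K_1\to L\otimes P_0\to L\otimes M$. The first two vertical
maps are isomorphisms because $K_1$ and $P_0$ are flat. -/
theorem univ_injective (hL : ∀ n, Module.Flat k (L.X n)) (hM : Module.Flat k (syz M 1)) (n : ℕ) :
    Function.Injective (univ L M n) := by
  have := hM
  refine (injective_iff_map_eq_zero (univ L M n).hom).2 fun t ht => ?_
  obtain ⟨s, rfl⟩ := lTensor_syzπ_surjective (L.homology n) M 0 t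
  have h₁ : homMap (𝟙 L) (syzπ M 0) n (univ L (syzCover M 0) n s) = 0 :=
    (ConcreteCategory.congr_hom (univ_naturality_right L (syzπ M 0) n) s).trans ht
  obtain ⟨w, hw⟩ := (conn_exact₂ L hL M 0 n _).1 h₁
  have : IsIso (univ L (syz M 1) n) := isIso_univ_of_flat L _ n
  obtain ⟨v, rfl⟩ := ((ConcreteCategory.isIso_iff_bijective (univ L (syz M 1) n)).1 this).2 w
  have h₂ := (ConcreteCategory.congr_hom (univ_naturality_right L (syzι M 0) n) v).symm.trans hw
  have h₃ := ((ConcreteCategory.isIso_iff_bijective (univ L (syzCover M 0) n)).1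
    inferInstance).1 h₂
  rw [← h₃]
  exact (lTensor_syz_exact _ M 0).apply_apply_eq_zero v

theorem univ_surjective_zero : Function.Surjective (univ L M 0) := by
  rw [← LinearMap.range_eq_top (f := (univ L M 0).hom), range_univ]
  exact LinearMap.range_eq_top.2 (surjective_homMap_zero L _ (syzπ_surjective M 0))

theorem torToSyz_comp (X M : ModuleCat.{u} k) : torToSyz X M 0 ≫ X ◁ syzι M 0 = 0 :=
  ModuleCat.hom_ext (LinearMap.ext fun x => (torToSyz_exact X M 0).apply_apply_eq_zero x)

/-- The connecting map takes values in $H_n(L\otimes K_1)\cong H_n(L)\otimes K_1$ and dies in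
$H_n(L)\otimes P_0$, so it factors through the kernel $\mathrm{Tor}_1(H_n(L),M)$. The equation
determines the factorisation, since the maps after it are injective. -/
theorem exists_uctδ (hM : Module.Flat k (syz M 1)) (n : ℕ) :
    ∃ t : (tensObj L M).homology (n + 1) ⟶ ((Tor (ModuleCat.{u} k) 1).obj (L.homology n)).obj M,
      t ≫ torToSyz _ M 0 ≫ univ L (syz M 1) n = conn L hL M 0 n := by
  have : IsIso (univ L (syz M 1) n) := isIso_univ_of_flat L _ n
  have hS : (ShortComplex.mk _ _ (torToSyz_comp (L.homology n) M)).Exact :=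
    (ShortComplex.ShortExact.moduleCat_exact_iff_function_exact _).2
      (torToSyz_exact (L.homology n) M 0)
  have : Mono (ShortComplex.mk _ _ (torToSyz_comp (L.homology n) M)).f :=
    (ModuleCat.mono_iff_injective _).2 (torToSyz_injective _ M 0)
  have h : (conn L hL M 0 n ≫ inv (univ L (syz M 1) n)) ≫ (L.homology n) ◁ syzι M 0 = 0 := by
    rw [← cancel_mono (univ L (syzCover M 0) n), Limits.zero_comp, Category.assoc,
      ← univ_naturality_right]
    refine (Category.assoc _ _ _).trans ?_
    refine (congrArg (conn L hL M 0 n ≫ ·) (IsIso.inv_hom_id_assoc _ _)).trans ?_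
    exact ModuleCat.hom_ext (LinearMap.ext fun x =>
      (conn_exact₁ L hL M 0 n).apply_apply_eq_zero x)
  refine ⟨hS.lift _ h, ?_⟩
  refine (Category.assoc _ _ _).symm.trans ((congrArg (· ≫ univ L (syz M 1) n)
    (hS.lift_f _ h)).trans ?_)
  exact (Category.assoc _ _ _).trans ((congrArg _ (IsIso.inv_hom_id _)).trans (Category.comp_id _))

/-- The map `H_{n+1}(L ⊗ M) ⟶ Tor_1(H_n(L), M)`. -/
noncomputable def uctδ (hM : Module.Flat k (syz M 1)) (n : ℕ) :
    (tensObj L M).homology (n + 1) ⟶ ((Tor (ModuleCat.{u} k) 1).obj (L.homology n)).obj M :=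
  (exists_uctδ L hL M hM n).choose

theorem uctδ_spec (hM : Module.Flat k (syz M 1)) (n : ℕ) :
    uctδ L hL M hM n ≫ torToSyz _ M 0 ≫ univ L (syz M 1) n = conn L hL M 0 n :=
  (exists_uctδ L hL M hM n).choose_spec

theorem uctδ_spec_apply (hM : Module.Flat k (syz M 1)) (n : ℕ)
    (y : (tensObj L M).homology (n + 1)) :
    univ L (syz M 1) n (torToSyz _ M 0 (uctδ L hL M hM n y)) = conn L hL M 0 n y :=
  ConcreteCategory.congr_hom (uctδ_spec L hL M hM n) y

theorem univ_torToSyz_injective (hM : Module.Flat k (syz M 1)) (n : ℕ) :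
    Function.Injective (torToSyz (L.homology n) M 0 ≫ univ L (syz M 1) n) := by
  have : IsIso (univ L (syz M 1) n) := isIso_univ_of_flat L _ n
  exact ((ConcreteCategory.isIso_iff_bijective (univ L (syz M 1) n)).1 this).1.comp
    (torToSyz_injective _ M 0)

theorem uctδ_surjective (hM : Module.Flat k (syz M 1)) (n : ℕ) :
    Function.Surjective (uctδ L hL M hM n) := by
  intro t
  have h : homMap (𝟙 L) (syzι M 0) n (univ L (syz M 1) n (torToSyz _ M 0 t)) = 0 := by
    refine (ConcreteCategory.congr_hom (univ_naturality_right L (syzι M 0) n) _).trans ?_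
    refine (congrArg (univ L (syzCover M 0) n)
      ((torToSyz_exact _ M 0).apply_apply_eq_zero t)).trans (map_zero _)
  obtain ⟨y, hy⟩ := (conn_exact₁ L hL M 0 n _).1 h
  exact ⟨y, univ_torToSyz_injective L M hM n
    ((uctδ_spec_apply L hL M hM n y).trans hy)⟩

/-- The kernel of `uctδ` is that of the connecting map, hence the image of $H_{n+1}(L\otimes P_0)$,
which is the image of `univ`. -/
theorem univ_exact (hM : Module.Flat k (syz M 1)) (n : ℕ) :
    Function.Exact (univ L M (n + 1)) (uctδ L hL M hM n) := by
  refine (LinearMap.exact_iff (f := (univ L M (n + 1)).hom) (g := (uctδ L hL M hM n).hom)).2 ?_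
  rw [range_univ, ← LinearMap.exact_iff.1 (conn_exact₃ L hL M 0 n)]
  ext y
  refine Iff.trans ?_ (Eq.congr_left (uctδ_spec_apply L hL M hM n y))
  exact (map_eq_zero_iff (torToSyz (L.homology n) M 0 ≫ univ L (syz M 1) n).hom
    (univ_torToSyz_injective L M hM n)).symm

theorem comp_eq_of_ladder {𝒜 : Type*} [Category 𝒜] {Y T T₁ T₂ W W₁ W₂ Z Z₂ : 𝒜} {d : Y ⟶ T}
    {a : T ⟶ T₁} {b : T₁ ⟶ T₂} {t : T ⟶ W} {t₁ : T₁ ⟶ W₁} {t₂ : T₂ ⟶ W₂} {w₁ : W ⟶ W₁}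
    {w₂ : W₁ ⟶ W₂} {v : W ⟶ Z} {v₂ : W₂ ⟶ Z₂} {c : Y ⟶ Z} {m : Z ⟶ Z₂} (hc : d ≫ t ≫ v = c)
    (h₁ : a ≫ t₁ = t ≫ w₁) (h₂ : b ≫ t₂ = t₁ ≫ w₂) (h₃ : v ≫ m = (w₁ ≫ w₂) ≫ v₂) :
    (d ≫ a ≫ b) ≫ t₂ ≫ v₂ = c ≫ m := by
  subst hc
  simp only [Category.assoc, h₃]
  rw [reassoc_of% h₂, reassoc_of% h₁]

theorem conn_naturality {L' : ChainComplex (ModuleCat.{u} k) ℕ}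
    (hL' : ∀ n, Module.Flat k (L'.X n)) (f : L ⟶ L') {M N : ModuleCat.{u} k} (g : M ⟶ N) (n : ℕ) :
    conn L hL M 0 n ≫ homMap f (syzMap g) n = homMap f g (n + 1) ≫ conn L' hL' N 0 n :=
  HomologicalComplex.HomologySequence.δ_naturality (tensSCMap f (syzSCMap g))
    (tensSC_shortExact L hL (syzSC_shortExact M 0))
    (tensSC_shortExact L' hL' (syzSC_shortExact N 0)) (n + 1) n rfl

/-- After the monomorphism into $H_n(L'\otimes K_1)$, with $K_1$ the syzygy of $N$, the maps `uctδ`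
turn into connecting maps. These are natural for the map of syzygy sequences, and the embedding of
$\mathrm{Tor}_1$ is natural in both variables. -/
theorem uctδ_naturality {L' : ChainComplex (ModuleCat.{u} k) ℕ}
    (hL' : ∀ n, Module.Flat k (L'.X n)) (f : L ⟶ L') {M N : ModuleCat.{u} k} (g : M ⟶ N)
    (hM : Module.Flat k (syz M 1)) (hN : Module.Flat k (syz N 1)) (n : ℕ) :
    uctδ L hL M hM n ≫
        ((Tor (ModuleCat.{u} k) 1).map (HomologicalComplex.homologyMap f n)).app M ≫
        ((Tor (ModuleCat.{u} k) 1).obj (L'.homology n)).map g =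
      homMap f g (n + 1) ≫ uctδ L' hL' N hN n := by
  have : Mono (torToSyz (L'.homology n) N 0 ≫ univ L' (syz N 1) n) :=
    (ModuleCat.mono_iff_injective _).2
      (univ_torToSyz_injective L' N hN n)
  refine (cancel_mono (torToSyz (L'.homology n) N 0 ≫ univ L' (syz N 1) n)).1 ?_
  refine Eq.trans ?_ ((Category.assoc _ _ _).trans
    (congrArg (homMap f g (n + 1) ≫ ·) (uctδ_spec L' hL' N hN n))).symm
  refine Eq.trans ?_ (conn_naturality L hL hL' f g n)
  have h := univ_naturality f (syzMap g) n
  rw [MonoidalCategory.tensorHom_def] at h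
  exact comp_eq_of_ladder (uctδ_spec L hL M hM n)
    (torToSyz_naturality_left (HomologicalComplex.homologyMap f n) M)
    (torToSyz_naturality_right (L'.homology n) g) h

end Sequences
end CoefficientHomology

/-! ### Flat and projective tensor powers -/

section Flatness
open TensorProduct
variable {k : Type u} [CommRing k]

theorem TensorPower.flat (V : Type u) [AddCommGroup V] [Module k V] [Module.Flat k V] (n : ℕ) :
    Module.Flat k (⨂[k]^n V) := by
  induction n with
  | zero => exact Module.Flat.of_linearEquiv (PiTensorProduct.isEmptyEquiv (R := k) (Fin 0))
  | succ n ih =>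
    have : Module.Flat k (⨂[k]^1 V) :=
      Module.Flat.of_linearEquiv (PiTensorProduct.subsingletonEquiv (R := k) (0 : Fin 1))
    exact Module.Flat.of_linearEquiv (TensorPower.mulEquiv (R := k) (M := V) (n := n) (m := 1)).symm

theorem TensorPower.projective (V : Type u) [AddCommGroup V] [Module k V] [Module.Projective k V]
    (n : ℕ) : Module.Projective k (⨂[k]^n V) := by
  induction n with
  | zero => exact Module.Projective.of_equiv (PiTensorProduct.isEmptyEquiv (R := k) (Fin 0)).symm
  | succ n ih =>
    have : Module.Projective k (⨂[k]^1 V) :=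
      Module.Projective.of_equiv (PiTensorProduct.subsingletonEquiv (R := k) (0 : Fin 1)).symm
    exact Module.Projective.of_equiv (TensorPower.mulEquiv (R := k) (M := V) (n := n) (m := 1))

namespace InvolutiveAlgebra
open FunctorHomology

theorem flat_complex (A : InvolutiveAlgebra k) (hA : Module.Flat k A) (n : ℕ) :
    Module.Flat k ((complex A.barConstruction).X n) := by
  classical
  have (a : DeltaH) : Module.Flat k (A.barConstruction.obj a) := TensorPower.flat A (a.len + 1)
  exact inferInstanceAs (Module.Flat k (chains A.barConstruction n))

theorem projective_complex (A : InvolutiveAlgebra k) (hA : Module.Projective k A) (n : ℕ) :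
    Module.Projective k ((complex A.barConstruction).X n) := by
  classical
  have (a : DeltaH) : Module.Projective k (A.barConstruction.obj a) :=
    TensorPower.projective A (a.len + 1)
  exact inferInstanceAs (Module.Projective k (chains A.barConstruction n))

end InvolutiveAlgebra
end Flatness

/-! ### Submodules of projective modules over a hereditary ring -/

section Hereditary
variable {k : Type u} [CommRing k]

/-- Over a hereditary ring, quotients of injective modules are injective. -/
theorem IsHereditary.baer_of_surjective (hk : IsHereditary k) {J Q : Type u} [AddCommGroup J]
    [Module k J] [AddCommGroup Q] [Module k Q] (hJ : Module.Baer k J) (f : J →ₗ[k] Q)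
    (hf : Function.Surjective f) : Module.Baer k Q := by
  intro I g
  have := hk I
  obtain ⟨g', hg'⟩ := Module.projective_lifting_property f g hf
  obtain ⟨h, hh⟩ := hJ I g'
  refine ⟨f ∘ₗ h, fun x hx => ?_⟩
  rw [LinearMap.comp_apply, hh x hx, ← LinearMap.comp_apply, hg']

/-- Over a hereditary ring, submodules of projective modules are projective. -/
theorem IsHereditary.projective_of_injective (hk : IsHereditary k) {N P : Type u} [AddCommGroup N]
    [Module k N] [AddCommGroup P] [Module k P] [Module.Projective k P] (i : N →ₗ[k] P)
    (hi : Function.Injective i) : Module.Projective k N := by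
  refine Module.Projective.of_lifting_property'' fun f hf => ?_
  let F := ModuleCat.of k (N →₀ k)
  let J := Injective.under F
  let ι : (N →₀ k) →ₗ[k] J := (Injective.ι F).hom
  have hι : Function.Injective ι := (ModuleCat.mono_iff_injective (Injective.ι F)).1 inferInstance
  have hJ : Module.Baer k J := Module.Baer.of_injective
    ((Module.injective_iff_injective_object k J).2 (Injective.injective_under F))
  -- As $F/\ker f\cong N$, the module $N$ maps to the injective module $J/K$; this map extends to
  -- $P$ and lifts to $P\to J$. On $N$ the lift takes values in $\iota(F)$, because
  -- $K\subseteq\iota(F)$, and so gives a section of `f`.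
  let K := (LinearMap.ker f).map ι
  have hQ := hk.baer_of_surjective hJ K.mkQ K.mkQ_surjective
  let e : N →ₗ[k] J ⧸ K := f.descend hf (K.mkQ ∘ₗ ι) fun v hv =>
    (Submodule.Quotient.mk_eq_zero _).2 ⟨v, hv, rfl⟩
  obtain ⟨e', he'⟩ := Module.Baer.extension_property hQ i hi e
  obtain ⟨e'', he''⟩ := Module.projective_lifting_property K.mkQ e' K.mkQ_surjective
  have key (n : N) : ∃ x, ι x = e'' (i n) ∧ f x = n := by
    obtain ⟨v, rfl⟩ := hf n
    have h : K.mkQ (e'' (i (f v))) = K.mkQ (ι v) := by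
      rw [← LinearMap.comp_apply, he'', ← LinearMap.comp_apply, he']
      exact LinearMap.descend_apply _ _ _ _ v
    obtain ⟨w, hw, hw'⟩ := (Submodule.Quotient.eq K).1 h
    refine ⟨v + w, ?_, ?_⟩
    · rw [map_add, hw', add_sub_cancel]
    · rw [map_add, LinearMap.mem_ker.1 hw, add_zero]
  choose s hs hs' using key
  exact ⟨{ toFun := s
           map_add' := fun a b => hι (by rw [hs, map_add, map_add, map_add, hs, hs])
           map_smul' := fun c a => hι ((hs (c • a)).trans (by
             rw [map_smul, map_smul, ← hs]
             exact (map_smul ι c (s a)).symm)) },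
    LinearMap.ext hs'⟩

end Hereditary

/-! ### Splitting over a hereditary ring -/

namespace CoefficientHomology
open MonoidalCategory TensorProduct
variable {k : Type u} [CommRing k]

/-- The image of the outgoing differential is a submodule of a projective module, hence projective.
So the cycles are a direct summand; project onto them and take classes. -/
theorem _root_.IsHereditary.exists_extend_cls (hk : IsHereditary k)
    (S : ShortComplex (ModuleCat.{u} k)) (hS : Module.Projective k S.X₃) :
    ∃ h : S.X₂ →ₗ[k] S.homology, ∀ z : LinearMap.ker S.g.hom, h z.1 = S.cls z := by
  have : Module.Projective k (LinearMap.range S.g.hom) :=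
    hk.projective_of_injective (LinearMap.range S.g.hom).subtype (Submodule.subtype_injective _)
  obtain ⟨s, hs⟩ := S.g.hom.rangeRestrict.exists_rightInverse_of_surjective
    (LinearMap.range_eq_top.2 S.g.hom.surjective_rangeRestrict)
  have hr (x : S.X₂) : S.g.hom (s (S.g.hom.rangeRestrict x)) = S.g.hom x :=
    congrArg Subtype.val (DFunLike.congr_fun hs (S.g.hom.rangeRestrict x))
  refine ⟨S.cls ∘ₗ LinearMap.codRestrict (LinearMap.ker S.g.hom)
    (LinearMap.id - s ∘ₗ S.g.hom.rangeRestrict) fun x => ?_, fun z => ?_⟩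
  · rw [LinearMap.mem_ker]
    exact (map_sub S.g.hom _ _).trans (sub_eq_zero.2 (hr x).symm)
  · refine congrArg S.cls (Subtype.ext ?_)
    have : S.g.hom.rangeRestrict z.1 = 0 := Subtype.ext z.2
    change z.1 - s (S.g.hom.rangeRestrict z.1) = z.1
    rw [this, map_zero, sub_zero]

/-- Over a hereditary ring the universal coefficient map of a projective complex is a split
monomorphism. -/
theorem _root_.IsHereditary.exists_retraction_univ (hk : IsHereditary k)
    (L : ChainComplex (ModuleCat.{u} k) ℕ) (hL : ∀ n, Module.Projective k (L.X n))
    (M : ModuleCat.{u} k) (n : ℕ) :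
    ∃ r : (tensObj L M).homology n ⟶ L.homology n ⊗ M, univ L M n ≫ r = 𝟙 _ := by
  -- An extension of the class map to all chains kills boundaries, so $h\otimes M$ descends to
  -- $H_n(L\otimes M)$ and sends $[z\otimes m]$ to $[z]\otimes m$.
  obtain ⟨h, hh⟩ := hk.exists_extend_cls (L.sc n) (hL _)
  have h0 (y : (L.sc n).X₁) : h ((L.sc n).f y) = 0 := by
    have hy : (L.sc n).f y ∈ LinearMap.ker (L.sc n).g.hom := (L.sc n).moduleCat_zero_apply y
    exact (hh ⟨_, hy⟩).trans ((ShortComplex.cls_eq_zero_iff _ _).2 ⟨y, rfl⟩)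
  have hf : h.rTensor M ∘ₗ (L.sc n).f.hom.rTensor M = 0 := by
    rw [← LinearMap.rTensor_comp, show h ∘ₗ (L.sc n).f.hom = 0 from LinearMap.ext h0,
      LinearMap.rTensor_zero]
  let ρ : (tensObj L M).homology n →ₗ[k] (L.homology n : Type u) ⊗[k] M :=
    LinearMap.descend ((tensObj L M).sc n).cls (ShortComplex.cls_surjective _)
      (h.rTensor M ∘ₗ (LinearMap.ker ((tensObj L M).sc n).g.hom).subtype) fun z hz => by
        obtain ⟨y, hy⟩ := (ShortComplex.cls_eq_zero_iff _ z).1 hz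
        exact (congrArg (h.rTensor M) hy.symm).trans (DFunLike.congr_fun hf y)
  refine ⟨ModuleCat.ofHom ρ, ?_⟩
  refine ModuleCat.hom_ext (TensorProduct.ext' fun x m => ?_)
  obtain ⟨z, rfl⟩ := ShortComplex.cls_surjective _ x
  have hz := ShortComplex.mem_ker_of_hom
    ((HomologicalComplex.shortComplexFunctor _ _ n).map (tmulRight L m)) z
  refine (congrArg ρ (univ_cls L M n (z ⊗ₜ m) hz)).trans ?_
  refine (LinearMap.descend_apply _ _ _ _ _).trans ?_
  exact congrArg (· ⊗ₜ[k] m) (hh z)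

end CoefficientHomology

/-! ### The spectral sequence and the sequences for hyperoctahedral homology -/

section Theorem
open MonoidalCategory CoefficientHomology FunctorHomology
variable {k : Type u} [CommRing k]

/-- `HO_n(A)` as the homology of the Gabriel-Zisman complex. -/
noncomputable abbrev HOIso (A : InvolutiveAlgebra k) (n : ℕ) :
    HO A n ≅ (complex A.barConstruction).homology n :=
  functorTorIso n A.barConstruction

theorem HOIso_naturality {A B : InvolutiveAlgebra k} (φ : A →⋆ₐ[k] B) (n : ℕ) :
    HOMap φ n ≫ (HOIso B n).hom = (HOIso A n).hom ≫
      HomologicalComplex.homologyMap (complexMap (InvolutiveAlgebra.barConstructionMap φ)) n :=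
  functorTorIso_naturality n _

/-- The universal coefficient spectral sequence of a flat involutive algebra. -/
noncomputable def universalCoefficientSpectralSequence (A : InvolutiveAlgebra k)
    (hA : Module.Flat k A) (M : ModuleCat.{u} k) : UniversalCoefficientSpectralSequence A M where
  E := (couple (complex A.barConstruction) (A.flat_complex hA) M).spectralSequence
  pageTwo p q := couplePageTwo (complex A.barConstruction) (A.flat_complex hA) M p q (HOIso A q)
  converges := (couple (complex A.barConstruction) (A.flat_complex hA) M).convergesTo

/-- The universal coefficient map `HO_n(A) ⊗ M ⟶ HO_n(A; M)`. -/
noncomputable def HOuniv (A : InvolutiveAlgebra k) (M : ModuleCat.{u} k) (n : ℕ) :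
    HO A n ⊗ M ⟶ HOCoeff A M n :=
  (HOIso A n).hom ▷ M ≫ univ (complex A.barConstruction) M n

theorem range_HOuniv (A : InvolutiveAlgebra k) (hA : Module.Flat k A) (M : ModuleCat.{u} k)
    (n : ℕ) : LinearMap.range (HOuniv A M n).hom =
      (universalCoefficientSpectralSequence A hA M).converges.filtration n 0 := by
  have h₁ : LinearMap.range ((HOIso A n).hom ▷ M).hom = ⊤ :=
    LinearMap.range_eq_top.2 ((ConcreteCategory.isIso_iff_bijective _).1 inferInstance).2
  have h₂ : LinearMap.range (HOuniv A M n).hom =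
      LinearMap.range (univ (complex A.barConstruction) M n).hom :=
    LinearMap.range_comp_of_range_eq_top _ h₁
  refine h₂.trans ((range_univ (complex A.barConstruction) M n).trans ?_)
  exact ((couple (complex A.barConstruction) (A.flat_complex hA) M).filtration_zero n).symm

theorem HOuniv_naturality {A B : InvolutiveAlgebra k} (φ : A →⋆ₐ[k] B) {M N : ModuleCat.{u} k}
    (g : M ⟶ N) (n : ℕ) :
    HOuniv A M n ≫ HOCoeffMap φ g n = (HOMap φ n ⊗ₘ g) ≫ HOuniv B N n := by
  have h := univ_naturality (complexMap (InvolutiveAlgebra.barConstructionMap φ)) g n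
  have h' := HOIso_naturality φ n
  refine (Category.assoc _ _ _).trans ((congrArg ((HOIso A n).hom ▷ M ≫ ·) h).trans ?_)
  refine (Category.assoc _ _ _).symm.trans (Eq.trans ?_ (Category.assoc _ _ _))
  refine congrArg (· ≫ univ (complex B.barConstruction) N n) ?_
  rw [← tensorHom_id, ← tensorHom_id, tensorHom_comp_tensorHom, tensorHom_comp_tensorHom, ← h',
    Category.id_comp, Category.comp_id]

variable (hk : weakGlobalDimension k ≤ 1)

/-- The map `HO_{n+1}(A; M) ⟶ Tor_1(HO_n(A), M)`. -/
noncomputable def HOδ (A : InvolutiveAlgebra k) (hA : Module.Flat k A) (M : ModuleCat.{u} k)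
    (n : ℕ) : HOCoeff A M (n + 1) ⟶ ((Tor (ModuleCat.{u} k) 1).obj (HO A n)).obj M :=
  uctδ (complex A.barConstruction) (A.flat_complex hA) M (flat_syz_one hk M) n ≫
    ((Tor (ModuleCat.{u} k) 1).map (HOIso A n).inv).app M

theorem HOδ_naturality {A B : InvolutiveAlgebra k} (hA : Module.Flat k A) (hB : Module.Flat k B)
    (φ : A →⋆ₐ[k] B) {M N : ModuleCat.{u} k} (g : M ⟶ N) (n : ℕ) :
    HOδ hk A hA M n ≫ ((Tor (ModuleCat.{u} k) 1).map (HOMap φ n)).app M ≫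
        ((Tor (ModuleCat.{u} k) 1).obj (HO B n)).map g =
      HOCoeffMap φ g (n + 1) ≫ HOδ hk B hB N n := by
  have h := uctδ_naturality (complex A.barConstruction) (A.flat_complex hA)
    (B.flat_complex hB) (complexMap (InvolutiveAlgebra.barConstructionMap φ)) g
    (flat_syz_one hk M) (flat_syz_one hk N) n
  have h' : (HOIso A n).inv ≫ HOMap φ n = HomologicalComplex.homologyMap
      (complexMap (InvolutiveAlgebra.barConstructionMap φ)) n ≫ (HOIso B n).inv := by
    rw [Iso.inv_comp_eq, ← Category.assoc, ← HOIso_naturality φ n, Category.assoc,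
      Iso.hom_inv_id, Category.comp_id]
  have h'' := congrArg (fun f => ((Tor (ModuleCat.{u} k) 1).map f).app M) h'
  simp only [Functor.map_comp, NatTrans.comp_app] at h''
  refine Eq.trans ?_ (Category.assoc _ _ _)
  refine Eq.trans ?_ (congrArg
    (· ≫ ((Tor (ModuleCat.{u} k) 1).map (HOIso B n).inv).app N) h)
  refine (Category.assoc _ _ _).trans (Eq.trans ?_ (Category.assoc _ _ _).symm)
  refine congrArg (uctδ _ _ M _ n ≫ ·) ?_
  refine (Category.assoc _ _ _).symm.trans ((congrArg
    (· ≫ ((Tor (ModuleCat.{u} k) 1).obj (HO B n)).map g) h'').trans ?_)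
  refine (Category.assoc _ _ _).trans (Eq.trans ?_ (Category.assoc _ _ _).symm)
  refine congrArg (((Tor (ModuleCat.{u} k) 1).map _).app M ≫ ·) ?_
  exact (((Tor (ModuleCat.{u} k) 1).map (HOIso B n).inv).naturality g).symm

/-- `Tor_1(HO_n(A), M)` from the Gabriel-Zisman complex. -/
noncomputable abbrev torHOIso (A : InvolutiveAlgebra k) (M : ModuleCat.{u} k) (n : ℕ) :
    ((Tor (ModuleCat.{u} k) 1).obj ((complex A.barConstruction).homology n)).obj M ≅
      ((Tor (ModuleCat.{u} k) 1).obj (HO A n)).obj M :=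
  ((Tor (ModuleCat.{u} k) 1).mapIso (HOIso A n).symm).app M

theorem HOuniv_injective (A : InvolutiveAlgebra k) (hA : Module.Flat k A) (M : ModuleCat.{u} k)
    (hM : Module.Flat k (syz M 1)) (n : ℕ) : Function.Injective (HOuniv A M n) :=
  (univ_injective _ M (A.flat_complex hA) hM n).comp
    ((ConcreteCategory.isIso_iff_bijective ((HOIso A n).hom ▷ M)).1 inferInstance).1

theorem HO_exact (A : InvolutiveAlgebra k) (hA : Module.Flat k A) (M : ModuleCat.{u} k)
    (n : ℕ) : Function.Exact (HOuniv A M (n + 1)) (HOδ hk A hA M n) := by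
  have hi : Function.Injective (torHOIso A M n).hom :=
    ((ConcreteCategory.isIso_iff_bijective (torHOIso A M n).hom).1 inferInstance).1
  have hs : Function.Surjective ((HOIso A (n + 1)).hom ▷ M) :=
    ((ConcreteCategory.isIso_iff_bijective _).1 inferInstance).2
  intro y
  refine (map_eq_zero_iff (torHOIso A M n).hom.hom hi).trans ?_
  refine (univ_exact _ (A.flat_complex hA) M (flat_syz_one hk M) n y).trans ?_
  constructor
  · rintro ⟨x, rfl⟩
    obtain ⟨z, rfl⟩ := hs x
    exact ⟨z, rfl⟩
  · rintro ⟨z, rfl⟩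
    exact ⟨_, rfl⟩

theorem HOδ_surjective (A : InvolutiveAlgebra k) (hA : Module.Flat k A) (M : ModuleCat.{u} k)
    (n : ℕ) : Function.Surjective (HOδ hk A hA M n) :=
  ((ConcreteCategory.isIso_iff_bijective (torHOIso A M n).hom).1 inferInstance).2.comp
    (uctδ_surjective _ (A.flat_complex hA) M (flat_syz_one hk M) n)

/-- The universal coefficient sequences over a ring of weak global dimension at most one. -/
noncomputable def universalCoefficientSequences : UniversalCoefficientSequences k where
  ι A _ M n := HOuniv A M n
  δ A hA M n := HOδ hk A hA M n
  isIso_zero A hA M := (ConcreteCategory.isIso_iff_bijective _).2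
    ⟨HOuniv_injective A hA M (flat_syz_one hk M) 0,
      (univ_surjective_zero (complex A.barConstruction) M).comp
        ((ConcreteCategory.isIso_iff_bijective ((HOIso A 0).hom ▷ M)).1 inferInstance).2⟩
  comp_zero A hA M n := ModuleCat.hom_ext (LinearMap.ext fun x =>
    (HO_exact hk A hA M n).apply_apply_eq_zero x)
  shortExact A hA M n :=
    { exact := (ShortComplex.ShortExact.moduleCat_exact_iff_function_exact _).2
        (HO_exact hk A hA M n)
      mono_f := (ModuleCat.mono_iff_injective _).2
        (HOuniv_injective A hA M (flat_syz_one hk M) (n + 1))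
      epi_g := (ModuleCat.epi_iff_surjective _).2 (HOδ_surjective hk A hA M n) }
  ι_naturality _ _ φ _ _ g n := HOuniv_naturality φ g n
  δ_naturality hA hB φ _ _ g n := HOδ_naturality hk hA hB φ g n

theorem IsHereditary.nonempty_splitting (hk' : IsHereditary k) (A : InvolutiveAlgebra k)
    (hA : Module.Flat k A) (hA' : Module.Projective k A) (M : ModuleCat.{u} k) (n : ℕ) :
    Nonempty ((universalCoefficientSequences hk).sequence A hA M n).Splitting := by
  obtain ⟨r, hr⟩ := hk'.exists_retraction_univ (complex A.barConstruction)
    (A.projective_complex hA') M (n + 1)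
  have h := (universalCoefficientSequences hk).shortExact A hA M n
  refine ⟨ShortComplex.Splitting.ofExactOfRetraction _ h.exact
    (r ≫ (HOIso A (n + 1)).inv ▷ M) ?_ h.epi_g⟩
  refine (Category.assoc _ _ _).trans ((congrArg ((HOIso A (n + 1)).hom ▷ M ≫ ·) ?_).trans
    (hom_inv_whiskerRight (HOIso A (n + 1)) M))
  exact (Category.assoc _ _ _).symm.trans
    ((congrArg (· ≫ (HOIso A (n + 1)).inv ▷ M) hr).trans (Category.id_comp _))

end Theorem

/-! ### Hereditary rings have weak global dimension at most one -/

section GlobalDimension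
open MonoidalCategory CoefficientHomology
variable {k : Type u} [CommRing k]

/-- The syzygy $K_{n+1}\subseteq P_n$ is projective, so $K_{n+2}\to P_{n+1}$ is a split injection
and stays injective after tensoring; hence $\mathrm{Tor}_{n+2}$ vanishes. -/
theorem IsHereditary.weakGlobalDimension_le_one (hk : IsHereditary k) :
    weakGlobalDimension k ≤ 1 := by
  refine sSup_le ?_
  rintro _ ⟨n, rfl, X, M, h⟩
  obtain _ | _ | n := n
  · exact zero_le
  · exact le_rfl
  · refine absurd ((isZero_tor_iff X M (n + 1)).2 ?_) h
    have hi : Function.Injective (syzι M n) := (ModuleCat.mono_iff_injective _).1 inferInstance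
    have hp : Module.Projective k (syz M (n + 1)) :=
      hk.projective_of_injective (syzι M n).hom hi
    have hp' : Projective (syzSC M (n + 1)).X₃ := (IsProjective.iff_projective _).1 hp
    let σ := (syzSC_shortExact M (n + 1)).splittingOfProjective
    have : X ◁ syzι M (n + 1) ≫ X ◁ σ.r = 𝟙 _ := by
      rw [← whiskerLeft_comp]
      exact (congrArg (X ◁ ·) σ.f_r).trans (whiskerLeft_id _ _)
    exact Function.LeftInverse.injective fun x => ConcreteCategory.congr_hom this x

theorem isHereditary_of_isPrincipalIdealRing [IsDomain k] [IsPrincipalIdealRing k] :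
    IsHereditary k := fun _ => inferInstance

instance : IsDomain (ULift.{u} ℤ) := (ULift.ringEquiv (R := ℤ)).toMulEquiv.isDomain _

instance : IsPrincipalIdealRing (ULift.{u} ℤ) :=
  IsPrincipalIdealRing.of_surjective (ULift.ringEquiv (R := ℤ)).symm.toRingHom
    (ULift.ringEquiv (R := ℤ)).symm.surjective

end GlobalDimension

/-! ### The Heisenberg algebras and their involution -/

/-- The Heisenberg algebra with basis `1, x, y, z` and `x y = c z = - y x`. -/
@[ext]
structure Heis (k : Type u) (c : k) where
  a : k
  x : k
  y : k
  z : k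

namespace Heis
variable {k : Type u} [CommRing k] {c : k}

instance : Zero (Heis k c) := ⟨⟨0, 0, 0, 0⟩⟩
instance : One (Heis k c) := ⟨⟨1, 0, 0, 0⟩⟩
instance : Add (Heis k c) := ⟨fun u v => ⟨u.a + v.a, u.x + v.x, u.y + v.y, u.z + v.z⟩⟩
instance : Neg (Heis k c) := ⟨fun u => ⟨-u.a, -u.x, -u.y, -u.z⟩⟩
instance : SMul k (Heis k c) := ⟨fun r u => ⟨r * u.a, r * u.x, r * u.y, r * u.z⟩⟩
instance : Mul (Heis k c) := ⟨fun u v => ⟨u.a * v.a, u.a * v.x + u.x * v.a, u.a * v.y + u.y * v.a,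
  u.a * v.z + u.z * v.a + c * (u.x * v.y - u.y * v.x)⟩⟩
-- The sign on `x` alone compensates the reversal of order: the involution of $xy$ is $y(-x)=xy$, in
-- accordance with `z` being fixed.
instance : Star (Heis k c) := ⟨fun u => ⟨u.a, -u.x, u.y, u.z⟩⟩

@[simp] theorem zero_a : (0 : Heis k c).a = 0 := rfl
@[simp] theorem zero_x : (0 : Heis k c).x = 0 := rfl
@[simp] theorem zero_y : (0 : Heis k c).y = 0 := rfl
@[simp] theorem zero_z : (0 : Heis k c).z = 0 := rfl
@[simp] theorem one_a : (1 : Heis k c).a = 1 := rfl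
@[simp] theorem one_x : (1 : Heis k c).x = 0 := rfl
@[simp] theorem one_y : (1 : Heis k c).y = 0 := rfl
@[simp] theorem one_z : (1 : Heis k c).z = 0 := rfl
@[simp] theorem add_a (u v : Heis k c) : (u + v).a = u.a + v.a := rfl
@[simp] theorem add_x (u v : Heis k c) : (u + v).x = u.x + v.x := rfl
@[simp] theorem add_y (u v : Heis k c) : (u + v).y = u.y + v.y := rfl
@[simp] theorem add_z (u v : Heis k c) : (u + v).z = u.z + v.z := rfl
@[simp] theorem neg_a (u : Heis k c) : (-u).a = -u.a := rfl
@[simp] theorem neg_x (u : Heis k c) : (-u).x = -u.x := rfl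
@[simp] theorem neg_y (u : Heis k c) : (-u).y = -u.y := rfl
@[simp] theorem neg_z (u : Heis k c) : (-u).z = -u.z := rfl
@[simp] theorem smul_a (r : k) (u : Heis k c) : (r • u).a = r * u.a := rfl
@[simp] theorem smul_x (r : k) (u : Heis k c) : (r • u).x = r * u.x := rfl
@[simp] theorem smul_y (r : k) (u : Heis k c) : (r • u).y = r * u.y := rfl
@[simp] theorem smul_z (r : k) (u : Heis k c) : (r • u).z = r * u.z := rfl
@[simp] theorem mul_a (u v : Heis k c) : (u * v).a = u.a * v.a := rfl
@[simp] theorem mul_x (u v : Heis k c) : (u * v).x = u.a * v.x + u.x * v.a := rfl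
@[simp] theorem mul_y (u v : Heis k c) : (u * v).y = u.a * v.y + u.y * v.a := rfl
@[simp] theorem mul_z (u v : Heis k c) :
    (u * v).z = u.a * v.z + u.z * v.a + c * (u.x * v.y - u.y * v.x) := rfl
@[simp] theorem star_a (u : Heis k c) : (star u).a = u.a := rfl
@[simp] theorem star_x (u : Heis k c) : (star u).x = -u.x := rfl
@[simp] theorem star_y (u : Heis k c) : (star u).y = u.y := rfl
@[simp] theorem star_z (u : Heis k c) : (star u).z = u.z := rfl

instance : Ring (Heis k c) where
  add_assoc u v w := by ext <;> simp <;> ring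
  zero_add u := by ext <;> simp
  add_zero u := by ext <;> simp
  add_comm u v := by ext <;> simp <;> ring
  left_distrib u v w := by ext <;> simp <;> ring
  right_distrib u v w := by ext <;> simp <;> ring
  zero_mul u := by ext <;> simp
  mul_zero u := by ext <;> simp
  mul_assoc u v w := by ext <;> simp <;> ring
  one_mul u := by ext <;> simp
  mul_one u := by ext <;> simp
  neg_add_cancel u := by ext <;> simp
  nsmul := nsmulRec
  zsmul := zsmulRec

instance : Module k (Heis k c) where
  one_smul u := by ext <;> simp
  mul_smul r s u := by ext <;> simp <;> ring
  smul_zero r := by ext <;> simp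
  smul_add r u v := by ext <;> simp <;> ring
  add_smul r s u := by ext <;> simp <;> ring
  zero_smul u := by ext <;> simp

instance : Algebra k (Heis k c) :=
  Algebra.ofModule (fun r u v => by ext <;> simp; all_goals ring)
    fun r u v => by ext <;> simp; all_goals ring

instance : StarRing (Heis k c) where
  star_involutive u := by ext <;> simp
  star_mul u v := by ext <;> simp <;> ring
  star_add u v := by ext <;> simp; ring

/-- The coordinates. -/
def equivProd (c : k) : Heis k c ≃ₗ[k] k × k × k × k where
  toFun u := (u.a, u.x, u.y, u.z)
  invFun v := ⟨v.1, v.2.1, v.2.2.1, v.2.2.2⟩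
  map_add' _ _ := rfl
  map_smul' _ _ := rfl
  left_inv _ := rfl
  right_inv _ := rfl

instance : Module.Projective k (Heis k c) := Module.Projective.of_equiv (equivProd c).symm

variable (k) in
/-- The Heisenberg algebra with the involution `x ↦ -x`, `y ↦ y`, `z ↦ z`. -/
def involutive (c : k) : InvolutiveAlgebra k where
  carrier := Heis k c
  star_smul r u := by ext <;> simp

/-- The linear map that multiplies the coordinate `z` by `l`. -/
def scale (c c' l : k) : Heis k c →ₗ[k] Heis k c' where
  toFun u := ⟨u.a, u.x, u.y, l * u.z⟩
  map_add' u v := by ext <;> simp; ring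
  map_smul' r u := by ext <;> simp; ring

@[simp] theorem scale_a (c c' l : k) (u : Heis k c) : (scale c c' l u).a = u.a := rfl
@[simp] theorem scale_x (c c' l : k) (u : Heis k c) : (scale c c' l u).x = u.x := rfl
@[simp] theorem scale_y (c c' l : k) (u : Heis k c) : (scale c c' l u).y = u.y := rfl
@[simp] theorem scale_z (c c' l : k) (u : Heis k c) : (scale c c' l u).z = l * u.z := rfl

/-- Multiplication of the coordinate `z`, as a map of star algebras. -/
def scaleStarHom {c c' : k} (l : k) (h : l * c = c') : Heis k c →⋆ₐ[k] Heis k c' where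
  toFun := scale c c' l
  map_one' := by ext <;> simp
  map_mul' u v := by
    subst h
    ext <;> simp
    ring
  map_zero' := map_zero (scale c c' l)
  map_add' := map_add (scale c c' l)
  commutes' r := by
    rw [Algebra.algebraMap_eq_smul_one, Algebra.algebraMap_eq_smul_one]
    refine (map_smul (scale c c' l) r 1).trans (congrArg (r • ·) ?_)
    ext <;> simp
  map_star' u := by ext <;> simp

/-- Multiplication of the coordinate `z`, as a map of involutive algebras. -/
def scaleHom {c c' : k} (l : k) (h : l * c = c') : involutive k c →⋆ₐ[k] involutive k c' :=
  scaleStarHom l h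

end Heis

/-! ### The weight and the cocycle of the deformation -/

namespace Heis
open TensorProduct TrivSqZeroExt
variable {k : Type u} [CommRing k] {c : k}

/-- The dual number `a + z ε`. -/
def dual (c : k) : Heis k c →ₗ[k] DualNumber k where
  toFun u := inl u.a + inr u.z
  map_add' u v := by ext <;> simp
  map_smul' r u := by ext <;> simp

@[simp] theorem fst_dual (u : Heis k c) : (dual c u).fst = u.a := by simp [dual]
@[simp] theorem snd_dual (u : Heis k c) : (dual c u).snd = u.z := by simp [dual]

theorem dual_star (u : Heis k c) : dual c (star u) = dual c u := by ext <;> simp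

/-- For $c=0$ the error term vanishes and `dual` is multiplicative with values in a commutative
ring. The cocycle below measures the failure for $c=1$. -/
theorem dual_mul (u v : Heis k c) :
    dual c (u * v) = dual c u * dual c v + inr (c * (u.x * v.y - u.y * v.x)) := by
  ext <;> simp

theorem mul_congr_of_fst {X X' D : DualNumber k} (hX : X.fst = X'.fst) (hD : D.fst = 0) :
    X * D = X' * D := by
  ext <;> simp [hX, hD]

/-- The failure of `dual` to be multiplicative on a list. -/
def defect (l : List (Heis k c)) : DualNumber k := dual c l.prod - (l.map (dual c)).prod

theorem defect_cons (u : Heis k c) (l : List (Heis k c)) :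
    defect (u :: l) = dual c u * defect l + inr (c * (u.x * l.prod.y - u.y * l.prod.x)) := by
  simp only [defect, List.prod_cons, List.map_cons, dual_mul]
  ring

theorem fst_defect (l : List (Heis k c)) : (defect l).fst = 0 := by
  induction l with
  | nil => simp [defect]
  | cons u l ih => simp [defect_cons, ih]

/-- The defect is built from the coordinates `x`, `y` and from products of multiples of
$\varepsilon$ with dual numbers, which see only the coordinate `a`. It never sees `z`. -/
theorem defect_map (f : Heis k c → Heis k c) (ha : ∀ u, (f u).a = u.a) (hx : ∀ u, (f u).x = u.x)
    (hy : ∀ u, (f u).y = u.y) (l : List (Heis k c)) :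
    defect (l.map f) = defect l ∧ (l.map f).prod.a = l.prod.a ∧ (l.map f).prod.x = l.prod.x ∧
      (l.map f).prod.y = l.prod.y := by
  induction l with
  | nil => simp
  | cons u l ih =>
    obtain ⟨h, h₁, h₂, h₃⟩ := ih
    refine ⟨?_, by simp [ha, h₁], by simp [ha, hx, h₁, h₂], by simp [ha, hy, h₁, h₃]⟩
    rw [List.map_cons, defect_cons, defect_cons, h, h₂, h₃, hx, hy,
      mul_congr_of_fst (X' := dual c u) (by simp [ha]) (fst_defect l)]

/-- Each $E_i$ is a multiple of $\varepsilon$ and $\varepsilon^2=0$, so only the constant terms of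
the other factors matter. The last two clauses carry the induction. -/
theorem prod_add_sub_prod_congr {ι : Type*} (s : Finset ι) (P P' E : ι → DualNumber k)
    (hP : ∀ i, (P i).fst = (P' i).fst) (hE : ∀ i, (E i).fst = 0) :
    ∏ i ∈ s, (P i + E i) - ∏ i ∈ s, P i = ∏ i ∈ s, (P' i + E i) - ∏ i ∈ s, P' i ∧
      (∏ i ∈ s, (P i + E i) - ∏ i ∈ s, P i).fst = 0 ∧
      (∏ i ∈ s, (P i + E i)).fst = (∏ i ∈ s, (P' i + E i)).fst := by
  classical
  induction s using Finset.induction_on with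
  | empty => simp
  | insert i s hi ih =>
    obtain ⟨h₁, h₂, h₃⟩ := ih
    have key (Q : ι → DualNumber k) : ∏ j ∈ insert i s, (Q j + E j) - ∏ j ∈ insert i s, Q j =
        Q i * (∏ j ∈ s, (Q j + E j) - ∏ j ∈ s, Q j) + (∏ j ∈ s, (Q j + E j)) * E i := by
      rw [Finset.prod_insert hi, Finset.prod_insert hi]
      ring
    rw [key, key, ← h₁]
    refine ⟨?_, by simp [h₂, hE], ?_⟩
    · rw [mul_congr_of_fst (hP i) h₂, mul_congr_of_fst h₃ (hE i)]
    · rw [Finset.prod_insert hi, Finset.prod_insert hi, fst_mul, fst_mul, h₃]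
      simp [hP, hE]

/-- The map $\varepsilon\mapsto l\varepsilon$ is an endomorphism of the dual numbers. -/
theorem prod_dual_scale {ι : Type*} (s : Finset ι) (P P' : ι → DualNumber k) (l : k)
    (h₁ : ∀ i, (P' i).fst = (P i).fst) (h₂ : ∀ i, (P' i).snd = l * (P i).snd) :
    (∏ i ∈ s, P' i).fst = (∏ i ∈ s, P i).fst ∧ (∏ i ∈ s, P' i).snd = l * (∏ i ∈ s, P i).snd := by
  classical
  induction s using Finset.induction_on with
  | empty => simp
  | insert i s hi ih =>
    rw [Finset.prod_insert hi, Finset.prod_insert hi]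
    simp only [fst_mul, snd_mul, h₁, h₂, ih.1, ih.2, smul_eq_mul, MulOpposite.smul_eq_mul_unop,
      MulOpposite.unop_op]
    refine ⟨trivial, by ring⟩

/-- The objects of the bar construction. -/
abbrev power (c : k) (a : DeltaH) : Type u :=
  ⨂[k] _ : Fin (a.len + 1), (involutive k c : Type u)

/-- The coefficient of `ε` in the product of the dual numbers of the factors. -/
noncomputable def weight (c : k) (a : DeltaH) : power c a →ₗ[k] k :=
  sndHom k k ∘ₗ PiTensorProduct.lift
    ((MultilinearMap.mkPiAlgebra k (Fin (a.len + 1)) (DualNumber k)).compLinearMap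
      fun _ => dual c)

theorem weight_tprod (a : DeltaH) (x : Fin (a.len + 1) → Heis k c) :
    weight c a (PiTensorProduct.tprod k x) = (∏ i, dual c (x i)).snd := by
  refine (congrArg snd (PiTensorProduct.lift.tprod _)).trans ?_
  rfl

/-- The action of a morphism on the bar construction. -/
noncomputable abbrev act (c : k) {a b : DeltaH} (f : a ⟶ b) : power c a →ₗ[k] power c b :=
  ((involutive k c).barConstruction.map f).hom

theorem act_tprod {a b : DeltaH} (f : a ⟶ b) (x : Fin (a.len + 1) → Heis k c) :
    act c f (PiTensorProduct.tprod k x) =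
      PiTensorProduct.tprod k ((involutive k c).word f x) :=
  PiTensorProduct.lift.tprod _

theorem act_comp {a b d : DeltaH} (f : a ⟶ b) (g : b ⟶ d) (t : power c a) :
    act c (f ≫ g) t = act c g (act c f t) :=
  ConcreteCategory.congr_hom ((involutive k c).barConstruction.map_comp f g) t

/-- The action of the labels. -/
def twist (z : ℤˣ) (u : Heis k c) : Heis k c := (involutive k c).twist z u

theorem twist_eq (z : ℤˣ) (u : Heis k c) : twist z u = if z = 1 then u else star u := rfl

theorem dual_twist (z : ℤˣ) (u : Heis k c) : dual c (twist z u) = dual c u := by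
  rw [twist_eq]
  split_ifs
  · rfl
  · exact dual_star u

theorem scale_twist (l : k) (z : ℤˣ) (u : Heis k c) :
    scale c c l (twist z u) = twist z (scale c c l u) := by
  rw [twist_eq, twist_eq]
  split_ifs
  · rfl
  · ext <;> simp

theorem scale_scale (c c' c'' l l' : k) (u : Heis k c) :
    scale c' c'' l' (scale c c' l u) = scale c c'' (l' * l) u := by
  ext <;> simp [mul_assoc]

/-- The twisted elements of a fibre, in order. -/
def fibreList {a b : DeltaH} (f : a ⟶ b) (x : Fin (a.len + 1) → Heis k c) (j : Fin (b.len + 1)) :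
    List (Heis k c) :=
  (InvolutiveAlgebra.fibre f j).map fun i => twist (f.grp.label i) (x i)

/-- Dual numbers commute and `dual` ignores the involution, so neither the order in the fibres nor
the labels matter. -/
theorem prod_fibreList {a b : DeltaH} (f : a ⟶ b) (x : Fin (a.len + 1) → Heis k c) :
    ∏ j, ((fibreList f x j).map (dual c)).prod = ∏ i, dual c (x i) := by
  rw [← Finset.prod_fiberwise Finset.univ f.toFun]
  refine Finset.prod_congr rfl fun j _ => ?_
  have h : Finset.univ.filter (fun i => f.toFun i = j) =
      (InvolutiveAlgebra.fibre f j).toFinset := by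
    ext i
    rw [List.mem_toFinset, InvolutiveAlgebra.mem_fibre]
    simp
  rw [h, List.prod_toFinset _ (InvolutiveAlgebra.fibre_nodup f j), fibreList, List.map_map]
  congr 1
  exact List.map_congr_left fun i _ => dual_twist _ _

/-- The change of the weight under a morphism. -/
noncomputable def weightChange (c : k) {a b : DeltaH} (f : a ⟶ b) : power c a →ₗ[k] k :=
  weight c b ∘ₗ act c f - weight c a

theorem weightChange_apply {a b : DeltaH} (f : a ⟶ b) (t : power c a) :
    weightChange c f t = weight c b (act c f t) - weight c a t := rfl

theorem weightChange_tprod {a b : DeltaH} (f : a ⟶ b) (x : Fin (a.len + 1) → Heis k c) :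
    weightChange c f (PiTensorProduct.tprod k x) =
      (∏ j, (((fibreList f x j).map (dual c)).prod + defect (fibreList f x j)) -
        ∏ j, ((fibreList f x j).map (dual c)).prod).snd := by
  rw [weightChange_apply, act_tprod, prod_fibreList, snd_sub]
  refine congrArg₂ (· - ·) ((weight_tprod b _).trans ?_) (weight_tprod a x)
  refine congrArg snd (Finset.prod_congr rfl fun j _ => ?_)
  exact (add_sub_cancel _ _).symm

/-- The map of tensor powers induced by the scaling of `z`. -/
noncomputable def scalePower (c c' l : k) (a : DeltaH) : power c a →ₗ[k] power c' a :=
  PiTensorProduct.map fun _ => scale c c' l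

theorem scalePower_tprod (c c' l : k) (a : DeltaH) (x : Fin (a.len + 1) → Heis k c) :
    scalePower c c' l a (PiTensorProduct.tprod k x) =
      PiTensorProduct.tprod k fun i => scale c c' l (x i) :=
  PiTensorProduct.map_tprod _ _

theorem scalePower_scalePower (c c' c'' l l' : k) (a : DeltaH) (t : power c a) :
    scalePower c' c'' l' a (scalePower c c' l a t) = scalePower c c'' (l' * l) a t := by
  suffices scalePower c' c'' l' a ∘ₗ scalePower c c' l a = scalePower c c'' (l' * l) a from
    DFunLike.congr_fun this t
  refine PiTensorProduct.ext (MultilinearMap.ext fun x => ?_)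
  refine (congrArg (scalePower c' c'' l' a) (scalePower_tprod c c' l a x)).trans ?_
  refine (scalePower_tprod c' c'' l' a _).trans (Eq.trans ?_ (scalePower_tprod _ _ _ a x).symm)
  exact congrArg _ (funext fun i => scale_scale c c' c'' l l' (x i))

/-- The map of bar constructions induced by the scaling of `z`. -/
noncomputable abbrev scaleBar {c c' : k} (l : k) (h : l * c = c') :
    (involutive k c).barConstruction ⟶ (involutive k c').barConstruction :=
  InvolutiveAlgebra.barConstructionMap (scaleHom l h)

theorem act_scalePower {c c' : k} (l : k) (h : l * c = c') {a b : DeltaH} (f : a ⟶ b)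
    (t : power c a) :
    act c' f (scalePower c c' l a t) = scalePower c c' l b (act c f t) :=
  (ConcreteCategory.congr_hom ((scaleBar l h).naturality f) t).symm

theorem weight_scalePower (c c' l : k) (a : DeltaH) (t : power c a) :
    weight c' a (scalePower c c' l a t) = l * weight c a t := by
  suffices weight c' a ∘ₗ scalePower c c' l a = l • weight c a from DFunLike.congr_fun this t
  refine PiTensorProduct.ext (MultilinearMap.ext fun x => ?_)
  refine (congrArg (weight c' a) (scalePower_tprod c c' l a x)).trans ?_
  refine (weight_tprod a _).trans (Eq.trans ?_ (congrArg (l * ·) (weight_tprod a x)).symm)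
  exact (prod_dual_scale Finset.univ (fun i => dual c (x i)) _ l
    (fun i => (fst_dual (scale c c' l (x i))).trans (fst_dual (x i)).symm)
    fun i => (snd_dual (scale c c' l (x i))).trans (congrArg (l * ·) (snd_dual (x i)).symm)).2

/-- A morphism changes the weight only through the defects of its fibres, which do not see `z` and
meet only constant terms of the other factors. So `z` may be killed beforehand, although this is in
general not a map of algebras. -/
theorem weightChange_scalePower (c : k) {a b : DeltaH} (f : a ⟶ b) (t : power c a) :
    weightChange c f (scalePower c c 0 a t) = weightChange c f t := by
  suffices weightChange c f ∘ₗ scalePower c c 0 a = weightChange c f from DFunLike.congr_fun this t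
  refine PiTensorProduct.ext (MultilinearMap.ext fun x => ?_)
  refine (congrArg (weightChange c f) (scalePower_tprod c c 0 a x)).trans ?_
  refine (weightChange_tprod f _).trans (Eq.trans ?_ (weightChange_tprod f x).symm)
  have hl (j) : fibreList f (fun i => scale c c 0 (x i)) j =
      (fibreList f x j).map (scale c c 0) :=
    (List.map_congr_left fun i _ => (scale_twist 0 (f.grp.label i) (x i)).symm).trans
      List.map_map.symm
  have hd (l : List (Heis k c)) := defect_map (scale c c 0) (by simp) (by simp) (by simp) l
  have hf (l : List (Heis k c)) :
      ((l.map (scale c c 0)).map (dual c)).prod.fst = ((l.map (dual c)).prod).fst := by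
    induction l with
    | nil => simp
    | cons u l ih => simp only [List.map_cons, List.prod_cons, fst_mul, ih, fst_dual, scale_a]
  have := (prod_add_sub_prod_congr Finset.univ
    (fun j => (((fibreList f x j).map (scale c c 0)).map (dual c)).prod)
    (fun j => ((fibreList f x j).map (dual c)).prod) (fun j => defect (fibreList f x j))
    (fun j => hf _) (fun j => fst_defect _)).1
  refine congrArg snd (Eq.trans ?_ this)
  simp only [hl, fun l => (hd l).1]

/-- The cocycle on the bar construction of `Heis k 0` that comes from its deformation
`Heis k 1`. -/
noncomputable def cocycle {a b : DeltaH} (f : a ⟶ b) : power (0 : k) a →ₗ[k] k :=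
  weightChange 1 f ∘ₗ scalePower 0 1 0 a

theorem cocycle_apply {a b : DeltaH} (f : a ⟶ b) (t : power (0 : k) a) :
    cocycle f t = weight 1 b (act 1 f (scalePower 0 1 0 a t)) -
      weight 1 a (scalePower 0 1 0 a t) := rfl

/-- Acting in `Heis k 0` or in `Heis k 1` gives the same result once `z` is killed, and the change
of weight under `g` does not see `z`. So it may be computed on the image under `f` in `Heis k 1`,
where it is a difference of two weights. -/
theorem cocycle_act {a b d : DeltaH} (f : a ⟶ b) (g : b ⟶ d) (t : power (0 : k) a) :
    cocycle g (act 0 f t) = weight 1 d (act 1 (f ≫ g) (scalePower 0 1 0 a t)) -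
      weight 1 b (act 1 f (scalePower 0 1 0 a t)) := by
  rw [act_comp]
  change weightChange 1 g (scalePower 0 1 0 b (act 0 f t)) =
    weightChange 1 g (act 1 f (scalePower 0 1 0 a t))
  rw [← weightChange_scalePower, ← weightChange_scalePower 1 g (act 1 f _),
    scalePower_scalePower]
  refine congrArg _ ?_
  have h : scalePower (1 : k) 1 0 b (act 1 f (scalePower 0 1 0 a t)) =
      scalePower 0 1 0 b (scalePower 1 0 0 b (act 1 f (scalePower 0 1 0 a t))) := by
    rw [scalePower_scalePower, mul_zero]
  rw [h, ← act_scalePower 0 (zero_mul 1), scalePower_scalePower, act_scalePower _ (by simp),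
    scalePower_scalePower]
  simp

/-- The algebra map `Heis k 1 → Heis k c` with $z\mapsto cz$ multiplies weights by $c$, so $c$ times
the cocycle is the change of weight in `Heis k c`. -/
theorem mul_cocycle_scalePower (c : k) {a b : DeltaH} (f : a ⟶ b) (t : power c a) :
    c * cocycle f (scalePower c 0 0 a t) = weight c b (act c f t) - weight c a t := by
  rw [cocycle_apply, mul_sub, ← weight_scalePower 1 c, ← weight_scalePower 1 c,
    ← act_scalePower c (mul_one c), scalePower_scalePower, scalePower_scalePower]
  simp only [mul_zero]
  exact weightChange_scalePower c f t

end Heis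

/-! ### Linear forms on homology and classes of pure tensors -/

namespace CoefficientHomology
open TensorProduct
variable {k : Type u} [CommRing k]

/-- The map `H_n(L ⊗ M) ⟶ M` induced by a linear form on `L_n` that vanishes on boundaries. -/
noncomputable def evalHom (L : ChainComplex (ModuleCat.{u} k) ℕ) (M : ModuleCat.{u} k) (n : ℕ)
    (f : L.X n →ₗ[k] k) (hf : ∀ y, f (L.d (n + 1) n y) = 0) :
    (tensObj L M).homology n →ₗ[k] M :=
  LinearMap.descend ((tensObj L M).sc n).cls (ShortComplex.cls_surjective _)
    ((TensorProduct.lid k M).toLinearMap ∘ₗ f.rTensor M ∘ₗ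
      (LinearMap.ker ((tensObj L M).sc n).g.hom).subtype) fun z hz => by
    obtain ⟨y, hy⟩ := (exists_sc_f_iff (tensObj L M) n z.1).1
      ((ShortComplex.cls_eq_zero_iff _ z).1 hz)
    have h : f ∘ₗ (L.d (n + 1) n).hom = 0 := LinearMap.ext hf
    have h' : f.rTensor M ∘ₗ (L.d (n + 1) n).hom.rTensor M = 0 := by
      rw [← LinearMap.rTensor_comp, h, LinearMap.rTensor_zero]
    refine (congrArg (fun t => TensorProduct.lid k M (f.rTensor M t)) hy.symm).trans ?_
    exact (congrArg (TensorProduct.lid k M) (DFunLike.congr_fun h' y)).trans (map_zero _)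

theorem evalHom_cls (L : ChainComplex (ModuleCat.{u} k) ℕ) (M : ModuleCat.{u} k) (n : ℕ)
    (f : L.X n →ₗ[k] k) (hf : ∀ y, f (L.d (n + 1) n y) = 0)
    (z : LinearMap.ker ((tensObj L M).sc n).g.hom) :
    evalHom L M n f hf (((tensObj L M).sc n).cls z) = TensorProduct.lid k M (f.rTensor M z.1) :=
  LinearMap.descend_apply _ _ _ _ z

/-- The homology class of `t ⊗ m`. -/
noncomputable def tmulCls (L : ChainComplex (ModuleCat.{u} k) ℕ) (M : ModuleCat.{u} k) (n : ℕ)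
    (t : L.X (n + 1)) (m : M) (h : L.d (n + 1) n t ⊗ₜ[k] m = 0) :
    (tensObj L M).homology (n + 1) :=
  ((tensObj L M).sc (n + 1)).cls ⟨t ⊗ₜ[k] m, (mem_ker_sc_iff (tensObj L M) n _).2 h⟩

theorem homMap_tmulCls {L L' : ChainComplex (ModuleCat.{u} k) ℕ} {M M' : ModuleCat.{u} k}
    (f : L ⟶ L') (g : M ⟶ M') (n : ℕ) (t : L.X (n + 1)) (m : M)
    (h : L.d (n + 1) n t ⊗ₜ[k] m = 0) (t' : L'.X (n + 1)) (ht : f.f (n + 1) t = t') (m' : M')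
    (hm : g m = m') (h' : L'.d (n + 1) n t' ⊗ₜ[k] m' = 0) :
    homMap f g (n + 1) (tmulCls L M n t m h) = tmulCls L' M' n t' m' h' := by
  subst ht hm
  exact ShortComplex.homologyMap_cls
    ((HomologicalComplex.shortComplexFunctor _ _ (n + 1)).map (tensMap f g)) ⟨t ⊗ₜ[k] m, _⟩
    ((mem_ker_sc_iff (tensObj L' M') n _).2 h')

end CoefficientHomology

/-! ### The cocycle on one-chains -/

namespace FunctorHomology
variable {k : Type u} [CommRing k] {C : Type} [SmallCategory C]
open scoped Classical

theorem complexMap_chain {F F' : C ⥤ ModuleCat.{u} k} (Ψ : F ⟶ F') (n : ℕ)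
    (s : ComposableArrows C n) (x : F.obj (s.obj 0)) :
    @Eq (chains F' n) ((complexMap Ψ).f n (chain F s x)) (chain F' s (Ψ.app _ x)) :=
  simplicialModuleMap_chain Ψ (.op (.mk n)) s x

theorem chain_zero_eq (F : C ⥤ ModuleCat.{u} k) (s : ComposableArrows C 0)
    (x : F.obj (s.obj 0)) : chain F s x = chain F (ComposableArrows.mk₀ (s.obj 0)) x := by
  obtain ⟨c, rfl⟩ := ComposableArrows.mk₀_surjective s
  rfl

theorem complex_d_one_chain (F : C ⥤ ModuleCat.{u} k) (s : ComposableArrows C 1)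
    (x : F.obj (s.obj 0)) :
    @Eq (chains F 0) ((complex F).d 1 0 (chain F s x))
      (chain F (ComposableArrows.mk₀ (s.obj 1)) (F.map (s.map (homOfLE (Fin.zero_le 1))) x) -
        chain F (ComposableArrows.mk₀ (s.obj 0)) x) := by
  refine (complex_d_apply F 0 _).trans ?_
  rw [Fin.sum_univ_two]
  have h₀ : simplicialMap F (m := .mk 0) (n := .mk 1) (SimplexCategory.δ 0) (chain F s x) =
      chain F (ComposableArrows.mk₀ (s.obj 1)) (F.map (s.map (homOfLE (Fin.zero_le 1))) x) :=
    (simplicialMap_lof F _ s x).trans (chain_zero_eq F _ _)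
  have h₁ : simplicialMap F (m := .mk 0) (n := .mk 1) (SimplexCategory.δ 1) (chain F s x) =
      chain F (ComposableArrows.mk₀ (s.obj 0)) x := by
    refine ((simplicialMap_lof F _ s x).trans (chain_zero_eq F _ _)).trans ?_
    refine congrArg (chain F (ComposableArrows.mk₀ (s.obj 0))) ?_
    have : F.map (s.map (homOfLE (Fin.zero_le (0 : Fin 2)))) = 𝟙 _ :=
      (congrArg F.map (s.map_id 0)).trans (F.map_id _)
    exact ConcreteCategory.congr_hom this x
  rw [h₀, h₁]
  simp [sub_eq_add_neg]

end FunctorHomology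

namespace Heis
open TensorProduct FunctorHomology
variable {k : Type u} [CommRing k]
open scoped Classical

/-- The bar construction of the Heisenberg algebra. -/
noncomputable abbrev bar (c : k) : DeltaH ⥤ ModuleCat.{u} k := (involutive k c).barConstruction

/-- The cocycle on the one-chains. -/
noncomputable def cocycleChain (k : Type u) [CommRing k] : chains (bar (0 : k)) 1 →ₗ[k] k :=
  DirectSum.toModule k _ _ fun s => cocycle (s.map (homOfLE (Fin.zero_le 1)))

theorem cocycleChain_chain (s : ComposableArrows DeltaH 1) (x : power (0 : k) (s.obj 0)) :
    cocycleChain k (chain (bar 0) s x) = cocycle (s.map (homOfLE (Fin.zero_le 1))) x :=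
  DirectSum.toModule_lof _ _ _

/-- The weight on the zero-chains. -/
noncomputable def weightChain (c : k) : chains (bar c) 0 →ₗ[k] k :=
  DirectSum.toModule k _ _ fun s => weight c (s.obj 0)

theorem weightChain_chain (c : k) (s : ComposableArrows DeltaH 0) (x : power c (s.obj 0)) :
    weightChain c (chain (bar c) s x) = weight c (s.obj 0) x :=
  DirectSum.toModule_lof _ _ _

/-- On an edge of a simplex the cocycle is the difference of the weights, in `Heis k 1`, of the
images of one element at the two vertices. The alternating sum over the edges of a triangle
therefore telescopes to zero. -/
theorem cocycleChain_simplicialMap {n : SimplexCategory} (θ : SimplexCategory.mk 1 ⟶ n)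
    (s : ComposableArrows DeltaH n.len) (x : power (0 : k) (s.obj 0)) :
    cocycleChain k (simplicialMap (bar 0) θ (chain (bar 0) s x)) =
      weight 1 _ (act 1 (s.map (homOfLE (Fin.zero_le (θ.toOrderHom 1)))) (scalePower 0 1 0 _ x)) -
      weight 1 _ (act 1 (s.map (homOfLE (Fin.zero_le (θ.toOrderHom 0)))) (scalePower 0 1 0 _ x)) := by
  refine (congrArg (cocycleChain k) (simplicialMap_lof (bar 0) θ s x)).trans ?_
  refine (cocycleChain_chain _ _).trans ?_
  have hle : θ.toOrderHom 0 ≤ θ.toOrderHom 1 := θ.toOrderHom.monotone (Fin.zero_le 1)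
  refine (cocycle_act (s.map (homOfLE (Fin.zero_le (θ.toOrderHom 0)))) (s.map (homOfLE hle))
    x).trans ?_
  rw [← s.map_comp]
  rfl

theorem cocycleChain_d (x : chains (bar (0 : k)) 2) :
    cocycleChain k ((complex (bar 0)).d 2 1 x) = 0 := by
  let D (i : Fin 3) : chains (bar (0 : k)) 2 →ₗ[k] chains (bar (0 : k)) 1 :=
    simplicialMap (bar (0 : k)) (m := .mk 1) (n := .mk 2) (SimplexCategory.δ i)
  suffices cocycleChain k ∘ₗ (∑ i : Fin 3, (-1 : ℤ) ^ (i : ℕ) • D i) = 0 from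
    (congrArg (cocycleChain k) (DFunLike.congr_fun (complex_d_hom (bar (0 : k)) 1) x)).trans
      (DFunLike.congr_fun this x)
  refine DirectSum.linearMap_ext _ fun s => LinearMap.ext fun x => ?_
  have h (i : Fin 3) := cocycleChain_simplicialMap (k := k) (n := .mk 2) (SimplexCategory.δ i) s x
  have h0 := h 0
  have h1 := h 1
  have h2 := h 2
  generalize hw : (fun j : Fin 3 => weight (1 : k) (s.obj j) (act 1 (s.map (homOfLE (Fin.zero_le j)))
    (scalePower 0 1 0 _ x))) = w at *
  have e0 : cocycleChain k (simplicialMap (bar (0 : k)) (m := .mk 1) (n := .mk 2)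
      (SimplexCategory.δ 0) (chain (bar 0) s x)) = w 2 - w 1 := by subst hw; exact h0
  have e1 : cocycleChain k (simplicialMap (bar (0 : k)) (m := .mk 1) (n := .mk 2)
      (SimplexCategory.δ 1) (chain (bar 0) s x)) = w 2 - w 0 := by subst hw; exact h1
  have e2 : cocycleChain k (simplicialMap (bar (0 : k)) (m := .mk 1) (n := .mk 2)
      (SimplexCategory.δ 2) (chain (bar 0) s x)) = w 1 - w 0 := by subst hw; exact h2
  rw [Fin.sum_univ_three]
  have (f₀ f₁ f₂ : chains (bar (0 : k)) 2 →ₗ[k] chains (bar (0 : k)) 1)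
      (y : chains (bar (0 : k)) 2) :
      (cocycleChain k ∘ₗ ((-1 : ℤ) ^ ((0 : Fin 3) : ℕ) • f₀ + (-1 : ℤ) ^ ((1 : Fin 3) : ℕ) • f₁ +
        (-1 : ℤ) ^ ((2 : Fin 3) : ℕ) • f₂)) y =
      cocycleChain k (f₀ y) - cocycleChain k (f₁ y) + cocycleChain k (f₂ y) := by
    simp [sub_eq_add_neg]
  refine (this (D 0) (D 1) (D 2) (chain (bar 0) s x)).trans ?_
  refine (congrArg₂ (· + ·) (congrArg₂ (· - ·) e0 e1) e2).trans ?_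
  change _ = (0 : k)
  ring

theorem mul_cocycleChain_chain (c : k) (s : ComposableArrows DeltaH 1)
    (x : power c (s.obj 0)) :
    c * cocycleChain k ((complexMap (scaleBar 0 (zero_mul c))).f 1 (chain (bar c) s x)) =
      weightChain c ((complex (bar c)).d 1 0 (chain (bar c) s x)) := by
  have h₁ : cocycleChain k ((complexMap (scaleBar 0 (zero_mul c))).f 1 (chain (bar c) s x)) =
      cocycle (s.map (homOfLE (Fin.zero_le 1))) (scalePower c 0 0 _ x) :=
    (congrArg (cocycleChain k) (complexMap_chain (scaleBar 0 (zero_mul c)) 1 s x)).trans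
      (cocycleChain_chain s _)
  have h₂ : weightChain c ((complex (bar c)).d 1 0 (chain (bar c) s x)) =
      weight c (s.obj 1) (act c (s.map (homOfLE (Fin.zero_le 1))) x) - weight c (s.obj 0) x :=
    (congrArg (weightChain c) (complex_d_one_chain (bar c) s x)).trans
      ((map_sub (weightChain c) _ _).trans
        (congrArg₂ (· - ·) (weightChain_chain c _ _) (weightChain_chain c _ _)))
  exact (congrArg (c * ·) h₁).trans ((mul_cocycle_scalePower c _ x).trans h₂.symm)

/-- Pulled back to `Heis k c`, the cocycle becomes after multiplication by $c$ the coboundary of the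
weight. Hence $c$ annihilates its values on cycles. -/
theorem mul_cocycleChain (c : k) (t : chains (bar c) 1) :
    c * cocycleChain k ((complexMap (scaleBar 0 (zero_mul c))).f 1 t) =
      weightChain c ((complex (bar c)).d 1 0 t) := by
  let f : chains (bar c) 1 →ₗ[k] chains (bar (0 : k)) 1 :=
    ((complexMap (scaleBar 0 (zero_mul c))).f 1).hom
  let d : chains (bar c) 1 →ₗ[k] chains (bar c) 0 := ((complex (bar c)).d 1 0).hom
  have : c • (cocycleChain k ∘ₗ f) = weightChain c ∘ₗ d :=
    DirectSum.linearMap_ext _ fun s => LinearMap.ext fun x => mul_cocycleChain_chain c s x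
  exact DFunLike.congr_fun this t

end Heis

/-! ### The divisibility forced by a natural splitting -/

section Naturality
open MonoidalCategory TensorProduct
variable {k : Type u} [CommRing k]

/-- The reduction of scalars modulo `c`. -/
noncomputable abbrev ModuleCat.reduction (c : k) :
    ModuleCat.of k k ⟶ ModuleCat.of k (k ⧸ Ideal.span {c}) :=
  ModuleCat.ofHom (Ideal.span {c}).mkQ

theorem ModuleCat.reduction_surjective (c : k) :
    Function.Surjective (ModuleCat.reduction c) := Submodule.mkQ_surjective _

theorem ModuleCat.whiskerLeft_reduction_surjective (X : ModuleCat.{u} k) (c : k) :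
    Function.Surjective (X ◁ ModuleCat.reduction c) :=
  LinearMap.lTensor_surjective X (ModuleCat.reduction_surjective c)

theorem ModuleCat.exists_smul_of_whiskerLeft_reduction (X : ModuleCat.{u} k) (c : k)
    (x : (X ⊗ ModuleCat.of k k : ModuleCat.{u} k)) (h : (X ◁ ModuleCat.reduction c) x = 0) :
    ∃ y : (X ⊗ ModuleCat.of k k : ModuleCat.{u} k), c • y = x := by
  have hex : Function.Exact (c • (LinearMap.id : k →ₗ[k] k)) (Ideal.span {c}).mkQ := fun r => by
    rw [Submodule.mkQ_apply, Submodule.Quotient.mk_eq_zero, Ideal.mem_span_singleton']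
    refine exists_congr fun a => ?_
    simp [mul_comm]
  obtain ⟨y, hy⟩ := ((lTensor_exact X hex (Submodule.mkQ_surjective _)) x).1 h
  refine ⟨y, Eq.trans ?_ hy⟩
  rw [LinearMap.lTensor_smul, LinearMap.lTensor_id]
  rfl

namespace UniversalCoefficientSequences

/-- The module `k` is projective, so the $\mathrm{Tor}_1$ term of its sequence vanishes. -/
theorem ι_surjective (S : UniversalCoefficientSequences k) (A : InvolutiveAlgebra k)
    (hA : Module.Flat k A) (n : ℕ) :
    Function.Surjective (S.ι A hA (ModuleCat.of k k) (n + 1)) := by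
  have : Projective (ModuleCat.of k k) := (IsProjective.iff_projective _).1 inferInstance
  have h : Limits.IsZero (((Tor (ModuleCat.{u} k) 1).obj (HO A n)).obj (ModuleCat.of k k)) :=
    isZero_Tor_succ_of_projective _ _ _ 0
  have := (S.shortExact A hA (ModuleCat.of k k) n).exact.epi_f (h.eq_of_tgt _ _)
  exact (ModuleCat.epi_iff_surjective _).1 this

/-- If the reduction of an integral class of `B` comes from `A` with coefficients $k/c$, natural
retractions force the corresponding elements of $HO(B)\otimes k/c$ to agree as well. The one from
`A` lifts to $HO(A)\otimes k$, where `F` vanishes after `φ`; the difference is a multiple of $c$.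
The map `ψ` accompanies the reduction of coefficients. -/
theorem NaturalSplitting.dvd {S : UniversalCoefficientSequences k} {c : k} {n : ℕ}
    (N : S.NaturalSplitting (ModuleCat.of k (k ⧸ Ideal.span {c})) n) {A B : InvolutiveAlgebra k}
    (hA : Module.Projective k A) (hB : Module.Projective k B) (φ : A →⋆ₐ[k] B) (ψ : B →⋆ₐ[k] B)
    (F : HOCoeff B (ModuleCat.of k k) (n + 1) →ₗ[k] k)
    (hF : ∀ x, F (HOCoeffMap φ (𝟙 _) (n + 1) x) = 0)
    (e : HOCoeff B (ModuleCat.of k k) (n + 1))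
    (ε : HOCoeff A (ModuleCat.of k (k ⧸ Ideal.span {c})) (n + 1))
    (h : HOCoeffMap ψ (ModuleCat.reduction c) (n + 1) e = HOCoeffMap φ (𝟙 _) (n + 1) ε) :
    c ∣ F (HOCoeffMap ψ (𝟙 _) (n + 1) e) := by
  have fA : Module.Flat k A := .of_projective
  have fB : Module.Flat k B := .of_projective
  obtain ⟨w, rfl⟩ := S.ι_surjective B fB n e
  let r := (N.splitting A hA).r ε
  obtain ⟨α, hα⟩ := ModuleCat.whiskerLeft_reduction_surjective (HO A (n + 1)) c r
  -- The retraction for `B` is applied to `h`: on the left it undoes `ι`, on the right naturality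
  -- carries it back to `A`.
  have h₁ : (HOMap ψ (n + 1) ⊗ₘ ModuleCat.reduction c) w = (HOMap φ (n + 1) ▷ _) r := by
    refine Eq.trans ?_ (ConcreteCategory.congr_hom (N.naturality hA hB φ) ε)
    refine Eq.trans ?_ (congrArg (N.splitting B hB).r h)
    refine Eq.trans ?_ (congrArg (N.splitting B hB).r
      (ConcreteCategory.congr_hom (S.ι_naturality fB fB ψ (ModuleCat.reduction c) (n + 1)) w)).symm
    exact (ConcreteCategory.congr_hom (N.splitting B hB).f_r _).symm
  have h₂ : (HO B (n + 1) ◁ ModuleCat.reduction c)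
      ((HOMap ψ (n + 1) ▷ _) w - (HOMap φ (n + 1) ▷ _) α) = 0 := by
    refine (map_sub (HO B (n + 1) ◁ ModuleCat.reduction c).hom _ _).trans (sub_eq_zero.2 ?_)
    refine Eq.trans ?_ (h₁.trans ?_)
    · exact ConcreteCategory.congr_hom (MonoidalCategory.tensorHom_def _ _).symm w
    · refine (congrArg (HOMap φ (n + 1) ▷ _) hα.symm).trans ?_
      exact ConcreteCategory.congr_hom (whisker_exchange (HOMap φ (n + 1))
        (ModuleCat.reduction c)) α
  -- Both elements lie in $HO(B)\otimes k$ and agree modulo $c$, so their difference is $c\,y$;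
  -- applying `F` through `ι` gives the divisibility.
  obtain ⟨y, hy⟩ := ModuleCat.exists_smul_of_whiskerLeft_reduction _ c _ h₂
  have hι {A' : InvolutiveAlgebra k} (f' : Module.Flat k A') (χ : A' →⋆ₐ[k] B)
      (v : (HO A' (n + 1) ⊗ ModuleCat.of k k : ModuleCat.{u} k)) :
      HOCoeffMap χ (𝟙 _) (n + 1) (S.ι A' f' _ (n + 1) v) =
        S.ι B fB _ (n + 1) ((HOMap χ (n + 1) ▷ _) v) :=
    (ConcreteCategory.congr_hom (S.ι_naturality f' fB χ (𝟙 _) (n + 1)) v).trans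
      (congrArg (S.ι B fB _ (n + 1))
        (ConcreteCategory.congr_hom (tensorHom_id (HOMap χ (n + 1)) _) v))
  refine ⟨F (S.ι B fB _ (n + 1) y), ?_⟩
  let G : (HO B (n + 1) ⊗ ModuleCat.of k k : ModuleCat.{u} k) →ₗ[k] k :=
    F ∘ₗ (S.ι B fB (ModuleCat.of k k) (n + 1)).hom
  have h₃ : c * G y = G ((HOMap ψ (n + 1) ▷ _) w) - G ((HOMap φ (n + 1) ▷ _) α) :=
    (map_smul G c y).symm.trans ((congrArg G hy).trans (map_sub G _ _))
  have h₄ : G ((HOMap φ (n + 1) ▷ _) α) = 0 := (congrArg F (hι fA φ α)).symm.trans (hF _)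
  rw [h₄, sub_zero] at h₃
  exact (congrArg F (hι fB ψ w)).trans h₃.symm

end UniversalCoefficientSequences
end Naturality

/-! ### The commutator class -/

namespace Heis
open TensorProduct FunctorHomology CoefficientHomology
variable {k : Type u} [CommRing k]
open scoped Classical

/-- The morphism `[1] ⟶ [0]` that multiplies two factors in the order given by `σ`. -/
def mulHom (σ : Equiv.Perm (Fin 2)) : (⟨1⟩ : DeltaH) ⟶ ⟨0⟩ :=
  show DeltaH.Hom ⟨1⟩ ⟨0⟩ from ⟨OrderHom.const _ 0, ⟨fun _ => 1, σ⟩⟩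

/-- The tensor `x ⊗ y`. -/
noncomputable def genTensor (c : k) : power c ⟨1⟩ :=
  PiTensorProduct.tprod k (![⟨0, 1, 0, 0⟩, ⟨0, 0, 1, 0⟩] : Fin 2 → Heis k c)

/-- The element `z` in the zeroth degree of the bar construction. -/
noncomputable def zTensor (c : k) : power c ⟨0⟩ :=
  PiTensorProduct.tprod k fun _ => (⟨0, 0, 0, 1⟩ : Heis k c)

theorem tprod_smul_z (c r : k) :
    PiTensorProduct.tprod k (fun _ : Fin 1 => (⟨0, 0, 0, r⟩ : Heis k c)) = r • zTensor c := by
  have h := MultilinearMap.map_smul_univ (PiTensorProduct.tprod k) (fun _ : Fin 1 => r)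
    (fun _ : Fin 1 => (⟨0, 0, 0, 1⟩ : Heis k c))
  refine Eq.trans (congrArg _ (funext fun _ => ?_)) (h.trans ?_)
  · ext <;> simp
  · rw [Finset.prod_const, Finset.card_fin, pow_one]
    rfl

theorem act_mulHom (c : k) (σ : Equiv.Perm (Fin 2)) (r : k)
    (h : (![⟨0, 1, 0, 0⟩, ⟨0, 0, 1, 0⟩] : Fin 2 → Heis k c) (σ.symm 0) *
      (![⟨0, 1, 0, 0⟩, ⟨0, 0, 1, 0⟩] : Fin 2 → Heis k c) (σ.symm 1) = ⟨0, 0, 0, r⟩) :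
    act c (mulHom σ) (genTensor c) = r • zTensor c := by
  refine (act_tprod _ _).trans (Eq.trans (congrArg _ (funext fun j => ?_)) (tprod_smul_z c r))
  have : InvolutiveAlgebra.fibre (mulHom σ) j = [σ.symm 0, σ.symm 1] := by
    obtain rfl : j = 0 := Subsingleton.elim (α := Fin 1) _ _
    rfl
  refine (congrArg (fun l : List (Fin 2) => (l.map fun i => twist 1
    ((![⟨0, 1, 0, 0⟩, ⟨0, 0, 1, 0⟩] : Fin 2 → Heis k c) i)).prod) this).trans (Eq.trans ?_ h)
  refine congrArg₂ (· * ·) ((involutive k c).twist_one _) ?_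
  exact (mul_one _).trans ((involutive k c).twist_one _)

theorem act_mulHom_refl (c : k) : act c (mulHom (Equiv.refl _)) (genTensor c) = c • zTensor c :=
  act_mulHom c _ c (by ext <;> simp)

theorem act_mulHom_swap (c : k) :
    act c (mulHom (Equiv.swap 0 1)) (genTensor c) = (-c) • zTensor c :=
  act_mulHom c _ (-c) (by ext <;> simp)

theorem scalePower_genTensor (c c' l : k) :
    scalePower c c' l _ (genTensor c) = genTensor c' := by
  refine (scalePower_tprod _ _ _ _ _).trans (congrArg _ (funext fun i => ?_))
  fin_cases i <;> ext <;> simp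

/-- The chain that compares the products `y x` and `x y`. -/
noncomputable def commChain (c : k) : chains (bar c) 1 :=
  chain (bar c) (ComposableArrows.mk₁ (mulHom (Equiv.swap 0 1))) (genTensor c) -
    chain (bar c) (ComposableArrows.mk₁ (mulHom (Equiv.refl _))) (genTensor c)

/-- The two copies of $x\otimes y$ at the source cancel, and the boundary is $yx-xy=-2cz$.
Divisibility by $c$ makes the chain a cycle with coefficients killed by $c$. -/
theorem complex_d_commChain (c : k) : ∃ y : chains (bar c) 0,
    @Eq (chains (bar c) 0) ((complex (bar c)).d 1 0 (commChain c)) (c • y) := by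
  let s := ComposableArrows.mk₀ (⟨0⟩ : DeltaH)
  let i : power c ⟨0⟩ →ₗ[k] chains (bar c) 0 :=
    DirectSum.lof k _ (fun s : ComposableArrows DeltaH 0 => (bar c).obj (s.obj 0)) s
  let x : chains (bar c) 0 := chain (bar c) (ComposableArrows.mk₀ (⟨1⟩ : DeltaH)) (genTensor c)
  have key (σ : Equiv.Perm (Fin 2)) (r : k)
      (h : act c (mulHom σ) (genTensor c) = r • zTensor c) :
      @Eq (chains (bar c) 0) ((complex (bar c)).d 1 0
        (chain (bar c) (ComposableArrows.mk₁ (mulHom σ)) (genTensor c)))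
        (r • i (zTensor c) - x) :=
    (complex_d_one_chain (bar c) (ComposableArrows.mk₁ (mulHom σ)) (genTensor c)).trans
      (congrArg (· - x) ((congrArg i h).trans (map_smul i r _)))
  refine ⟨(-2 : k) • i (zTensor c), ?_⟩
  refine (map_sub ((complex (bar c)).d 1 0).hom _ _).trans ?_
  refine (congrArg₂ (fun u v : chains (bar c) 0 => u - v) (key _ _ (act_mulHom_swap c))
    (key _ _ (act_mulHom_refl c))).trans ?_
  module

theorem complexMap_commChain {c c' : k} (l : k) (h : l * c = c') :
    @Eq (chains (bar c') 1) ((complexMap (scaleBar l h)).f 1 (commChain c)) (commChain c') := by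
  refine (map_sub ((complexMap (scaleBar l h)).f 1).hom _ _).trans ?_
  have key (σ : Equiv.Perm (Fin 2)) : @Eq (chains (bar c') 1) ((complexMap (scaleBar l h)).f 1
      (chain (bar c) (ComposableArrows.mk₁ (mulHom σ)) (genTensor c)))
      (chain (bar c') (ComposableArrows.mk₁ (mulHom σ)) (genTensor c')) :=
    (complexMap_chain (scaleBar l h) 1 (ComposableArrows.mk₁ (mulHom σ)) (genTensor c)).trans
      (congrArg (chain (bar c') (ComposableArrows.mk₁ (mulHom σ))) (scalePower_genTensor c c' l))
  exact congrArg₂ (fun u v : chains (bar c') 1 => u - v) (key _) (key _)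

theorem weight_zTensor (c : k) : weight c ⟨0⟩ (zTensor c) = 1 :=
  (weight_tprod _ _).trans (by simp)

/-- The weight of the source cancels; in `Heis k 1` one has $yx-xy=-2z$, and `z` has weight one. -/
theorem cocycleChain_commChain : cocycleChain k (commChain 0) = -2 := by
  have key (σ : Equiv.Perm (Fin 2)) (r : k)
      (h : act 1 (mulHom σ) (genTensor 1) = r • zTensor (1 : k)) :
      cocycleChain k (chain (bar 0) (ComposableArrows.mk₁ (mulHom σ)) (genTensor 0)) =
        r - weight 1 ⟨1⟩ (genTensor (1 : k)) := by
    refine (cocycleChain_chain _ _).trans ((cocycle_apply (mulHom σ) (genTensor 0)).trans ?_)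
    rw [scalePower_genTensor, h, map_smul, weight_zTensor, smul_eq_mul, mul_one]
  refine (map_sub (cocycleChain k) _ _).trans ?_
  refine (congrArg₂ (· - ·) (key _ _ (act_mulHom_swap 1)) (key _ _ (act_mulHom_refl 1))).trans ?_
  ring

theorem complex_d_commChain_tmul {M : ModuleCat.{u} k} (c : k) (m : M) (hm : c • m = 0) :
    (complex (bar c)).d 1 0 (commChain c) ⊗ₜ[k] m = 0 := by
  obtain ⟨y, hy⟩ : ∃ y : (complex (bar c)).X 0,
    (complex (bar c)).d 1 0 (commChain c) = c • y := complex_d_commChain c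
  refine (congrArg (· ⊗ₜ[k] m) hy).trans ((TensorProduct.smul_tmul c y m).trans ?_)
  rw [hm, TensorProduct.tmul_zero]

/-- The linear form on `HO_1(Heis k 0; k)` given by the cocycle. -/
noncomputable def cocycleForm (k : Type u) [CommRing k] :
    HOCoeff (involutive k (0 : k)) (ModuleCat.of k k) 1 →ₗ[k] k :=
  evalHom (complex (bar 0)) (ModuleCat.of k k) 1 (cocycleChain k) cocycleChain_d

/-- By `mul_cocycleChain`, $c$ times the value is the weight of the boundary of a cycle, hence zero;
in a domain $c\ne 0$ can be cancelled. -/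
theorem cocycleForm_scaleHom [IsDomain k] {c : k} (hc : c ≠ 0)
    (x : HOCoeff (involutive k c) (ModuleCat.of k k) 1) :
    cocycleForm k (HOCoeffMap (scaleHom 0 (zero_mul c)) (𝟙 _) 1 x) = 0 := by
  obtain ⟨z, rfl⟩ := ShortComplex.cls_surjective _ x
  let f : chains (bar c) 1 →ₗ[k] chains (bar (0 : k)) 1 :=
    ((complexMap (scaleBar 0 (zero_mul c))).f 1).hom
  let d : chains (bar c) 1 →ₗ[k] chains (bar c) 0 := ((complex (bar c)).d 1 0).hom
  let t : chains (bar c) 1 ⊗[k] k := z.1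
  have ht : d.rTensor k t = 0 :=
    (mem_ker_sc_iff (tensObj (complex (bar c)) (ModuleCat.of k k)) 0 z.1).1 z.2
  have h : c • (cocycleChain k ∘ₗ f) = weightChain c ∘ₗ d := LinearMap.ext (mul_cocycleChain c)
  have hx : cocycleForm k (HOCoeffMap (scaleHom 0 (zero_mul c)) (𝟙 _) 1
      (((tensObj (complex (bar c)) (ModuleCat.of k k)).sc 1).cls z)) =
      TensorProduct.lid k k ((cocycleChain k).rTensor k (f.rTensor k t)) := by
    let Φ := (HomologicalComplex.shortComplexFunctor _ _ 1).map
      (tensMap (complexMap (scaleBar 0 (zero_mul c))) (𝟙 (ModuleCat.of k k)))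
    have hz := ShortComplex.mem_ker_of_hom Φ z
    refine (congrArg (cocycleForm k) (ShortComplex.homologyMap_cls Φ z hz)).trans ?_
    refine (evalHom_cls (complex (bar 0)) (ModuleCat.of k k) 1 _ cocycleChain_d ⟨_, hz⟩).trans ?_
    exact congrArg (fun v => TensorProduct.lid k k ((cocycleChain k).rTensor k v))
      (ConcreteCategory.congr_hom (tensMap_f (complexMap (scaleBar 0 (zero_mul c)))
        (𝟙 (ModuleCat.of k k)) 1) z.1)
  refine hx.trans ?_
  refine (mul_eq_zero.1 (?_ : c * _ = 0)).resolve_left hc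
  have h' : c • ((cocycleChain k).rTensor k ∘ₗ f.rTensor k) =
      (weightChain c).rTensor k ∘ₗ d.rTensor k := by
    rw [← LinearMap.rTensor_comp, ← LinearMap.rTensor_comp, ← h, LinearMap.rTensor_smul]
  refine (map_smul (TensorProduct.lid k k) c _).symm.trans ?_
  refine (congrArg (TensorProduct.lid k k) (DFunLike.congr_fun h' t)).trans ?_
  refine (congrArg (fun v => TensorProduct.lid k k ((weightChain c).rTensor k v)) ht).trans ?_
  rw [map_zero, map_zero]

/-- The class of the commutator of `x` and `y` in homology with coefficients killed by `c`. -/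
noncomputable def commClass (c : k) {M : ModuleCat.{u} k} (m : M) (hm : c • m = 0) :
    HOCoeff (involutive k c) M 1 :=
  tmulCls (complex (bar c)) M 0 (commChain c) m (complex_d_commChain_tmul c m hm)

theorem HOCoeffMap_commClass {c c' : k} (l : k) (h : l * c = c') {M M' : ModuleCat.{u} k}
    (g : M ⟶ M') (m : M) (hm : c • m = 0) (hm' : c' • g m = 0) :
    HOCoeffMap (scaleHom l h) g 1 (commClass c m hm) = commClass c' (g m) hm' :=
  homMap_tmulCls (complexMap (scaleBar l h)) g 0 (commChain c) m _ _ (complexMap_commChain l h) _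
    rfl (complex_d_commChain_tmul c' _ hm')

theorem cocycleForm_commClass (r : k) (hr : (0 : k) • r = 0) :
    cocycleForm k (commClass (M := ModuleCat.of k k) (0 : k) r hr) = -2 * r := by
  have h : cocycleForm k (commClass (M := ModuleCat.of k k) (0 : k) r hr) =
      cocycleChain k (commChain 0) • r :=
    evalHom_cls (complex (bar (0 : k))) (ModuleCat.of k k) 1 (cocycleChain k) cocycleChain_d _
  rw [h, cocycleChain_commChain, smul_eq_mul]

end Heis

/-! ### Nonexistence of natural splittings and the theorem -/

section MainTheorem
open FunctorHomology CoefficientHomology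

namespace Heis

/-- The commutator classes of `Heis k c` and `Heis k 0` with coefficients $k/c$ have the same image
in `Heis k 0`, and the latter lifts to `k`, where the cocycle form takes the value $-2$. The
endomorphism of `Heis k 0` that kills `z` fixes this lift. -/
theorem isEmpty_naturalSplitting {k : Type u} [CommRing k] [IsDomain k] {c : k}
    (hc : c ≠ 0) (hc₂ : ¬ c ∣ 2) (S : UniversalCoefficientSequences k) :
    IsEmpty (S.NaturalSplitting (ModuleCat.of k (k ⧸ Ideal.span {c})) 0) := by
  refine ⟨fun N => hc₂ ?_⟩
  have hm : c • ModuleCat.reduction c (1 : k) = 0 := by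
    refine (map_smul (ModuleCat.reduction c).hom c (1 : k)).symm.trans ?_
    refine (Submodule.Quotient.mk_eq_zero _).2 ?_
    rw [smul_eq_mul, mul_one]
    exact Ideal.mem_span_singleton_self c
  let e : HOCoeff (involutive k (0 : k)) (ModuleCat.of k k) 1 := commClass 0 (1 : k)
    (zero_smul k _)
  have h₁ := HOCoeffMap_commClass 0 (zero_mul (0 : k)) (ModuleCat.reduction c) (1 : k)
    (zero_smul k _)
    (zero_smul k _)
  have h₂ := HOCoeffMap_commClass 0 (zero_mul c) (𝟙 _) (ModuleCat.reduction c (1 : k)) hm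
    (zero_smul k _)
  have h₃ := HOCoeffMap_commClass 0 (zero_mul (0 : k)) (𝟙 (ModuleCat.of k k)) (1 : k)
    (zero_smul k _)
    (zero_smul k _)
  have h := N.dvd (inferInstanceAs (Module.Projective k (Heis k c)))
    (inferInstanceAs (Module.Projective k (Heis k 0))) (scaleHom 0 (zero_mul c))
    (scaleHom 0 (zero_mul 0)) (cocycleForm k) (cocycleForm_scaleHom hc) e _ (h₁.trans h₂.symm)
  have he := (congrArg (cocycleForm k) h₃).trans (cocycleForm_commClass (1 : k) (zero_smul k _))
  rw [mul_one] at he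
  exact dvd_neg.1 (he ▸ h)

end Heis

theorem mainTheorem7 :
    (∀ (k : Type u) [CommRing k],
      ∃ U : ∀ (A : InvolutiveAlgebra k) (_ : Module.Flat k A) (M : ModuleCat.{u} k),
          UniversalCoefficientSpectralSequence A M,
        weakGlobalDimension k ≤ 1 →
          ∃ S : UniversalCoefficientSequences k,
            (∀ (A : InvolutiveAlgebra k) (hA : Module.Flat k A) (M : ModuleCat.{u} k) (n : ℕ),
              LinearMap.range (S.ι A hA M n).hom = (U A hA M).converges.filtration n 0) ∧
            (IsHereditary k →
              ∀ (A : InvolutiveAlgebra k) (hA : Module.Flat k A), Module.Projective k A →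
                ∀ (M : ModuleCat.{u} k) (n : ℕ), Nonempty (S.sequence A hA M n).Splitting)) ∧
    (∃ (k : Type u) (_ : CommRing k), weakGlobalDimension k ≤ 1 ∧ IsHereditary k ∧
      ∃ (M : ModuleCat.{u} k) (n : ℕ), ∀ S : UniversalCoefficientSequences k,
        IsEmpty (S.NaturalSplitting M n)) := by
  refine ⟨fun k _ => ⟨universalCoefficientSpectralSequence, fun hk =>
    ⟨universalCoefficientSequences hk, range_HOuniv, fun hk' A hA hA' M n =>
      hk'.nonempty_splitting hk A hA hA' M n⟩⟩, ULift.{u} ℤ, inferInstance, ?_⟩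
  have h : IsHereditary (ULift.{u} ℤ) := isHereditary_of_isPrincipalIdealRing
  -- The obstruction is the value $-2$, so any nonzero $c$ that does not divide $2$ works; here
  -- $c=3$. Index `0` means degree one.
  refine ⟨h.weakGlobalDimension_le_one, h, _, 0,
    Heis.isEmpty_naturalSplitting (c := ⟨3⟩) ?_ ?_⟩
  · exact fun h => absurd (congrArg ULift.down h) (by decide)
  · rintro ⟨r, hr⟩
    have : (2 : ℤ) = 3 * r.down := congrArg ULift.down hr
    omega

end MainTheorem
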